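/- Let $X=L^2(0,\infty)$ and let $\lambda^1$ be Lebesgue measure on $\mathbb R$; measures $w(z)\lambda^1$ with $w$ supported on $(-\infty,0]$ are regarded as Borel measures on $\mathbb C$. For an operator $A$ generating a $C_0$-semigroup $T$ on $X$ and $s\in\rho(A)$, let $R(s,A)=(sI-A)^{-1}$ and let $X_{-1}$ be the completion of $X$ in the norm $\|R(s,A)x\|_X$; $A_{-1}$ and $T_{-1}$ denote the continuous extensions of $A$ (with domain $X$) and $T$ to $X_{-1}$. For self-adjoint $A$, $X_{-1}$ is identified with a space of functionals on $D(A)=D(A^*)$ by continuous extension of the inner product of $X$. An element $b\in X_{-1}$ is *finite-time $L^p$-admissible* if for every $t\ge 0$ there is $C>0$ such that for all $u\in L^p(0,t)$ the Bochner integral $\int_0^t T_{-1}(t-r)b\,u(r)\,dr$ in $X_{-1}$ lies in $X$ and has $X$-norm at most $C\|u\|_{L^p(0,t)}$. Let $E$ and $E_{-1}$ be the spectral measures of $A$ and $A_{-1}$, let $E_{g,g}=\langle E(\cdot)g,g\rangle_X$, and for $b\in X_{-1}$ let $$\mu_b(S)=\int_S(1+|z|^2)\,d\langle E_{-1}(z)b,b\rangle_{X_{-1}}\qquad(S\subseteq\mathbb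 C\text{ Borel}).$$ Two measures are called equivalent here if they are mutually absolutely continuous with Radon–Nikodym densities bounded away from $0$ and $\infty$. Write $(\mathcal Sf)(x)=\int_0^\infty f(\xi)\sin(x\xi)\,d\xi$ and $(\mathcal Cf)(x)=\int_0^\infty f(\xi)\cos(x\xi)\,d\xi$ for $f\in L^1\cap L^2$. **(Dirichlet)** Let $A=\frac{d^2}{dx^2}$ with $D(A)=H^2(0,\infty)\cap H^1_0(0,\infty)$, and let $b=\delta_0'$, i.e. $\langle\delta_0',\varphi\rangle=-\varphi'(0)$. Then: 1. every $z\in\mathbb C\setminus(-\infty,0]$ lies in $\rho(A)$ and for $g\in L^1\cap L^2$ $$(R(z,A)g)(x)=\frac2\pi\int_0^\infty\frac{\sin(x\eta)}{z+\eta^2}(\mathcal Sg)(\eta)\,d\eta\quad\text{for a.e. }x>0;$$ 2. $A$ has a spectral measure $E$, and for $g\in L^1\cap L^2$ $$E_{g,g}=\chi_{(-\infty,0]}(z)\,\frac{|(\mathcal Sg)(\sqrt{|z|})|^2}{\pi\sqrt{|z|}}\,\lambda^1(z);$$ moreover $\mathcal S$ extends to a bounded operator on $L^2(0,\infty)$,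 and with this extension the formula holds for all $g\in L^2(0,\infty)$; 3. $(\mathcal S\delta_0')(t)=\langle\delta_0',\sin(t\,\cdot)\rangle=-t$, so that $\chi_{(-\infty,0]}(z)\frac{|(\mathcal S\delta_0')(\sqrt{|z|})|^2}{\sqrt{|z|}}\lambda^1(z)=\chi_{(-\infty,0]}(z)|z|^{1/2}\lambda^1(z)$; 4. $A$ generates a $C_0$-semigroup on $X$ and, for every $s\in\rho(A)$, $\delta_0'$ defines a unique element $b$ of $X_{-1}$, $A_{-1}$ has a spectral measure $E_{-1}$ and $\mu_b$ is equivalent to $\chi_{(-\infty,0]}(z)|z|^{1/2}\lambda^1(z)$; 5. $b=\delta_0'$ is finite-time $L^p$-admissible for every $p\in(4,\infty]$. **(Neumann)** Let $A=\frac{d^2}{dx^2}$ with $D(A)=\{f\in H^2(0,\infty): f'(0)=0\}$, and let $b=\delta_0$. Then 1 and 2 hold with $\sin$ and $\mathcal S$ replaced by $\cos$ and $\mathcal C$; $(\mathcal C\delta_0)(t)=\langle\delta_0,\cos(t\,\cdot)\rangle=1$ for all $t$, so that $\chi_{(-\infty,0]}(z)\frac{|(\mathcal C\delta_0)(\sqrt{|z|})|^2}{\sqrt{|z|}}\lambda^1(z)=\chi_{(-\infty,0]}(z)|z|^{-1/2}\lambda^1(z)$;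 $A$ generates a $C_0$-semigroup on $X$ and, for every $s\in\rho(A)$, $\delta_0$ defines a unique element $b$ of $X_{-1}$, $A_{-1}$ has a spectral measure and $\mu_b$ is equivalent to $\chi_{(-\infty,0]}(z)|z|^{-1/2}\lambda^1(z)$; and $b=\delta_0$ is finite-time $L^p$-admissible for every $p\in(4/3,\infty]$. -/

import Mathlib

open MeasureTheory Set Filter Topology
open scoped ENNReal ContDiff InnerProductSpace ComplexConjugate

noncomputable section

namespace HalfLine

/-! ### Unbounded operators: resolvents, semigroups, spectral measures -/

section Operators

variable {X : Type} [NormedAddCommGroup X] [InnerProductSpace ℂ X]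

/-- `R` is a bounded two-sided inverse of `z I - A`. -/
def IsResolventAt (A : X →ₗ.[ℂ] X) (z : ℂ) (R : X →L[ℂ] X) : Prop :=
  (∀ x : X, ∃ h : R x ∈ A.domain, z • R x - A ⟨R x, h⟩ = x) ∧
    ∀ x : A.domain, R (z • (x : X) - A x) = x

/-- The resolvent set `ρ(A)`. -/
def resolventSet (A : X →ₗ.[ℂ] X) : Set ℂ := {z | ∃ R : X →L[ℂ] X, IsResolventAt A z R}

open Classical in
/-- The resolvent `R(z, A) = (z I - A)⁻¹`, with the junk value `0` off the resolvent set. -/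
def resolvent (A : X →ₗ.[ℂ] X) (z : ℂ) : X →L[ℂ] X :=
  if h : ∃ R : X →L[ℂ] X, IsResolventAt A z R then h.choose else 0

variable (X) in
/-- A strongly continuous semigroup on `X`; only the values at times `t ≥ 0` matter. -/
structure C0Semigroup where
  toFun : ℝ → X →L[ℂ] X
  map_zero : toFun 0 = 1
  map_add : ∀ s t : ℝ, 0 ≤ s → 0 ≤ t → toFun (s + t) = toFun s * toFun t
  tendsto_zero : ∀ x : X, Tendsto (fun t => toFun t x) (𝓝[>] 0) (𝓝 x)

/-- `A` is the generator of `T`: `x ∈ D(A)` with `A x = y` iff `(T(t) x - x) / t → y` as `t ↓ 0`. -/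
def IsGenerator (A : X →ₗ.[ℂ] X) (T : C0Semigroup X) : Prop :=
  ∀ x y : X, (x, y) ∈ A.graph ↔
    Tendsto (fun t : ℝ => ((t⁻¹ : ℝ) : ℂ) • (T.toFun t x - x)) (𝓝[>] 0) (𝓝 y)

variable [CompleteSpace X]

variable (X) in
/-- A projection-valued measure on the Borel sets of `ℂ`; only values at Borel sets matter. -/
structure ProjectionValuedMeasure where
  toFun : Set ℂ → X →L[ℂ] X
  isStarProjection : ∀ S, MeasurableSet S → IsStarProjection (toFun S)
  map_univ : toFun univ = 1
  map_inter : ∀ S S', MeasurableSet S → MeasurableSet S' →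
    toFun (S ∩ S') = toFun S * toFun S'
  hasSum : ∀ f : ℕ → Set ℂ, (∀ n, MeasurableSet (f n)) → Pairwise (Function.onFun Disjoint f) →
    ∀ x : X, HasSum (fun n => toFun (f n) x) (toFun (⋃ n, f n) x)

theorem ProjectionValuedMeasure.inner_self_nonneg (E : ProjectionValuedMeasure X) {S : Set ℂ}
    (hS : MeasurableSet S) (x : X) : 0 ≤ (inner ℂ x (E.toFun S x)).re := by
  have h := E.isStarProjection S hS
  have h1 : E.toFun S x = E.toFun S (E.toFun S x) := by
    conv_lhs => rw [← h.isIdempotentElem.eq]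
    rfl
  have h2 : inner ℂ x (E.toFun S x) = inner ℂ (E.toFun S x) (E.toFun S x) := by
    conv_lhs => rw [h1]
    rw [← ContinuousLinearMap.adjoint_inner_left, ← ContinuousLinearMap.star_eq_adjoint,
      h.isSelfAdjoint.star_eq]
  rw [h2]
  exact _root_.inner_self_nonneg (𝕜 := ℂ)

/-- The scalar measure `E_{x,x}(S) = ⟨E(S) x, x⟩`. -/
def ProjectionValuedMeasure.scalar (E : ProjectionValuedMeasure X) (x : X) : Measure ℂ :=
  Measure.ofMeasurable (fun S _ => ENNReal.ofReal (inner ℂ x (E.toFun S x)).re)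
    (by
      have h := E.hasSum (fun _ => ∅) (fun _ => MeasurableSet.empty)
        (fun i j _ => by simp [Function.onFun]) x
      have h0 : E.toFun ∅ x = 0 := by
        have := h.summable
        simpa [summable_const_iff] using this
      simp [h0])
    (by
      intro f hf hd
      have h := E.hasSum f hf hd x
      have h1 : HasSum (fun n => (inner ℂ x (E.toFun (f n) x)).re)
          (inner ℂ x (E.toFun (⋃ n, f n) x)).re :=
        Complex.reCLM.hasSum ((innerSL ℂ x).hasSum h)
      rw [← h1.tsum_eq]
      exact ENNReal.ofReal_tsum_of_nonneg (fun n => E.inner_self_nonneg (hf n) x) h1.summable)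

theorem ProjectionValuedMeasure.scalar_apply (E : ProjectionValuedMeasure X) (x : X) {S : Set ℂ}
    (hS : MeasurableSet S) : E.scalar x S = ENNReal.ofReal (inner ℂ x (E.toFun S x)).re :=
  Measure.ofMeasurable_apply S hS

/-- `E` is the spectral measure of `A`, i.e. `A = ∫ z dE(z)`: the domain of `A` consists of the `x`
with `∫ |z|² dE_{x,x}(z) < ∞`, and `⟨A x, x⟩ = ∫ z dE_{x,x}(z)` there (by polarization this
determines `A x`). Mathlib's inner product is linear in its second argument. -/
def IsSpectralMeasure (A : X →ₗ.[ℂ] X) (E : ProjectionValuedMeasure X) : Prop :=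
  (∀ x : X, x ∈ A.domain ↔ ∫⁻ z, ‖z‖ₑ ^ 2 ∂(E.scalar x) < ⊤) ∧
    ∀ x : A.domain, inner ℂ (x : X) (A x) = ∫ z, z ∂(E.scalar (x : X))

end Operators

/-! ### The extrapolation space -/

section Extrapolation

variable {X : Type} [NormedAddCommGroup X] [InnerProductSpace ℂ X]

/-- The vector space `X`, to be endowed with the norm `‖R(s, A) x‖`. -/
def PreExtrapolation (_A : X →ₗ.[ℂ] X) (_s : ℂ) : Type := X

variable (A : X →ₗ.[ℂ] X) (s : ℂ)

instance : AddCommGroup (PreExtrapolation A s) := inferInstanceAs (AddCommGroup X)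

instance : Module ℂ (PreExtrapolation A s) := inferInstanceAs (Module ℂ X)

/-- The identity map from `X` to `X` with the weaker norm. -/
def toPre : X →ₗ[ℂ] PreExtrapolation A s := LinearMap.id

/-- The resolvent `R(s, A)` as a linear map from `X` with the weaker norm to `X`. -/
def preResolvent : PreExtrapolation A s →ₗ[ℂ] X := (resolvent A s).toLinearMap

instance : SeminormedAddCommGroup (PreExtrapolation A s) :=
  SeminormedAddCommGroup.induced _ _ (preResolvent A s)

/-- The inner product `⟨R(s, A) x, R(s, A) y⟩`, which induces the norm `‖R(s, A) x‖`. -/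
instance : InnerProductSpace ℂ (PreExtrapolation A s) where
  toNormedSpace := NormedSpace.induced ℂ _ _ (preResolvent A s)
  inner x y := inner ℂ (preResolvent A s x) (preResolvent A s y)
  norm_sq_eq_re_inner x := norm_sq_eq_re_inner (𝕜 := ℂ) (preResolvent A s x)
  conj_inner_symm x y := inner_conj_symm _ _
  add_left x y z := by rw [map_add, inner_add_left]
  smul_left x y r := by rw [map_smul, inner_smul_left]

/-- The extrapolation space `X₋₁`: the completion of `X` in the norm `‖R(s, A) x‖`. -/
abbrev Extrapolation : Type := UniformSpace.Completion (PreExtrapolation A s)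

/-- The canonical map `X → X₋₁`. -/
def toExtrapolation : X →ₗ[ℂ] Extrapolation A s where
  toFun x := ((toPre A s x : PreExtrapolation A s) : Extrapolation A s)
  map_add' x y := by rw [map_add, UniformSpace.Completion.coe_add]
  map_smul' c x := by rw [map_smul, UniformSpace.Completion.coe_smul]; rfl

/-- The operator `A₋₁` on `X₋₁`: the closure of `A` in `X₋₁`. For `s ∈ ρ(A)` this is the unique
bounded extension of `A` to a map `X → X₋₁`, regarded as an operator on `X₋₁` with domain `X`. -/
def extrapolatedOperator : Extrapolation A s →ₗ.[ℂ] Extrapolation A s :=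
  (A.graph.map ((toExtrapolation A s).prodMap (toExtrapolation A s))).topologicalClosure.toLinearPMap

/-- The continuous extension of a bounded operator on `X` to `X₋₁`, for an operator that is bounded
in the norm of `X₋₁`, such as the members `T(t)` of the semigroup generated by `A`. -/
def extend (S : X →L[ℂ] X) : Extrapolation A s → Extrapolation A s :=
  UniformSpace.Completion.map fun x : PreExtrapolation A s => (show PreExtrapolation A s from S x)

/-- For `φ ∈ D(A*)`, the continuous extension to `X₋₁` of the functional `x ↦ ⟨φ, x⟩` on `X`
(linear in `x`, conjugate-linear in `φ`): the duality between `X₋₁` and `D(A*)` with pivot `X`. -/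
def pairing (φ : X) : Extrapolation A s → ℂ :=
  UniformSpace.Completion.extension fun x : PreExtrapolation A s => inner ℂ φ (show X from x)

/-- Finite-time `L^p`-admissibility of `B ∈ L(U, X₋₁)` for the semigroup `T` generated by `A`: for
each `t ≥ 0` the Bochner integral `∫₀ᵗ T(t - r) B u(r) dr` exists in `X₋₁`, lies in `X`, and is
bounded in the norm of `X` by `C ‖u‖` in `L^p([0, t], U)`, where `C` may depend on `t`. -/
def FiniteTimeAdmissible {U : Type} [NormedAddCommGroup U] [NormedSpace ℂ U]
    (T : C0Semigroup X) (B : U →L[ℂ] Extrapolation A s) (p : ℝ≥0∞) : Prop :=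
  ∀ t : ℝ, 0 ≤ t → ∃ C : ℝ, 0 < C ∧
    ∀ u : ℝ → U, MemLp u p (volume.restrict (Icc 0 t)) →
      IntegrableOn (fun r => extend A s (T.toFun (t - r)) (B (u r))) (Icc 0 t) ∧
      ∃ x : X,
        toExtrapolation A s x = ∫ r in Icc 0 t, extend A s (T.toFun (t - r)) (B (u r)) ∧
        ‖x‖ ≤ C * (eLpNorm u p (volume.restrict (Icc 0 t))).toReal

/-- The measure `μ(S) = ∫_S (1 + |z|²) d⟨E₋₁(z) b, b⟩_{X₋₁}` on the Borel sets of `ℂ`. -/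
def controlMeasure {A : X →ₗ.[ℂ] X} {s : ℂ}
    (F : ProjectionValuedMeasure (Extrapolation A s)) (b : Extrapolation A s) : Measure ℂ :=
  (F.scalar b).withDensity fun z => ENNReal.ofReal (1 + ‖z‖ ^ 2)

end Extrapolation

/-- Mutual absolute continuity, with Radon–Nikodym densities bounded away from `0` and `∞`. -/
def EquivalentMeasures (μ ν : Measure ℂ) : Prop :=
  μ ≪ ν ∧ ν ≪ μ ∧ ∃ c C : ℝ, 0 < c ∧
    (∀ᵐ z ∂ν, ENNReal.ofReal c ≤ μ.rnDeriv ν z ∧ μ.rnDeriv ν z ≤ ENNReal.ofReal C) ∧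
    (∀ᵐ z ∂μ, ENNReal.ofReal c ≤ ν.rnDeriv μ z ∧ ν.rnDeriv μ z ≤ ENNReal.ofReal C)

/-! ### The Laplacians on the half line -/

/-- The state space `L²(0, ∞)`. -/
abbrev L2 : Type := Lp ℂ 2 (volume.restrict (Ioi (0 : ℝ)))

/-- Test functions on the open half line `(0, ∞)`. -/
def IsTest (φ : ℝ → ℂ) : Prop :=
  ContDiff ℝ ∞ φ ∧ HasCompactSupport φ ∧ tsupport φ ⊆ Ioi 0

/-- `g` is the weak derivative of `f` on `(0, ∞)`. -/
def IsWeakDeriv (f g : L2) : Prop :=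
  ∀ φ : ℝ → ℂ, IsTest φ → ∫ x in Ioi (0 : ℝ), f x * deriv φ x = -∫ x in Ioi (0 : ℝ), g x * φ x

/-- `f ∈ H¹₀(0, ∞)`, the closure of the test functions in `H¹(0, ∞)`. -/
def MemH10 (f : L2) : Prop :=
  ∃ g : L2, IsWeakDeriv f g ∧ ∀ ε : ℝ≥0∞, 0 < ε → ∃ φ : ℝ → ℂ, IsTest φ ∧
    eLpNorm (fun x => f x - φ x) 2 (volume.restrict (Ioi 0)) < ε ∧
    eLpNorm (fun x => g x - deriv φ x) 2 (volume.restrict (Ioi 0)) < ε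

/-- `g` has a representative that is continuous on `[0, ∞)` and vanishes at `0`. -/
def VanishesAtZero (g : L2) : Prop :=
  ∃ G : ℝ → ℂ, ContinuousOn G (Ici 0) ∧ g =ᵐ[volume.restrict (Ioi 0)] G ∧ G 0 = 0

theorem IsTest.memLp {φ : ℝ → ℂ} (h : IsTest φ) :
    MemLp φ 2 (volume.restrict (Ioi 0)) :=
  (h.1.continuous.memLp_of_hasCompactSupport h.2.1).restrict _

theorem IsTest.memLp_deriv {φ : ℝ → ℂ} (h : IsTest φ) :
    MemLp (deriv φ) 2 (volume.restrict (Ioi 0)) :=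
  ((h.1.continuous_deriv (by simp)).memLp_of_hasCompactSupport h.2.1.deriv).restrict _

theorem IsTest.add {φ ψ : ℝ → ℂ} (hφ : IsTest φ) (hψ : IsTest ψ) : IsTest (φ + ψ) :=
  ⟨hφ.1.add hψ.1, hφ.2.1.add hψ.2.1,
    (tsupport_add φ ψ).trans (union_subset hφ.2.2 hψ.2.2)⟩

theorem IsTest.smul {φ : ℝ → ℂ} (c : ℂ) (hφ : IsTest φ) : IsTest (c • φ) := by
  have hs : Function.support (c • φ) ⊆ Function.support φ := Function.support_const_smul_subset c φ
  exact ⟨contDiff_const.smul hφ.1, hφ.2.1.mono hs, (closure_mono hs).trans hφ.2.2⟩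

theorem IsTest.deriv_add {φ ψ : ℝ → ℂ} (hφ : IsTest φ) (hψ : IsTest ψ) (x : ℝ) :
    deriv (φ + ψ) x = deriv φ x + deriv ψ x :=
  _root_.deriv_add (hφ.1.differentiable (by simp) x) (hψ.1.differentiable (by simp) x)

theorem IsTest.deriv_smul {φ : ℝ → ℂ} (c : ℂ) (x : ℝ) :
    deriv (c • φ) x = c * deriv φ x := by
  rw [deriv_const_smul_field]
  rfl

theorem integrable_mul_L2 (f : L2) {φ : ℝ → ℂ} (h : MemLp φ 2 (volume.restrict (Ioi 0))) :
    Integrable (fun x => f x * φ x) (volume.restrict (Ioi 0)) :=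
  (Lp.memLp f).integrable_mul h

theorem IsWeakDeriv.zero : IsWeakDeriv 0 0 := by
  intro φ _
  have h0 : ∀ ψ : ℝ → ℂ, ∫ x in Ioi (0 : ℝ), (0 : L2) x * ψ x = 0 := by
    intro ψ
    refine integral_eq_zero_of_ae ?_
    filter_upwards [Lp.coeFn_zero ℂ 2 (volume.restrict (Ioi (0 : ℝ)))] with x hx
    rw [hx]
    simp
  rw [h0, h0, neg_zero]

theorem IsWeakDeriv.add {f f' g g' : L2} (h : IsWeakDeriv f g) (h' : IsWeakDeriv f' g') :
    IsWeakDeriv (f + f') (g + g') := by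
  intro φ hφ
  have key : ∀ (a b : L2) {ψ : ℝ → ℂ}, MemLp ψ 2 (volume.restrict (Ioi 0)) →
      ∫ x in Ioi (0 : ℝ), (a + b : L2) x * ψ x =
        (∫ x in Ioi (0 : ℝ), a x * ψ x) + ∫ x in Ioi (0 : ℝ), b x * ψ x := by
    intro a b ψ hψ
    rw [← integral_add (integrable_mul_L2 a hψ) (integrable_mul_L2 b hψ)]
    refine integral_congr_ae ?_
    filter_upwards [Lp.coeFn_add a b] with x hx
    rw [hx, Pi.add_apply, add_mul]
  rw [key f f' hφ.memLp_deriv, key g g' hφ.memLp, h φ hφ, h' φ hφ]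
  ring

theorem IsWeakDeriv.smul {f g : L2} (c : ℂ) (h : IsWeakDeriv f g) :
    IsWeakDeriv (c • f) (c • g) := by
  intro φ hφ
  have key : ∀ (a : L2) (ψ : ℝ → ℂ), ∫ x in Ioi (0 : ℝ), (c • a : L2) x * ψ x =
      c * ∫ x in Ioi (0 : ℝ), a x * ψ x := by
    intro a ψ
    rw [← integral_const_mul]
    refine integral_congr_ae ?_
    filter_upwards [Lp.coeFn_smul c a] with x hx
    rw [hx, Pi.smul_apply, smul_eq_mul, mul_assoc]
  rw [key, key, h φ hφ]
  ring

theorem IsWeakDeriv.eq_zero {g : L2} (h : IsWeakDeriv 0 g) : g = 0 := by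
  have hloc : LocallyIntegrableOn (g : ℝ → ℂ) (Ioi 0) volume := by
    have h1 : LocallyIntegrable (g : ℝ → ℂ) (volume.restrict (Ioi 0)) :=
      (Lp.memLp g).locallyIntegrable (by norm_num)
    exact locallyIntegrableOn_of_locallyIntegrable_restrict h1
  have hz := isOpen_Ioi.ae_eq_zero_of_integral_contDiff_smul_eq_zero hloc (by
    intro ψ hψ hc hs
    have ht : IsTest (fun x => (ψ x : ℂ)) := by
      have hsupp : Function.support (fun x => (ψ x : ℂ)) ⊆ Function.support ψ := by
        intro x hx
        simpa using hx
      exact ⟨Complex.ofRealCLM.contDiff.comp hψ, hc.mono hsupp, (closure_mono hsupp).trans hs⟩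
    have h1 := h _ ht
    have h2 := IsWeakDeriv.zero _ ht
    have h3 : ∫ x in Ioi (0 : ℝ), (0 : L2) x * (ψ x : ℂ) = 0 := by
      refine integral_eq_zero_of_ae ?_
      filter_upwards [Lp.coeFn_zero ℂ 2 (volume.restrict (Ioi (0 : ℝ)))] with x hx
      rw [hx]
      simp
    have h4 : ∫ x in Ioi (0 : ℝ), g x * (ψ x : ℂ) = 0 := by
      rw [h2, h3, neg_zero, zero_eq_neg] at h1
      exact h1
    rw [← h4, ← setIntegral_eq_integral_of_forall_compl_eq_zero (s := Ioi (0 : ℝ))]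
    · refine integral_congr_ae (Eventually.of_forall fun x => ?_)
      simp only [Complex.real_smul]
      ring
    · intro x hx
      rw [image_eq_zero_of_notMem_tsupport fun hx' => hx (hs hx'), zero_smul])
  refine Lp.ext ?_
  have hz' : ∀ᵐ x ∂(volume.restrict (Ioi (0 : ℝ))), g x = 0 :=
    (ae_restrict_iff' measurableSet_Ioi).2 hz
  filter_upwards [hz', Lp.coeFn_zero ℂ 2 (volume.restrict (Ioi (0 : ℝ)))] with x hx hx0
  rw [hx, hx0]
  rfl

theorem MemH10.zero : MemH10 0 := by
  refine ⟨0, IsWeakDeriv.zero, fun ε hε => ⟨0, ?_, ?_, ?_⟩⟩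
  · refine ⟨contDiff_const, HasCompactSupport.zero, ?_⟩
    simp [tsupport]
  · rw [eLpNorm_congr_ae (g := 0), eLpNorm_zero]
    · exact hε
    · filter_upwards [Lp.coeFn_zero ℂ 2 (volume.restrict (Ioi (0 : ℝ)))] with x hx
      rw [hx]
      simp
  · rw [eLpNorm_congr_ae (g := 0), eLpNorm_zero]
    · exact hε
    · filter_upwards [Lp.coeFn_zero ℂ 2 (volume.restrict (Ioi (0 : ℝ)))] with x hx
      rw [hx]
      simp

theorem MemH10.add {f f' : L2} (h : MemH10 f) (h' : MemH10 f') : MemH10 (f + f') := by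
  obtain ⟨g, hg, H⟩ := h
  obtain ⟨g', hg', H'⟩ := h'
  have key : ∀ (a b : L2) {α β γ : ℝ → ℂ} {ε : ℝ≥0∞},
      MemLp α 2 (volume.restrict (Ioi 0)) → MemLp β 2 (volume.restrict (Ioi 0)) →
      (∀ x, γ x = α x + β x) →
      eLpNorm (fun x => a x - α x) 2 (volume.restrict (Ioi 0)) < ε / 2 →
      eLpNorm (fun x => b x - β x) 2 (volume.restrict (Ioi 0)) < ε / 2 →
      eLpNorm (fun x => (a + b : L2) x - γ x) 2 (volume.restrict (Ioi 0)) < ε := by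
    intro a b α β γ ε hα hβ hγ ha hb
    have : eLpNorm (fun x => (a + b : L2) x - γ x) 2 (volume.restrict (Ioi 0)) =
        eLpNorm ((fun x => a x - α x) + fun x => b x - β x) 2 (volume.restrict (Ioi 0)) := by
      refine eLpNorm_congr_ae ?_
      filter_upwards [Lp.coeFn_add a b] with x hx
      simp only [hx, hγ, Pi.add_apply]
      ring
    rw [this]
    calc _ ≤ _ := eLpNorm_add_le ((Lp.memLp a).sub hα).1 ((Lp.memLp b).sub hβ).1 (by norm_num)
      _ < ε / 2 + ε / 2 := ENNReal.add_lt_add ha hb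
      _ = ε := ENNReal.add_halves ε
  refine ⟨g + g', hg.add hg', fun ε hε => ?_⟩
  obtain ⟨φ, hφ, h1, h2⟩ := H (ε / 2) (ENNReal.half_pos hε.ne')
  obtain ⟨ψ, hψ, h1', h2'⟩ := H' (ε / 2) (ENNReal.half_pos hε.ne')
  exact ⟨φ + ψ, hφ.add hψ, key f f' hφ.memLp hψ.memLp (fun _ => rfl) h1 h1',
    key g g' hφ.memLp_deriv hψ.memLp_deriv (hφ.deriv_add hψ) h2 h2'⟩

theorem MemH10.smul {f : L2} (c : ℂ) (h : MemH10 f) : MemH10 (c • f) := by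
  rcases eq_or_ne c 0 with rfl | hc
  · rw [zero_smul]
    exact MemH10.zero
  obtain ⟨g, hg, H⟩ := h
  have hc0 : ‖c‖ₑ ≠ 0 := by simpa using hc
  have key : ∀ (a : L2) {α γ : ℝ → ℂ} {ε : ℝ≥0∞}, (∀ x, γ x = c * α x) →
      eLpNorm (fun x => a x - α x) 2 (volume.restrict (Ioi 0)) < ε / ‖c‖ₑ →
      eLpNorm (fun x => (c • a : L2) x - γ x) 2 (volume.restrict (Ioi 0)) < ε := by
    intro a α γ ε hγ ha
    have : eLpNorm (fun x => (c • a : L2) x - γ x) 2 (volume.restrict (Ioi 0)) =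
        eLpNorm (c • fun x => a x - α x) 2 (volume.restrict (Ioi 0)) := by
      refine eLpNorm_congr_ae ?_
      filter_upwards [Lp.coeFn_smul c a] with x hx
      simp only [hx, hγ, Pi.smul_apply, smul_eq_mul]
      ring
    rw [this, eLpNorm_const_smul, mul_comm]
    exact (ENNReal.lt_div_iff_mul_lt (Or.inl hc0) (Or.inl enorm_ne_top)).1 ha
  refine ⟨c • g, hg.smul c, fun ε hε => ?_⟩
  obtain ⟨φ, hφ, h1, h2⟩ := H (ε / ‖c‖ₑ) (ENNReal.div_pos hε.ne' enorm_ne_top)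
  exact ⟨c • φ, hφ.smul c, key f (fun _ => rfl) h1, key g (IsTest.deriv_smul c) h2⟩

theorem VanishesAtZero.zero : VanishesAtZero 0 :=
  ⟨0, continuousOn_const, Lp.coeFn_zero ℂ 2 _, rfl⟩

theorem VanishesAtZero.add {f g : L2} (hf : VanishesAtZero f) (hg : VanishesAtZero g) :
    VanishesAtZero (f + g) := by
  obtain ⟨F, hF, hfF, hF0⟩ := hf
  obtain ⟨G, hG, hgG, hG0⟩ := hg
  exact ⟨F + G, hF.add hG, (Lp.coeFn_add f g).trans (hfF.add hgG), by simp [hF0, hG0]⟩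

theorem VanishesAtZero.smul {f : L2} (c : ℂ) (hf : VanishesAtZero f) : VanishesAtZero (c • f) := by
  obtain ⟨F, hF, hfF, hF0⟩ := hf
  exact ⟨c • F, hF.const_smul c, (Lp.coeFn_smul c f).trans (hfF.const_smul c), by simp [hF0]⟩

/-- The graph of the Dirichlet Laplacian: the pairs `(f, f'')` with `f ∈ H²(0, ∞) ∩ H¹₀(0, ∞)`. -/
def dirichletGraph : Submodule ℂ (L2 × L2) where
  carrier := {q | MemH10 q.1 ∧ ∃ g : L2, IsWeakDeriv q.1 g ∧ IsWeakDeriv g q.2}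
  zero_mem' := ⟨MemH10.zero, 0, IsWeakDeriv.zero, IsWeakDeriv.zero⟩
  add_mem' := by
    rintro q q' ⟨h, g, h1, h2⟩ ⟨h', g', h1', h2'⟩
    exact ⟨h.add h', g + g', h1.add h1', h2.add h2'⟩
  smul_mem' := by
    rintro c q ⟨h, g, h1, h2⟩
    exact ⟨h.smul c, c • g, h1.smul c, h2.smul c⟩

/-- The graph of the Neumann Laplacian: the pairs `(f, f'')` with `f ∈ H²(0, ∞)`, `f'(0) = 0`. -/
def neumannGraph : Submodule ℂ (L2 × L2) where
  carrier := {q | ∃ g : L2, IsWeakDeriv q.1 g ∧ IsWeakDeriv g q.2 ∧ VanishesAtZero g}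
  zero_mem' := ⟨0, IsWeakDeriv.zero, IsWeakDeriv.zero, VanishesAtZero.zero⟩
  add_mem' := by
    rintro q q' ⟨g, h1, h2, h⟩ ⟨g', h1', h2', h'⟩
    exact ⟨g + g', h1.add h1', h2.add h2', h.add h'⟩
  smul_mem' := by
    rintro c q ⟨g, h1, h2, h⟩
    exact ⟨c • g, h1.smul c, h2.smul c, h.smul c⟩

/-- The Dirichlet Laplacian on `L²(0, ∞)`. -/
def dirichletLaplacian : L2 →ₗ.[ℂ] L2 := dirichletGraph.toLinearPMap

/-- The Neumann Laplacian on `L²(0, ∞)`. -/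
def neumannLaplacian : L2 →ₗ.[ℂ] L2 := neumannGraph.toLinearPMap

theorem dirichletLaplacian_graph : dirichletLaplacian.graph = dirichletGraph := by
  refine Submodule.toLinearPMap_graph_eq _ ?_
  rintro ⟨f, h⟩ ⟨-, g, h1, h2⟩ (rfl : f = 0)
  obtain rfl := h1.eq_zero
  exact h2.eq_zero

theorem neumannLaplacian_graph : neumannLaplacian.graph = neumannGraph := by
  refine Submodule.toLinearPMap_graph_eq _ ?_
  rintro ⟨f, h⟩ ⟨g, h1, h2, -⟩ (rfl : f = 0)
  obtain rfl := h1.eq_zero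
  exact h2.eq_zero

/-! ### Transforms, boundary distributions and measures on `(-∞, 0]` -/

/-- The one-sided sine transform `x ↦ ∫₀^∞ f(ξ) sin(x ξ) dξ`. -/
def sineTransform (f : ℝ → ℂ) (x : ℝ) : ℂ := ∫ ξ in Ioi (0 : ℝ), f ξ * (Real.sin (x * ξ) : ℂ)

/-- The one-sided cosine transform `x ↦ ∫₀^∞ f(ξ) cos(x ξ) dξ`. -/
def cosineTransform (f : ℝ → ℂ) (x : ℝ) : ℂ := ∫ ξ in Ioi (0 : ℝ), f ξ * (Real.cos (x * ξ) : ℂ)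

/-- The Dirac distribution at the boundary point: `⟨δ₀, F⟩ = F(0)`. -/
def delta (F : ℝ → ℂ) : ℂ := F 0

/-- Its derivative: `⟨δ₀', F⟩ = -F'(0)`, with the one-sided derivative on `[0, ∞)`. -/
def deltaPrime (F : ℝ → ℂ) : ℂ := -derivWithin F (Ici 0) 0

/-- `b ∈ X₋₁` is the functional `ℓ` on `D(A*) = D(A)`: for `φ ∈ D(A)` with the representative `F`
that is `C¹` on `[0, ∞)`, one has `⟨φ, b⟩ = conj (ℓ F)`. -/
def Represents (A : L2 →ₗ.[ℂ] L2) (s : ℂ) (b : Extrapolation A s) (ℓ : (ℝ → ℂ) → ℂ) : Prop :=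
  ∀ φ ∈ A.domain, ∀ F : ℝ → ℂ, φ =ᵐ[volume.restrict (Ioi 0)] F → ContDiffOn ℝ 1 F (Ici 0) →
    pairing A s φ b = conj (ℓ F)

/-- The Borel measure `χ_{(-∞, 0]}(z) w(z) dz` on `ℂ`, carried by the negative real half axis. -/
def halfAxisMeasure (w : ℝ → ℝ) : Measure ℂ :=
  ((volume.restrict (Iic (0 : ℝ))).withDensity fun z => ENNReal.ofReal (w z)).map
    fun z : ℝ => (z : ℂ)

end HalfLine

end

noncomputable section

namespace HalfLine

/-- Lebesgue measure on `(0, ∞)`. -/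
local notation "μ₀" => volume.restrict (Ioi (0 : ℝ))

/-- The square root of `2 / π`, which normalizes the sine and the cosine transform. -/
local notation "κ" => ((√(2 / Real.pi) : ℝ) : ℂ)

open FourierTransform in
/-- On `L¹ ∩ L²` the Fourier transform of `L²` is given by the Fourier integral. -/
theorem coeFn_fourier_toLp {f : ℝ → ℂ} (h1 : Integrable f) (h2 : MemLp f 2) :
    ((𝓕 (h2.toLp f) : Lp ℂ 2 (volume : Measure ℝ)) : ℝ → ℂ) =ᵐ[volume] 𝓕 f := by
  have hc : Continuous (𝓕 f) :=
    VectorFourier.fourierIntegral_continuous Real.continuous_fourierChar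
      (by exact continuous_inner) h1
  refine ae_eq_of_integral_contDiff_smul_eq ((Lp.memLp _).locallyIntegrable (by norm_num))
    hc.locallyIntegrable ?_
  intro g hg hgc
  have hg₁ : HasCompactSupport (Complex.ofRealCLM ∘ g) := hgc.comp_left rfl
  have hg₂ : ContDiff ℝ ∞ (Complex.ofRealCLM ∘ g) := by fun_prop
  set G := hg₁.toSchwartzMap hg₂ with hG
  have e1 : ∫ x, g x • (𝓕 (h2.toLp f) : Lp ℂ 2 (volume : Measure ℝ)) x =
      Lp.toTemperedDistribution (𝓕 (h2.toLp f) : Lp ℂ 2 (volume : Measure ℝ)) G := by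
    rw [Lp.toTemperedDistribution_apply]
    simp [hG]
  rw [e1, ← Lp.fourier_toTemperedDistribution_eq, TemperedDistribution.fourier_apply,
    Lp.toTemperedDistribution_apply]
  have e2 : ∫ x, (𝓕 G) x • h2.toLp f x = ∫ x, (𝓕 G) x • f x := by
    refine integral_congr_ae ?_
    filter_upwards [h2.coeFn_toLp] with x hx
    rw [hx]
  rw [e2]
  have e3 := VectorFourier.integral_fourierIntegral_smul_eq_flip (μ := (volume : Measure ℝ))
    (ν := (volume : Measure ℝ)) (L := innerₗ ℝ) (e := Real.fourierChar) (f := (G : ℝ → ℂ)) (g := f)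
    Real.continuous_fourierChar (by exact continuous_inner) G.integrable h1
  rw [flip_innerₗ] at e3
  have e4 : ∫ x, (𝓕 G) x • f x = ∫ x, G x • 𝓕 f x := by
    rw [SchwartzMap.fourier_coe]
    exact e3
  rw [e4]
  simp [hG]

open FourierTransform in
theorem lintegral_enorm_sq_fourier {f : ℝ → ℂ} (h1 : Integrable f) (h2 : MemLp f 2) :
    ∫⁻ x, ‖𝓕 f x‖ₑ ^ 2 = ∫⁻ x, ‖f x‖ₑ ^ 2 := by
  have h : ‖(𝓕 (h2.toLp f) : Lp ℂ 2 (volume : Measure ℝ))‖ₑ = ‖h2.toLp f‖ₑ := by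
    rw [← ofReal_norm, ← ofReal_norm, Lp.norm_fourier_eq]
  rw [Lp.enorm_def, Lp.enorm_def, eLpNorm_congr_ae (coeFn_fourier_toLp h1 h2),
    eLpNorm_congr_ae h2.coeFn_toLp] at h
  have key : ∀ g : ℝ → ℂ, eLpNorm g 2 volume ^ 2 = ∫⁻ x, ‖g x‖ₑ ^ 2 := by
    intro g
    have := eLpNorm_nnreal_pow_eq_lintegral (f := g) (μ := volume) (p := 2) (by norm_num)
    simpa using this
  rw [← key, ← key, h]

theorem lintegral_even {F : ℝ → ℝ≥0∞} (hF : ∀ x, F (-x) = F x) :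
    ∫⁻ x, F x = 2 * ∫⁻ x in Ioi 0, F x := by
  rw [← lintegral_add_compl F (measurableSet_Ioi (a := (0 : ℝ))), two_mul]
  congr 1
  rw [compl_Ioi, ← setLIntegral_congr (Iio_ae_eq_Iic (α := ℝ) (a := 0))]
  have h := lintegral_image_eq_lintegral_abs_deriv_mul (f := fun x : ℝ => -x) (f' := fun _ => -1)
    (measurableSet_Ioi (a := (0 : ℝ))) (fun x _ => (hasDerivAt_neg x).hasDerivWithinAt)
    neg_injective.injOn F
  simpa [hF] using h

theorem lintegral_comp_mul_left_Ioi (F : ℝ → ℝ≥0∞) {c : ℝ} (hc : 0 < c) :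
    ∫⁻ x in Ioi (0 : ℝ), F x = ENNReal.ofReal c * ∫⁻ x in Ioi (0 : ℝ), F (c * x) := by
  have h := lintegral_image_eq_lintegral_abs_deriv_mul (f := fun x : ℝ => c * x) (f' := fun _ => c)
    (measurableSet_Ioi (a := (0 : ℝ)))
    (fun x _ => by simpa using ((hasDerivAt_id x).const_mul c).hasDerivWithinAt)
    (mul_right_injective₀ hc.ne').injOn F
  rw [image_const_mul_Ioi_zero hc, lintegral_const_mul' _ _ (by simp), abs_of_pos hc] at h
  exact h

/-- The transform with kernel `k (x ξ)` on the half line. -/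
def kernelTransform (k : ℝ → ℝ) (f : ℝ → ℂ) (x : ℝ) : ℂ :=
  ∫ ξ in Ioi (0 : ℝ), f ξ * (k (x * ξ) : ℂ)

/-- A bounded continuous kernel for which `√(2/π)` times the transform is isometric on
`L¹ ∩ L²`. -/
structure IsPlancherelKernel (k : ℝ → ℝ) : Prop where
  continuous : Continuous k
  abs_le : ∀ x, |k x| ≤ 1
  lintegral_eq : ∀ f : ℝ → ℂ, IntegrableOn f (Ioi 0) → MemLp f 2 (volume.restrict (Ioi 0)) →
    ENNReal.ofReal (2 / Real.pi) * ∫⁻ x in Ioi (0 : ℝ), ‖kernelTransform k f x‖ₑ ^ 2 =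
      ∫⁻ x in Ioi (0 : ℝ), ‖f x‖ₑ ^ 2

open FourierTransform in
theorem isPlancherelKernel_of_fourier {k : ℝ → ℝ} (hk : Continuous k) (hb : ∀ x, |k x| ≤ 1)
    (c d : ℂ) (hc : ‖c‖ = 1) (hcc : c * c = 1) (hd : ‖d‖ = 2)
    (h : ∀ x : ℝ, Complex.exp (-(x * Complex.I)) + c * Complex.exp (x * Complex.I) = d * k x)
    (hp' : ∀ (f : ℝ → ℂ) x, ‖kernelTransform k f (-x)‖ = ‖kernelTransform k f x‖) :
    IsPlancherelKernel k := by
  refine ⟨hk, hb, fun f h1 h2 => ?_⟩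
  set e : ℝ → ℂ := indicator (Ioi 0) f with he
  have he1 : Integrable e := h1.integrable_indicator measurableSet_Ioi
  have he2 : MemLp e 2 := (memLp_indicator_iff_restrict measurableSet_Ioi).2 h2
  have hm : MeasurePreserving (fun x : ℝ => -x) volume volume := Measure.measurePreserving_neg _
  have he1' : Integrable (fun x => e (-x)) := he1.comp_neg
  have he2' : MemLp (fun x => e (-x)) 2 := he2.comp_measurePreserving hm
  set F : ℝ → ℂ := fun x => e x + c * e (-x) with hF
  have hF1 : Integrable F := he1.add (he1'.const_mul c)
  have hF2 : MemLp F 2 := he2.add (he2'.const_mul c)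
  have hFF : ∀ ξ : ℝ, 𝓕 F ξ = d * kernelTransform k f (2 * Real.pi * ξ) := by
    intro ξ
    have hint : ∀ (g : ℝ → ℂ) (y : ℝ), Integrable g →
        Integrable fun x : ℝ => Complex.exp ((y * x : ℝ) * Complex.I) * g x := by
      intro g y hg
      refine hg.bdd_mul (c := 1) (by fun_prop) (Eventually.of_forall fun x => ?_)
      exact (Complex.norm_exp_ofReal_mul_I _).le
    rw [Real.fourier_eq']
    simp only [RCLike.inner_apply, conj_trivial, smul_eq_mul, hF, mul_add]
    have i1 := hint e (-2 * Real.pi * ξ) he1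
    have i2 := hint (fun x => e (-x)) (-2 * Real.pi * ξ) he1'
    have r1 : ∀ x : ℝ, -2 * Real.pi * (ξ * x) = -2 * Real.pi * ξ * x := fun x => by ring
    simp only [r1, mul_left_comm _ c]
    rw [integral_add i1 (i2.const_mul c), integral_const_mul,
      ← integral_neg_eq_self (fun x : ℝ =>
        Complex.exp ((-2 * Real.pi * ξ * x : ℝ) * Complex.I) * e (-x)), ← integral_const_mul,
      ← integral_add i1, kernelTransform, ← integral_const_mul,
      ← integral_indicator measurableSet_Ioi]
    · refine integral_congr_ae (Eventually.of_forall fun x => ?_)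
      by_cases hx : x ∈ Ioi (0 : ℝ)
      · have := h (2 * Real.pi * ξ * x)
        simp only [he, neg_neg, indicator_of_mem hx]
        rw [show d * (f x * (k (2 * Real.pi * ξ * x) : ℂ)) =
          f x * (d * (k (2 * Real.pi * ξ * x) : ℂ)) by ring, ← this]
        push_cast
        ring_nf
      · simp [he, indicator_of_notMem hx]
    · have i3 := (hint e (2 * Real.pi * ξ) he1).const_mul c
      refine i3.congr (Eventually.of_forall fun x => ?_)
      simp
  have hP := lintegral_enorm_sq_fourier hF1 hF2
  have hn1 : ∀ x, ‖F (-x)‖ = ‖F x‖ := by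
    intro x
    have : F (-x) = c * F x := by
      simp only [hF, neg_neg, mul_add, ← mul_assoc, hcc, one_mul]
      ring
    rw [this, norm_mul, hc, one_mul]
  have hen : ∀ {a b : ℂ}, ‖a‖ = ‖b‖ → ‖a‖ₑ = ‖b‖ₑ := fun h => by
    rw [← ofReal_norm, h, ofReal_norm]
  rw [lintegral_even (F := fun x => ‖F x‖ₑ ^ 2) (fun x => by rw [hen (hn1 x)]),
    lintegral_even (F := fun x => ‖𝓕 F x‖ₑ ^ 2) (fun x => by
      rw [hFF, hFF, enorm_mul, enorm_mul, mul_neg, hen (hp' f _)])] at hP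
  have hP' := (ENNReal.mul_right_inj (by norm_num) (by norm_num)).1 hP
  have hR : ∫⁻ x in Ioi (0 : ℝ), ‖F x‖ₑ ^ 2 = ∫⁻ x in Ioi (0 : ℝ), ‖f x‖ₑ ^ 2 := by
    refine setLIntegral_congr_fun measurableSet_Ioi fun x hx => ?_
    have h2 : -x ∉ Ioi (0 : ℝ) := by
      have : (0 : ℝ) < x := hx
      simp [this.le]
    simp [hF, he, indicator_of_mem hx, indicator_of_notMem h2]
  have h2p : 0 < 2 * Real.pi := by positivity
  rw [← hR, ← hP', lintegral_comp_mul_left_Ioi (fun x => ‖kernelTransform k f x‖ₑ ^ 2) h2p,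
    ← mul_assoc, ← ENNReal.ofReal_mul (by positivity),
    show 2 / Real.pi * (2 * Real.pi) = 4 by field_simp; norm_num,
    ← lintegral_const_mul' _ _ (by simp)]
  refine lintegral_congr fun x => ?_
  rw [hFF, enorm_mul, mul_pow]
  congr 1
  rw [← ofReal_norm, hd, ← ENNReal.ofReal_pow (by norm_num)]
  norm_num

theorem isPlancherelKernel_sin : IsPlancherelKernel Real.sin := by
  refine isPlancherelKernel_of_fourier Real.continuous_sin Real.abs_sin_le_one
    (-1) (-2 * Complex.I) (by simp) (by simp) (by simp) (fun x => ?_)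
    fun f x => ?_
  · rw [Complex.ofReal_sin, ← neg_mul, Complex.exp_mul_I, Complex.exp_mul_I, Complex.sin_neg,
      Complex.cos_neg]
    ring
  · rw [← norm_neg]
    simp [kernelTransform, integral_neg]

theorem isPlancherelKernel_cos : IsPlancherelKernel Real.cos := by
  refine isPlancherelKernel_of_fourier Real.continuous_cos Real.abs_cos_le_one
    1 2 (by simp) (by simp) (by simp) (fun x => ?_) fun f x => ?_
  · rw [Complex.ofReal_cos, ← neg_mul, Complex.exp_mul_I, Complex.exp_mul_I, Complex.sin_neg,
      Complex.cos_neg]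
    ring
  · simp [kernelTransform]

/-! ### Bounded multiplication operators on `L²(0, ∞)` -/

theorem enorm_sq_L2 (f : L2) : ‖f‖ₑ ^ 2 = ∫⁻ x in Ioi (0 : ℝ), ‖f x‖ₑ ^ 2 := by
  rw [Lp.enorm_def]
  simpa using eLpNorm_nnreal_pow_eq_lintegral (f := f) (μ := μ₀) (p := 2) (by norm_num)

theorem memLp_two_of_lintegral_lt_top {f : ℝ → ℂ} (hf : AEStronglyMeasurable f μ₀)
    (h : ∫⁻ x in Ioi (0 : ℝ), ‖f x‖ₑ ^ 2 < ⊤) : MemLp f 2 μ₀ := by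
  refine ⟨hf, ?_⟩
  have := eLpNorm_nnreal_pow_eq_lintegral (f := f) (μ := μ₀) (p := 2) (by norm_num)
  have h2 : eLpNorm f 2 μ₀ ^ 2 = ∫⁻ x in Ioi (0 : ℝ), ‖f x‖ₑ ^ 2 := by simpa using this
  rw [← h2] at h
  by_contra hn
  rw [not_lt, top_le_iff] at hn
  simp [hn] at h

theorem lintegral_lt_top_of_memLp_two {f : ℝ → ℂ} (h : MemLp f 2 μ₀) :
    ∫⁻ x in Ioi (0 : ℝ), ‖f x‖ₑ ^ 2 < ⊤ := by
  have := eLpNorm_nnreal_pow_eq_lintegral (f := f) (μ := μ₀) (p := 2) (by norm_num)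
  have h2 : eLpNorm f 2 μ₀ ^ 2 = ∫⁻ x in Ioi (0 : ℝ), ‖f x‖ₑ ^ 2 := by simpa using this
  rw [← h2]
  exact ENNReal.pow_lt_top h.2

theorem norm_le_of_ae_norm_le {f g : L2} (h : ∀ᵐ x ∂μ₀, ‖f x‖ ≤ ‖g x‖) : ‖f‖ ≤ ‖g‖ :=
  Lp.norm_le_norm_of_ae_le h

theorem inner_L2 (f g : L2) : inner ℂ f g = ∫ x in Ioi (0 : ℝ), conj (f x) * g x := by
  rw [L2.inner_def]
  refine integral_congr_ae (Eventually.of_forall fun x => ?_)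
  simp [mul_comm]

theorem norm_sq_L2 (f : L2) : ‖f‖ ^ 2 = ∫ x in Ioi (0 : ℝ), ‖f x‖ ^ 2 := by
  have h := inner_self_eq_norm_sq_to_K (𝕜 := ℂ) f
  rw [inner_L2] at h
  have h2 : ∀ z : ℂ, conj z * z = ((‖z‖ ^ 2 : ℝ) : ℂ) := fun z => by
    rw [Complex.conj_mul', Complex.ofReal_pow]
  simp only [h2] at h
  rw [integral_complex_ofReal] at h
  refine Complex.ofReal_injective ?_
  rw [Complex.ofReal_pow]
  exact h.symm

theorem tendsto_L2_of_dominated {ι : Type*} {l : Filter ι} [l.IsCountablyGenerated] {F : ι → L2}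
    {f g : L2} {ψ : ι → ℝ → ℂ} (hF : ∀ᶠ i in l, F i =ᵐ[μ₀] ψ i)
    (hb : ∀ᶠ i in l, ∀ᵐ x ∂μ₀, ‖ψ i x‖ ≤ ‖g x‖)
    (ht : ∀ᵐ x ∂μ₀, Tendsto (fun i => ψ i x) l (𝓝 (f x))) : Tendsto F l (𝓝 f) := by
  have key : Tendsto (fun i => ∫ x in Ioi (0 : ℝ), ‖ψ i x - f x‖ ^ 2) l
      (𝓝 (∫ _ in Ioi (0 : ℝ), (0 : ℝ))) := by
    refine tendsto_integral_filter_of_dominated_convergence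
      (fun x => (‖g x‖ + ‖f x‖) ^ 2) ?_ ?_ ?_ ?_
    · filter_upwards [hF] with i hi
      have : AEStronglyMeasurable (ψ i) μ₀ := (Lp.aestronglyMeasurable (F i)).congr hi
      exact (this.sub (Lp.aestronglyMeasurable f)).norm.pow 2
    · filter_upwards [hb] with i hi
      filter_upwards [hi] with x hx
      rw [Real.norm_of_nonneg (by positivity)]
      gcongr
      exact (norm_sub_le _ _).trans (by gcongr)
    · exact ((Lp.memLp g).norm.add (Lp.memLp f).norm).integrable_sq
    · filter_upwards [ht] with x hx
      simpa using ((hx.sub_const (f x)).norm).pow 2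
  have h2 : Tendsto (fun i => ‖F i - f‖ ^ 2) l (𝓝 0) := by
    rw [integral_zero] at key
    refine key.congr' ?_
    filter_upwards [hF] with i hi
    rw [norm_sq_L2]
    refine integral_congr_ae ?_
    filter_upwards [hi, Lp.coeFn_sub (F i) f] with x hx hs
    rw [hs, Pi.sub_apply, hx]
  rw [tendsto_iff_norm_sub_tendsto_zero]
  have h3 := h2.sqrt
  simpa [Real.sqrt_sq] using h3

/-- Multiplication by the bounded measurable function `φ` (zero if `φ` is not of this kind). -/
def mulOp (φ : ℝ → ℂ) : L2 →L[ℂ] L2 :=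
  open Classical in
  if h : MemLp φ ∞ μ₀ then (ContinuousLinearMap.mul ℂ ℂ).holderL μ₀ ∞ 2 2 (h.toLp φ) else 0

/-- Bounded measurable functions on the line. -/
def IsBddMeas (φ : ℝ → ℂ) : Prop := Measurable φ ∧ ∃ C, ∀ x, ‖φ x‖ ≤ C

theorem IsBddMeas.memLp {φ : ℝ → ℂ} (h : IsBddMeas φ) : MemLp φ ∞ μ₀ :=
  memLp_top_of_bound h.1.aestronglyMeasurable h.2.choose (Eventually.of_forall h.2.choose_spec)

theorem IsBddMeas.mul {φ ψ : ℝ → ℂ} (h : IsBddMeas φ) (h' : IsBddMeas ψ) :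
    IsBddMeas (fun x => φ x * ψ x) := by
  obtain ⟨C, hC⟩ := h.2
  obtain ⟨D, hD⟩ := h'.2
  refine ⟨h.1.mul h'.1, C * D, fun x => ?_⟩
  rw [norm_mul]
  exact mul_le_mul (hC x) (hD x) (norm_nonneg _) ((norm_nonneg _).trans (hC x))

theorem IsBddMeas.indicator {S : Set ℝ} (hS : MeasurableSet S) :
    IsBddMeas (S.indicator fun _ => (1 : ℂ)) :=
  ⟨measurable_const.indicator hS, 1, fun x => (norm_indicator_le_norm_self _ x).trans (by simp)⟩

theorem coeFn_mulOp {φ : ℝ → ℂ} (h : IsBddMeas φ) (f : L2) :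
    mulOp φ f =ᵐ[μ₀] fun x => φ x * f x := by
  rw [mulOp, dif_pos h.memLp]
  have := (ContinuousLinearMap.mul ℂ ℂ).coeFn_holder (r := 2) (h.memLp.toLp φ) f
  filter_upwards [this, h.memLp.coeFn_toLp] with x hx hx'
  rw [← hx']
  exact hx

theorem mulOp_mulOp {φ ψ : ℝ → ℂ} (h : IsBddMeas φ) (h' : IsBddMeas ψ) (f : L2) :
    mulOp φ (mulOp ψ f) = mulOp (fun x => φ x * ψ x) f := by
  refine Lp.ext ?_
  filter_upwards [coeFn_mulOp h (mulOp ψ f), coeFn_mulOp h' f, coeFn_mulOp (h.mul h') f]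
    with x h1 h2 h3
  rw [h1, h2, h3, mul_assoc]

/-- The relation `G = σ F` in terms of the bounded multipliers `B` and `σ B`. -/
theorem ae_eq_mul_iff_mulOp {σ B : ℝ → ℂ} (hB : IsBddMeas B)
    (hσ : IsBddMeas fun η => σ η * B η) (h0 : ∀ η, B η ≠ 0) (F G : L2) :
    (G =ᵐ[μ₀] fun η => σ η * F η) ↔ mulOp B G = mulOp (fun η => σ η * B η) F := by
  have h1 := coeFn_mulOp hB G
  have h2 := coeFn_mulOp hσ F
  constructor
  · intro h
    refine Lp.ext ?_
    filter_upwards [h, h1, h2] with η h h1 h2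
    rw [h1, h2, h]
    ring
  · intro h
    rw [h] at h1
    filter_upwards [h1, h2] with η h1 h2
    rw [h2, mul_comm (σ η), mul_assoc] at h1
    exact (mul_left_cancel₀ (h0 η) h1).symm

theorem mulOp_one (f : L2) : mulOp (fun _ => 1) f = f := by
  refine Lp.ext ?_
  filter_upwards [coeFn_mulOp (φ := fun _ => 1) ⟨measurable_const, 1, by simp⟩ f] with x hx
  rw [hx, one_mul]

theorem inner_mulOp_left {φ : ℝ → ℂ} (h : IsBddMeas φ) (f g : L2) :
    inner ℂ (mulOp φ f) g = ∫ x in Ioi (0 : ℝ), conj (φ x) * (conj (f x) * g x) := by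
  rw [inner_L2]
  refine integral_congr_ae ?_
  filter_upwards [coeFn_mulOp h f] with x hx
  rw [hx, map_mul, mul_assoc]

theorem inner_mulOp_right {φ : ℝ → ℂ} (h : IsBddMeas φ) (f g : L2) :
    inner ℂ f (mulOp φ g) = ∫ x in Ioi (0 : ℝ), φ x * (conj (f x) * g x) := by
  rw [inner_L2]
  refine integral_congr_ae ?_
  filter_upwards [coeFn_mulOp h g] with x hx
  rw [hx]
  ring

theorem tendsto_mulOp {ι : Type*} {l : Filter ι} [l.IsCountablyGenerated] {φ : ι → ℝ → ℂ}
    {φ₀ : ℝ → ℂ} {C : ℝ} (hm : ∀ᶠ i in l, Measurable (φ i))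
    (hb : ∀ᶠ i in l, ∀ x, ‖φ i x‖ ≤ C) (h0 : IsBddMeas φ₀)
    (ht : ∀ x, 0 < x → Tendsto (fun i => φ i x) l (𝓝 (φ₀ x))) (f : L2) :
    Tendsto (fun i => mulOp (φ i) f) l (𝓝 (mulOp φ₀ f)) := by
  refine tendsto_L2_of_dominated (g := (C : ℂ) • f) (ψ := fun i x => φ i x * f x) ?_ ?_ ?_
  · filter_upwards [hm, hb] with i h1 h2
    exact coeFn_mulOp ⟨h1, C, h2⟩ f
  · filter_upwards [hb] with i hi
    filter_upwards [Lp.coeFn_smul (C : ℂ) f] with x hx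
    rw [hx, Pi.smul_apply, norm_smul, norm_mul, Complex.norm_real]
    gcongr
    exact (hi x).trans (le_abs_self C)
  · filter_upwards [coeFn_mulOp h0 f, ae_restrict_mem measurableSet_Ioi] with x hx hx0
    rw [hx]
    exact (ht x hx0).mul_const _

/-- Truncation of square-integrable functions to `(-n, n)`. -/
def truncOp (n : ℕ) : L2 →L[ℂ] L2 := mulOp ((Ioo (-n : ℝ) n).indicator fun _ => 1)

theorem coeFn_truncOp (n : ℕ) (f : L2) :
    truncOp n f =ᵐ[μ₀] (Ioo (-n : ℝ) n).indicator f := by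
  filter_upwards [coeFn_mulOp (.indicator (measurableSet_Ioo (a := (-n : ℝ)) (b := n))) f] with x hx
  rw [truncOp, hx]
  by_cases h : x ∈ Ioo (-n : ℝ) n <;> simp [h]

theorem tendsto_truncOp (f : L2) : Tendsto (fun n => truncOp n f) atTop (𝓝 f) := by
  have h := tendsto_mulOp (l := atTop) (φ := fun n : ℕ => (Ioo (-n : ℝ) n).indicator fun _ => (1 : ℂ))
    (φ₀ := fun _ => 1) (C := 1)
    (Eventually.of_forall fun n => (IsBddMeas.indicator measurableSet_Ioo).1)
    (Eventually.of_forall fun n x => (norm_indicator_le_norm_self _ x).trans (by simp))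
    ⟨measurable_const, 1, by simp⟩ (fun x hx0 => ?_) f
  · simp only [mulOp_one] at h
    exact h
  · obtain ⟨N, hN⟩ := exists_nat_gt x
    refine tendsto_const_nhds.congr' ?_
    filter_upwards [eventually_ge_atTop N] with n hn
    have : x < n := hN.trans_le (by exact_mod_cast hn)
    have h' : x ∈ Ioo (-n : ℝ) n := ⟨by linarith, this⟩
    rw [indicator_of_mem h']

/-! ### The unitary transform attached to a Plancherel kernel -/

/-- `L¹ ∩ L²` as a subspace of `L²(0, ∞)`. -/
def integrableSubmodule : Submodule ℂ L2 where
  carrier := {f | Integrable f μ₀}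
  zero_mem' := (integrable_zero _ _ _).congr (Lp.coeFn_zero ℂ 2 μ₀).symm
  add_mem' {f g} hf hg := (hf.add hg).congr (Lp.coeFn_add f g).symm
  smul_mem' c f hf := (hf.smul c).congr (Lp.coeFn_smul c f).symm

theorem integrable_truncOp (n : ℕ) (f : L2) : Integrable (truncOp n f) μ₀ := by
  refine Integrable.congr ?_ (coeFn_truncOp n f).symm
  rw [integrable_indicator_iff measurableSet_Ioo, IntegrableOn,
    Measure.restrict_restrict measurableSet_Ioo]
  have hfin : IsFiniteMeasure (volume.restrict (Ioo (-n : ℝ) n ∩ Ioi 0)) :=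
    ⟨by
      rw [Measure.restrict_apply_univ]
      exact (measure_mono inter_subset_left).trans_lt measure_Ioo_lt_top⟩
  have : MemLp f 2 (volume.restrict (Ioo (-n : ℝ) n ∩ Ioi 0)) :=
    (Lp.memLp f).mono_measure (Measure.restrict_mono inter_subset_right le_rfl)
  exact this.integrable (by norm_num)

theorem denseRange_integrableSubmodule : DenseRange integrableSubmodule.subtype := fun f =>
  mem_closure_of_tendsto (tendsto_truncOp f) (Eventually.of_forall fun n =>
    ⟨⟨truncOp n f, integrable_truncOp n f⟩, rfl⟩)

theorem isClosed_property_L2 {p : L2 → Prop} (hp : IsClosed {f | p f})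
    (h : ∀ f : L2, Integrable f μ₀ → p f) (f : L2) : p f :=
  isClosed_property denseRange_integrableSubmodule hp (fun f => h f f.2) f

theorem enorm_normalization_sq : ‖κ‖ₑ ^ 2 = ENNReal.ofReal (2 / Real.pi) := by
  rw [← ofReal_norm, Complex.norm_real, Real.norm_of_nonneg (by positivity),
    ← ENNReal.ofReal_pow (by positivity), Real.sq_sqrt (by positivity)]

theorem kernelTransform_congr {k : ℝ → ℝ} {f g : ℝ → ℂ} (h : f =ᵐ[μ₀] g) :
    kernelTransform k f = kernelTransform k g := by
  funext x
  refine integral_congr_ae ?_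
  filter_upwards [h] with ξ hξ
  rw [hξ]

namespace IsPlancherelKernel

variable {k : ℝ → ℝ} (hk : IsPlancherelKernel k)

theorem integrable_mul (hk : IsPlancherelKernel k) {f : ℝ → ℂ} (hf : Integrable f μ₀) (x : ℝ) :
    Integrable (fun ξ => f ξ * (k (x * ξ) : ℂ)) μ₀ := by
  have hc := hk.continuous
  refine hf.mul_bdd (c := 1) (by fun_prop) (Eventually.of_forall fun ξ => ?_)
  simpa using hk.abs_le _

theorem continuous_kernelTransform (hk : IsPlancherelKernel k) {f : ℝ → ℂ} (hf : Integrable f μ₀) :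
    Continuous (kernelTransform k f) := by
  have hc := hk.continuous
  refine continuous_of_dominated (bound := fun ξ => ‖f ξ‖) (fun x => (hk.integrable_mul hf x).1)
    (fun x => Eventually.of_forall fun ξ => ?_) hf.norm
    (Eventually.of_forall fun ξ => by fun_prop)
  rw [norm_mul, Complex.norm_real]
  exact mul_le_of_le_one_right (norm_nonneg _) (hk.abs_le _)

theorem lintegral_kernelTransform (hk : IsPlancherelKernel k) {f : ℝ → ℂ}
    (h1 : Integrable f μ₀) (h2 : MemLp f 2 μ₀) :
    ∫⁻ x in Ioi (0 : ℝ), ‖κ * kernelTransform k f x‖ₑ ^ 2 =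
      ∫⁻ x in Ioi (0 : ℝ), ‖f x‖ₑ ^ 2 := by
  rw [← hk.lintegral_eq f h1 h2, ← lintegral_const_mul' _ _ (by simp)]
  refine lintegral_congr fun x => ?_
  rw [enorm_mul, mul_pow, enorm_normalization_sq]

theorem memLp_kernelTransform (hk : IsPlancherelKernel k) {f : ℝ → ℂ}
    (h1 : Integrable f μ₀) (h2 : MemLp f 2 μ₀) :
    MemLp (fun x => κ * kernelTransform k f x) 2 μ₀ := by
  refine memLp_two_of_lintegral_lt_top
    ((hk.continuous_kernelTransform h1).const_mul κ).aestronglyMeasurable ?_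
  rw [hk.lintegral_kernelTransform h1 h2]
  exact lintegral_lt_top_of_memLp_two h2

/-- The normalized transform on `L¹ ∩ L²`. -/
def preOp : integrableSubmodule →ₗ[ℂ] L2 where
  toFun f := (hk.memLp_kernelTransform f.2 (Lp.memLp _)).toLp _
  map_add' f g := by
    rw [← MemLp.toLp_add]
    refine MemLp.toLp_congr _ _ (Eventually.of_forall fun x => ?_)
    have : kernelTransform k (f + g : L2) = kernelTransform k (fun ξ => f.1 ξ + g.1 ξ) :=
      kernelTransform_congr (Lp.coeFn_add f.1 g.1)
    have h2 := integral_add (hk.integrable_mul f.2 x) (hk.integrable_mul g.2 x)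
    rw [Pi.add_apply, ← mul_add, Submodule.coe_add, this]
    simp only [kernelTransform, add_mul]
    rw [h2]
  map_smul' c f := by
    rw [RingHom.id_apply, ← MemLp.toLp_const_smul]
    refine MemLp.toLp_congr _ _ (Eventually.of_forall fun x => ?_)
    have : kernelTransform k (c • f : L2) = kernelTransform k (fun ξ => c * f.1 ξ) :=
      kernelTransform_congr (Lp.coeFn_smul c f.1)
    rw [Pi.smul_apply, Submodule.coe_smul, this]
    simp only [kernelTransform, mul_assoc, integral_const_mul, smul_eq_mul]
    ring

theorem norm_preOp (f : integrableSubmodule) : ‖hk.preOp f‖ = ‖integrableSubmodule.subtype f‖ := by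
  have h : ‖hk.preOp f‖ₑ ^ 2 = ‖(f : L2)‖ₑ ^ 2 := by
    rw [enorm_sq_L2, enorm_sq_L2, ← hk.lintegral_kernelTransform f.2 (Lp.memLp _)]
    refine lintegral_congr_ae ?_
    filter_upwards [(hk.memLp_kernelTransform f.2 (Lp.memLp _)).coeFn_toLp] with x hx
    exact congrArg (fun z => ‖z‖ₑ ^ 2) hx
  have h' := (ENNReal.pow_right_strictMono (n := 2) (by norm_num)).injective h
  rw [← ofReal_norm, ← ofReal_norm] at h'
  exact (ENNReal.ofReal_eq_ofReal_iff (norm_nonneg _) (norm_nonneg _)).1 h'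

/-- The normalized transform as a bounded operator. -/
def op : L2 →L[ℂ] L2 := hk.preOp.extendOfNorm integrableSubmodule.subtype

theorem op_eq_preOp (f : integrableSubmodule) : hk.op f = hk.preOp f :=
  LinearMap.extendOfNorm_eq denseRange_integrableSubmodule
    ⟨1, fun f => by rw [one_mul, hk.norm_preOp]⟩ f

theorem coeFn_op {f : L2} (hf : Integrable f μ₀) :
    hk.op f =ᵐ[μ₀] fun x => κ * kernelTransform k f x := by
  rw [hk.op_eq_preOp ⟨f, hf⟩]
  exact (hk.memLp_kernelTransform hf (Lp.memLp _)).coeFn_toLp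

theorem norm_op (f : L2) : ‖hk.op f‖ = ‖f‖ := by
  refine isClosed_property_L2 (p := fun f => ‖hk.op f‖ = ‖f‖)
    (isClosed_eq (by fun_prop) (by fun_prop)) (fun f hf => ?_) f
  rw [hk.op_eq_preOp ⟨f, hf⟩, hk.norm_preOp]
  rfl

theorem inner_op_of_integrable {f g : L2} (hf : Integrable f μ₀) (hg : Integrable g μ₀) :
    inner ℂ (hk.op f) g = inner ℂ f (hk.op g) := by
  have hc := hk.continuous
  have e1 : inner ℂ (hk.op f) g = κ * ∫ x in Ioi (0 : ℝ), ∫ ξ in Ioi (0 : ℝ),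
      (conj (f ξ) * g x) * (k (x * ξ) : ℂ) := by
    rw [inner_L2, ← integral_const_mul]
    refine integral_congr_ae ?_
    filter_upwards [hk.coeFn_op hf] with x hx
    rw [hx, map_mul, kernelTransform, ← integral_conj, Complex.conj_ofReal, mul_assoc,
      ← integral_mul_const]
    congr 1
    refine integral_congr_ae (Eventually.of_forall fun ξ => ?_)
    simp only [map_mul, Complex.conj_ofReal]
    ring
  have e2 : inner ℂ f (hk.op g) = κ * ∫ ξ in Ioi (0 : ℝ), ∫ x in Ioi (0 : ℝ),
      (conj (f ξ) * g x) * (k (x * ξ) : ℂ) := by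
    rw [inner_L2, ← integral_const_mul]
    refine integral_congr_ae ?_
    filter_upwards [hk.coeFn_op hg] with ξ hξ
    rw [hξ, kernelTransform, mul_left_comm, ← integral_const_mul]
    congr 1
    refine integral_congr_ae (Eventually.of_forall fun x => ?_)
    simp only [mul_comm x ξ]
    ring
  rw [e1, e2, integral_integral_swap]
  have hp : Integrable (fun p : ℝ × ℝ => g p.1 * conj (f p.2)) (Measure.prod μ₀ μ₀) :=
    hg.mul_prod (f := g) (g := fun ξ => conj (f ξ)) (Complex.conjLIE.integrable_comp_iff.2 hf)
  refine (hp.mul_bdd (c := 1) (g := fun p : ℝ × ℝ => (k (p.1 * p.2) : ℂ))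
    (by fun_prop) (Eventually.of_forall fun p => ?_)).congr
    (Eventually.of_forall fun p => ?_)
  · simpa using hk.abs_le _
  · simp [Function.uncurry, mul_comm]

theorem inner_op (f g : L2) : inner ℂ (hk.op f) g = inner ℂ f (hk.op g) := by
  refine isClosed_property_L2 (p := fun f => inner ℂ (hk.op f) g = inner ℂ f (hk.op g))
    (isClosed_eq (by fun_prop) (by fun_prop)) (fun f hf => ?_) f
  exact isClosed_property_L2 (p := fun g => inner ℂ (hk.op f) g = inner ℂ f (hk.op g))
    (isClosed_eq (by fun_prop) (by fun_prop)) (fun g hg => hk.inner_op_of_integrable hf hg) g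

theorem op_op (f : L2) : hk.op (hk.op f) = f := by
  refine ext_inner_left ℂ fun g => ?_
  rw [← hk.inner_op]
  exact (LinearMap.norm_map_iff_inner_map_map hk.op).1 hk.norm_op g f

theorem inner_op_op (f g : L2) : inner ℂ (hk.op f) (hk.op g) = inner ℂ f g := by
  rw [hk.inner_op, hk.op_op]

/-- The normalized transform as a unitary operator on `L²(0, ∞)`. -/
def unitary : L2 ≃ₗᵢ[ℂ] L2 where
  toFun := hk.op
  invFun := hk.op
  map_add' := map_add _
  map_smul' := map_smul _
  left_inv := hk.op_op
  right_inv := hk.op_op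
  norm_map' := hk.norm_op

end IsPlancherelKernel

/-! ### Measures carried by the negative half axis -/

/-- The point `-η²` of the negative half axis. -/
def axisPoint (η : ℝ) : ℂ := -(η : ℂ) ^ 2

theorem continuous_axisPoint : Continuous axisPoint := by
  unfold axisPoint
  fun_prop

theorem norm_axisPoint (η : ℝ) : ‖axisPoint η‖ = η ^ 2 := by
  simp [axisPoint]

/-- The image under `η ↦ -η²` of the measure with density `ρ` on `(0, ∞)`. -/
def axisMeasure (ρ : ℝ → ℝ≥0∞) : Measure ℂ := (Measure.withDensity μ₀ ρ).map axisPoint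

theorem axisMeasure_apply (ρ : ℝ → ℝ≥0∞) {S : Set ℂ} (hS : MeasurableSet S) :
    axisMeasure ρ S = ∫⁻ η in axisPoint ⁻¹' S, ρ η ∂μ₀ := by
  have hm := continuous_axisPoint.measurable
  rw [axisMeasure, Measure.map_apply hm hS, withDensity_apply _ (hm hS)]

theorem axisMeasure_congr {ρ σ : ℝ → ℝ≥0∞} (h : ρ =ᵐ[μ₀] σ) : axisMeasure ρ = axisMeasure σ := by
  rw [axisMeasure, withDensity_congr_ae h, axisMeasure]

theorem halfAxisMeasure_eq (w : ℝ → ℝ) :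
    halfAxisMeasure w =
      axisMeasure fun η => ENNReal.ofReal (2 * η) * ENNReal.ofReal (w (-η ^ 2)) := by
  ext S hS
  have hR : MeasurableSet ((fun z : ℝ => (z : ℂ)) ⁻¹' S) := Complex.measurable_ofReal hS
  rw [axisMeasure_apply _ hS, halfAxisMeasure, Measure.map_apply Complex.measurable_ofReal hS,
    withDensity_apply _ hR, Measure.restrict_restrict hR,
    Measure.restrict_restrict (continuous_axisPoint.measurable hS)]
  have hae : ((fun z : ℝ => (z : ℂ)) ⁻¹' S ∩ Iic 0 : Set ℝ) =ᵐ[volume]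
      ((fun z : ℝ => (z : ℂ)) ⁻¹' S ∩ Iio 0 : Set ℝ) := (ae_eq_refl _).inter Iio_ae_eq_Iic.symm
  rw [setLIntegral_congr hae]
  have him : (fun η : ℝ => -η ^ 2) '' (axisPoint ⁻¹' S ∩ Ioi 0) =
      (fun z : ℝ => (z : ℂ)) ⁻¹' S ∩ Iio 0 := by
    ext z
    constructor
    · rintro ⟨η, ⟨h1, h2⟩, rfl⟩
      refine ⟨?_, ?_⟩
      · simpa [axisPoint] using h1
      · have : 0 < η := h2
        change -η ^ 2 < 0
        nlinarith
    · rintro ⟨h1, h2⟩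
      have h2' : 0 < -z := by simpa using h2
      have hz : -√(-z) ^ 2 = z := by rw [Real.sq_sqrt h2'.le, neg_neg]
      refine ⟨√(-z), ⟨?_, Real.sqrt_pos.2 h2'⟩, hz⟩
      have : axisPoint √(-z) = z := by
        rw [axisPoint, ← Complex.ofReal_pow, ← Complex.ofReal_neg, hz]
      rw [mem_preimage, this]
      exact h1
  have h := lintegral_image_eq_lintegral_abs_deriv_mul (f := fun η : ℝ => -η ^ 2)
    (f' := fun η => -(2 * η)) (s := axisPoint ⁻¹' S ∩ Ioi 0)
    ((continuous_axisPoint.measurable hS).inter measurableSet_Ioi)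
    (fun η _ => by simpa using ((hasDerivAt_pow 2 η).fun_neg).hasDerivWithinAt)
    (fun a ha b hb hab => by
      have ha' : 0 < a := ha.2
      have hb' : 0 < b := hb.2
      simp only [neg_inj] at hab
      exact (pow_left_inj₀ ha'.le hb'.le (by norm_num)).1 hab)
    (fun z => ENNReal.ofReal (w z))
  rw [him] at h
  rw [h]
  refine setLIntegral_congr_fun ((continuous_axisPoint.measurable hS).inter measurableSet_Ioi)
    fun η hη => ?_
  have : 0 < η := hη.2
  rw [abs_neg, abs_of_pos (by positivity)]

theorem norm_add_sq_lower {z : ℂ} (hz : z ∈ Complex.slitPlane) :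
    ∃ c : ℝ, 0 < c ∧ ∀ η : ℝ, c * (1 + η ^ 2) ≤ ‖z + (η : ℂ) ^ 2‖ := by
  have hne : ∀ t : ℝ, 0 ≤ t → z + t ≠ 0 := by
    intro t ht h
    have : z = ((-t : ℝ) : ℂ) := by
      rw [Complex.ofReal_neg]
      exact eq_neg_of_add_eq_zero_left h
    rw [this, Complex.ofReal_mem_slitPlane] at hz
    linarith
  obtain ⟨t₀, ht₀, hmin⟩ := isCompact_Icc.exists_isMinOn (f := fun t : ℝ => ‖z + t‖)
    (nonempty_Icc.2 (by positivity : (0 : ℝ) ≤ 2 * ‖z‖ + 1)) (by fun_prop)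
  have hδ : 0 < ‖z + t₀‖ := norm_pos_iff.2 (hne t₀ ht₀.1)
  refine ⟨min (1 / 2) (‖z + t₀‖ / (2 * ‖z‖ + 2)), lt_min (by norm_num) (by positivity),
    fun η => ?_⟩
  have hcast : ((η : ℂ)) ^ 2 = ((η ^ 2 : ℝ) : ℂ) := by push_cast; rfl
  rw [hcast]
  rcases le_total (η ^ 2) (2 * ‖z‖ + 1) with h | h
  · have h1 : ‖z + t₀‖ ≤ ‖z + ((η ^ 2 : ℝ) : ℂ)‖ := hmin ⟨sq_nonneg η, h⟩
    calc _ ≤ ‖z + t₀‖ / (2 * ‖z‖ + 2) * (1 + η ^ 2) := by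
          gcongr
          exact min_le_right _ _
      _ ≤ ‖z + t₀‖ / (2 * ‖z‖ + 2) * (2 * ‖z‖ + 2) := by
          exact mul_le_mul_of_nonneg_left (by linarith) (by positivity)
      _ = ‖z + t₀‖ := by field_simp
      _ ≤ _ := h1
  · calc _ ≤ 1 / 2 * (1 + η ^ 2) := by
          gcongr
          exact min_le_left _ _
      _ ≤ η ^ 2 - ‖z‖ := by linarith
      _ = ‖((η ^ 2 : ℝ) : ℂ)‖ - ‖z‖ := by
          rw [Complex.norm_real, Real.norm_of_nonneg (sq_nonneg η)]
      _ ≤ _ := by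
          rw [add_comm]
          exact norm_sub_le_norm_add _ _

theorem norm_add_sq_upper (z : ℂ) (η : ℝ) : ‖z + (η : ℂ) ^ 2‖ ≤ (1 + ‖z‖) * (1 + η ^ 2) := by
  refine (norm_add_le _ _).trans ?_
  rw [norm_pow, Complex.norm_real, Real.norm_eq_abs, sq_abs]
  nlinarith [norm_nonneg z, sq_nonneg η, mul_nonneg (norm_nonneg z) (sq_nonneg η)]

theorem add_sq_ne_zero {z : ℂ} (hz : z ∈ Complex.slitPlane) (η : ℝ) : z + (η : ℂ) ^ 2 ≠ 0 := by
  obtain ⟨c, hc, h⟩ := norm_add_sq_lower hz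
  refine norm_pos_iff.1 (lt_of_lt_of_le ?_ (h η))
  positivity

/-- The multiplier `η ↦ 1 / (z + η²)` of the resolvent. -/
def resolventSymbol (z : ℂ) (η : ℝ) : ℂ := (z + (η : ℂ) ^ 2)⁻¹

theorem norm_resolventSymbol_le {z : ℂ} (hz : z ∈ Complex.slitPlane) :
    ∃ C : ℝ, 0 < C ∧ ∀ η : ℝ, ‖resolventSymbol z η‖ ≤ C * (1 + η ^ 2)⁻¹ := by
  obtain ⟨c, hc, h⟩ := norm_add_sq_lower hz
  refine ⟨c⁻¹, by positivity, fun η => ?_⟩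
  rw [resolventSymbol, norm_inv, ← mul_inv]
  exact inv_anti₀ (by positivity) (h η)

theorem measurable_resolventSymbol (z : ℂ) : Measurable (resolventSymbol z) := by
  unfold resolventSymbol
  fun_prop

theorem isBddMeas_resolventSymbol {z : ℂ} (hz : z ∈ Complex.slitPlane) :
    IsBddMeas (resolventSymbol z) := by
  obtain ⟨C, hC, h⟩ := norm_resolventSymbol_le hz
  refine ⟨measurable_resolventSymbol z, C, fun η => (h η).trans ?_⟩
  refine mul_le_of_le_one_right hC.le (inv_le_one_of_one_le₀ ?_)
  nlinarith [sq_nonneg η]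

theorem isBddMeas_axis_mul_resolventSymbol {z : ℂ} (hz : z ∈ Complex.slitPlane) :
    IsBddMeas (fun η => axisPoint η * resolventSymbol z η) := by
  obtain ⟨C, hC, h⟩ := norm_resolventSymbol_le hz
  refine ⟨continuous_axisPoint.measurable.mul (measurable_resolventSymbol z), C, fun η => ?_⟩
  rw [norm_mul, norm_axisPoint]
  calc _ ≤ η ^ 2 * (C * (1 + η ^ 2)⁻¹) := by
        gcongr
        exact h η
    _ = C * (η ^ 2 / (1 + η ^ 2)) := by ring
    _ ≤ C := mul_le_of_le_one_right hC.le ((div_le_one (by positivity)).2 (by linarith))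

theorem sub_axisPoint (z : ℂ) (η : ℝ) : z - axisPoint η = z + (η : ℂ) ^ 2 := by
  rw [axisPoint, sub_neg_eq_add]

theorem eq_axisPoint_mul_iff {z : ℂ} (hz : z ∈ Complex.slitPlane) (F G : L2) :
    (G =ᵐ[μ₀] fun η => axisPoint η * F η) ↔
      mulOp (resolventSymbol z) G = mulOp (fun η => axisPoint η * resolventSymbol z η) F :=
  ae_eq_mul_iff_mulOp (isBddMeas_resolventSymbol hz) (isBddMeas_axis_mul_resolventSymbol hz)
    (fun η => inv_ne_zero (add_sq_ne_zero hz η)) F G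

/-! ### Operators unitarily equivalent to multiplication by `-η²` -/

section Model

variable {H : Type} [NormedAddCommGroup H] [InnerProductSpace ℂ H]

theorem IsResolventAt.unique {A : H →ₗ.[ℂ] H} {z : ℂ} {R R' : H →L[ℂ] H}
    (h : IsResolventAt A z R) (h' : IsResolventAt A z R') : R = R' := by
  ext x
  obtain ⟨h1, h2⟩ := h.1 x
  have h3 := h'.2 ⟨R x, h1⟩
  rw [h2] at h3
  exact h3.symm

theorem IsResolventAt.resolvent_eq {A : H →ₗ.[ℂ] H} {z : ℂ} {R : H →L[ℂ] H}
    (h : IsResolventAt A z R) : resolvent A z = R := by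
  have hex : ∃ R : H →L[ℂ] H, IsResolventAt A z R := ⟨R, h⟩
  rw [resolvent, dif_pos hex]
  exact hex.choose_spec.unique h

/-- The unitary operator `V` transforms `A` into multiplication by `-η²`. -/
def IsModel (A : H →ₗ.[ℂ] H) (V : H ≃ₗᵢ[ℂ] L2) : Prop :=
  ∀ f g : H, (f, g) ∈ A.graph ↔ V g =ᵐ[μ₀] fun η => axisPoint η * V f η

/-- The operator that `V` transforms into multiplication by `φ`. -/
def conjOp (V : H ≃ₗᵢ[ℂ] L2) (φ : ℝ → ℂ) : H →L[ℂ] H :=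
  (V.symm.toContinuousLinearEquiv : L2 →L[ℂ] H) ∘L mulOp φ ∘L
    (V.toContinuousLinearEquiv : H →L[ℂ] L2)

theorem map_conjOp (V : H ≃ₗᵢ[ℂ] L2) (φ : ℝ → ℂ) (x : H) :
    V (conjOp V φ x) = mulOp φ (V x) := V.apply_symm_apply _

theorem conjOp_apply (V : H ≃ₗᵢ[ℂ] L2) (φ : ℝ → ℂ) (x : H) :
    conjOp V φ x = V.symm (mulOp φ (V x)) := rfl

theorem conjOp_mul (V : H ≃ₗᵢ[ℂ] L2) {φ ψ : ℝ → ℂ} (hφ : IsBddMeas φ) (hψ : IsBddMeas ψ) :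
    conjOp V (fun x => φ x * ψ x) = conjOp V φ * conjOp V ψ := by
  ext x
  refine V.injective ?_
  rw [map_conjOp, ← mulOp_mulOp hφ hψ, ← map_conjOp, ← map_conjOp]
  rfl

theorem conjOp_one (V : H ≃ₗᵢ[ℂ] L2) : conjOp V (fun _ => 1) = 1 := by
  ext x
  refine V.injective ?_
  rw [map_conjOp, mulOp_one]
  rfl

theorem tendsto_conjOp (V : H ≃ₗᵢ[ℂ] L2) {ι : Type*} {l : Filter ι} {φ : ι → ℝ → ℂ}
    {φ₀ : ℝ → ℂ} {x : H} (h : Tendsto (fun i => mulOp (φ i) (V x)) l (𝓝 (mulOp φ₀ (V x)))) :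
    Tendsto (fun i => conjOp V (φ i) x) l (𝓝 (conjOp V φ₀ x)) :=
  (V.symm.continuous.tendsto _).comp h

namespace IsModel

variable {A : H →ₗ.[ℂ] H} {V : H ≃ₗᵢ[ℂ] L2}

theorem map_apply (hA : IsModel A V) (x : A.domain) :
    V (A x) =ᵐ[μ₀] fun η => axisPoint η * V x η :=
  (hA _ _).1 (A.mem_graph x)

theorem isResolventAt (hA : IsModel A V) {z : ℂ} (hz : z ∈ Complex.slitPlane) :
    IsResolventAt A z (conjOp V (resolventSymbol z)) := by
  have hb := isBddMeas_resolventSymbol hz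
  constructor
  · intro x
    have hg : (conjOp V (resolventSymbol z) x,
        conjOp V (fun η => axisPoint η * resolventSymbol z η) x) ∈ A.graph := by
      rw [hA, map_conjOp, map_conjOp]
      filter_upwards [coeFn_mulOp hb (V x),
        coeFn_mulOp (isBddMeas_axis_mul_resolventSymbol hz) (V x)] with η h1 h2
      rw [h1, h2, mul_assoc]
    obtain ⟨h, h'⟩ := A.mem_graph_iff.1 hg
    have hd : conjOp V (resolventSymbol z) x ∈ A.domain := LinearPMap.mem_domain_of_mem_graph hg
    refine ⟨hd, V.injective ?_⟩
    rw [← (LinearPMap.image_iff hd).2 hg, map_sub, map_smul, map_conjOp, map_conjOp]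
    refine Lp.ext ?_
    filter_upwards [coeFn_mulOp hb (V x), Lp.coeFn_sub (z • mulOp (resolventSymbol z) (V x))
      (mulOp (fun η => axisPoint η * resolventSymbol z η) (V x)),
      Lp.coeFn_smul z (mulOp (resolventSymbol z) (V x)),
      coeFn_mulOp (isBddMeas_axis_mul_resolventSymbol hz) (V x)] with η h1 h2 h3 h4
    rw [h2, Pi.sub_apply, h3, Pi.smul_apply, h1, h4, smul_eq_mul, mul_assoc, ← sub_mul,
      sub_axisPoint, resolventSymbol, ← mul_assoc, mul_inv_cancel₀ (add_sq_ne_zero hz η), one_mul]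
  · intro x
    refine V.injective ?_
    rw [map_conjOp, map_sub, map_smul]
    refine Lp.ext ?_
    filter_upwards [coeFn_mulOp hb (z • V x - V (A x)), Lp.coeFn_sub (z • V x) (V (A x)),
      Lp.coeFn_smul z (V x), hA.map_apply x] with η h1 h2 h3 h4
    rw [h1, h2, Pi.sub_apply, h3, Pi.smul_apply, h4, smul_eq_mul, ← sub_mul, sub_axisPoint,
      resolventSymbol, ← mul_assoc, inv_mul_cancel₀ (add_sq_ne_zero hz η), one_mul]

theorem mem_resolventSet (hA : IsModel A V) {z : ℂ} (hz : z ∈ Complex.slitPlane) :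
    z ∈ resolventSet A := ⟨_, hA.isResolventAt hz⟩

theorem resolvent_eq (hA : IsModel A V) {z : ℂ} (hz : z ∈ Complex.slitPlane) :
    resolvent A z = conjOp V (resolventSymbol z) := (hA.isResolventAt hz).resolvent_eq

theorem mem_slitPlane (hA : IsModel A V) {s : ℂ} (hs : s ∈ resolventSet A) :
    s ∈ Complex.slitPlane := by
  obtain ⟨R, hR⟩ := hs
  by_contra hn
  rw [Complex.mem_slitPlane_iff, not_or, not_lt, not_not] at hn
  set a : ℝ := √(-s.re) with ha
  have ha0 : 0 ≤ a := Real.sqrt_nonneg _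
  have hsa : s = ((-a ^ 2 : ℝ) : ℂ) := by
    rw [ha, Real.sq_sqrt (by linarith [hn.1]), neg_neg]
    exact Complex.ext (by simp) (by simp [hn.2])
  set K : ℝ := ‖R‖ * (2 * a + 1) with hK
  have hK0 : 0 ≤ K := by positivity
  set ε : ℝ := (K + 1)⁻¹ with hε
  have hε0 : 0 < ε := by positivity
  have hε1 : ε ≤ 1 := inv_le_one_of_one_le₀ (by linarith)
  have hKε : K * ε < 1 := by
    rw [hε, ← div_eq_mul_inv, div_lt_one (by linarith)]
    linarith
  have hlp : MemLp ((Ioo a (a + ε)).indicator fun _ => (1 : ℂ)) 2 μ₀ :=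
    memLp_indicator_const 2 measurableSet_Ioo 1 (Or.inr (by
      rw [Measure.restrict_apply measurableSet_Ioo]
      exact ((measure_mono inter_subset_left).trans_lt (by simp)).ne))
  set f : L2 := hlp.toLp _ with hf
  have hlp' : MemLp (fun η => axisPoint η * (Ioo a (a + ε)).indicator (fun _ => (1 : ℂ)) η) 2 μ₀ := by
    refine (hlp.const_mul (((a + 1) ^ 2 : ℝ) : ℂ)).mono
      (continuous_axisPoint.aestronglyMeasurable.mul hlp.1)
      (Eventually.of_forall fun η => ?_)
    by_cases h : η ∈ Ioo a (a + ε)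
    · have h0 : 0 ≤ η := ha0.trans h.1.le
      have h1 : η ≤ a + 1 := h.2.le.trans (by linarith)
      rw [norm_mul, norm_mul, norm_axisPoint, Complex.norm_real, Real.norm_of_nonneg (by positivity)]
      gcongr
    · simp [indicator_of_notMem h]
  set g : L2 := hlp'.toLp _ with hg
  have hgr : (V.symm f, V.symm g) ∈ A.graph := by
    rw [hA, V.apply_symm_apply, V.apply_symm_apply]
    filter_upwards [hlp.coeFn_toLp, hlp'.coeFn_toLp] with η h1 h2
    rw [h1, h2]
  have hd := LinearPMap.mem_domain_of_mem_graph hgr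
  have hR2 := hR.2 ⟨_, hd⟩
  rw [← (LinearPMap.image_iff hd).2 hgr] at hR2
  have hle : ‖s • f - g‖ ≤ ‖((ε * (2 * a + 1) : ℝ) : ℂ) • f‖ := by
    refine norm_le_of_ae_norm_le ?_
    filter_upwards [hlp.coeFn_toLp, hlp'.coeFn_toLp, Lp.coeFn_sub (s • f) g, Lp.coeFn_smul s f,
      Lp.coeFn_smul ((ε * (2 * a + 1) : ℝ) : ℂ) f] with η h1 h2 h3 h4 h5
    rw [h3, Pi.sub_apply, h4, h5, Pi.smul_apply, Pi.smul_apply, h1, h2, smul_eq_mul, ← sub_mul,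
      norm_smul, norm_mul, sub_axisPoint]
    by_cases h : η ∈ Ioo a (a + ε)
    · gcongr
      rw [hsa, ← Complex.ofReal_pow, ← Complex.ofReal_add, Complex.norm_real, Complex.norm_real,
        Real.norm_of_nonneg (by nlinarith [h.1]), Real.norm_of_nonneg (by positivity)]
      nlinarith [h.1, h.2]
    · simp [indicator_of_notMem h]
  have hfpos : 0 < ‖f‖ := by
    rw [norm_pos_iff]
    intro h0
    have h1 : ∀ᵐ η ∂μ₀, η ∉ Ioo a (a + ε) := by
      filter_upwards [hlp.coeFn_toLp, Lp.coeFn_zero ℂ 2 μ₀] with η h1 h2 hη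
      rw [← hf, h0, h2, indicator_of_mem hη] at h1
      simp at h1
    have h2 : μ₀ (Ioo a (a + ε)) = 0 := by
      have := ae_iff.1 h1
      simpa only [not_not, ofPred_mem_eq] using this
    have h3 : Ioo a (a + ε) ⊆ Ioi 0 := fun x hx => ha0.trans_lt hx.1
    rw [Measure.restrict_apply measurableSet_Ioo, inter_eq_left.2 h3, Real.volume_Ioo] at h2
    simp at h2
    linarith
  have : ‖f‖ ≤ K * ε * ‖f‖ := by
    calc ‖f‖ = ‖V.symm f‖ := (V.symm.norm_map f).symm
      _ = ‖R (s • V.symm f - V.symm g)‖ := by rw [hR2]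
      _ ≤ ‖R‖ * ‖s • V.symm f - V.symm g‖ := R.le_opNorm _
      _ = ‖R‖ * ‖s • f - g‖ := by rw [← map_smul, ← map_sub, V.symm.norm_map]
      _ ≤ ‖R‖ * ‖((ε * (2 * a + 1) : ℝ) : ℂ) • f‖ := by gcongr
      _ = K * ε * ‖f‖ := by
        rw [norm_smul, Complex.norm_real, Real.norm_of_nonneg (by positivity), hK]
        ring
  nlinarith

end IsModel

end Model

section Model

variable {H : Type} [NormedAddCommGroup H] [InnerProductSpace ℂ H]

theorem inner_conjOp (V : H ≃ₗᵢ[ℂ] L2) (φ : ℝ → ℂ) (x y : H) :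
    inner ℂ x (conjOp V φ y) = inner ℂ (V x) (mulOp φ (V y)) := by
  rw [← map_conjOp, V.inner_map_map]

/-! ### The spectral measure -/

/-- The multiplier of the spectral projection of the Borel set `S`. -/
def spectralSymbol (S : Set ℂ) : ℝ → ℂ := (axisPoint ⁻¹' S).indicator fun _ => 1

theorem isBddMeas_spectralSymbol {S : Set ℂ} (hS : MeasurableSet S) :
    IsBddMeas (spectralSymbol S) :=
  IsBddMeas.indicator (continuous_axisPoint.measurable hS)

theorem spectralSymbol_inter (S S' : Set ℂ) :
    spectralSymbol (S ∩ S') = fun η => spectralSymbol S η * spectralSymbol S' η := by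
  funext η
  by_cases h : axisPoint η ∈ S <;> by_cases h' : axisPoint η ∈ S' <;>
    simp [spectralSymbol, h, h']

theorem conj_spectralSymbol (S : Set ℂ) (η : ℝ) :
    conj (spectralSymbol S η) = spectralSymbol S η := by
  by_cases h : axisPoint η ∈ S <;> simp [spectralSymbol, h]

theorem norm_sum_spectralSymbol_le {f : ℕ → Set ℂ} (hd : Pairwise (Function.onFun Disjoint f))
    (s : Finset ℕ) (η : ℝ) : ‖∑ n ∈ s, spectralSymbol (f n) η‖ ≤ 1 := by
  by_cases h : ∃ n ∈ s, axisPoint η ∈ f n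
  · obtain ⟨n, hn, hη⟩ := h
    rw [Finset.sum_eq_single_of_mem n hn]
    · simp [spectralSymbol, hη]
    · intro m _ hm
      have : axisPoint η ∉ f m := fun h' => (disjoint_left.1 (hd hm) h') hη
      simp [spectralSymbol, this]
  · push Not at h
    rw [Finset.sum_eq_zero]
    · simp
    · intro n hn
      simp [spectralSymbol, h n hn]

theorem hasSum_spectralSymbol {f : ℕ → Set ℂ} (hd : Pairwise (Function.onFun Disjoint f))
    (η : ℝ) : HasSum (fun n => spectralSymbol (f n) η) (spectralSymbol (⋃ n, f n) η) := by
  by_cases h : ∃ n, axisPoint η ∈ f n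
  · obtain ⟨n, hη⟩ := h
    have h1 : spectralSymbol (⋃ n, f n) η = spectralSymbol (f n) η := by
      have : axisPoint η ∈ ⋃ n, f n := mem_iUnion.2 ⟨n, hη⟩
      simp only [spectralSymbol]
      rw [indicator_of_mem (by exact this), indicator_of_mem (by exact hη)]
    rw [h1]
    refine hasSum_single n fun m hm => ?_
    have : axisPoint η ∉ f m := fun h' => (disjoint_left.1 (hd hm) h') hη
    simp [spectralSymbol, this]
  · push Not at h
    have h1 : ∀ n, spectralSymbol (f n) η = 0 := fun n => by simp [spectralSymbol, h n]
    have h2 : spectralSymbol (⋃ n, f n) η = 0 := by simp [spectralSymbol, h]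
    simp only [h1, h2]
    exact hasSum_zero

theorem mulOp_sum_spectralSymbol {f : ℕ → Set ℂ} (hf : ∀ n, MeasurableSet (f n))
    (hd : Pairwise (Function.onFun Disjoint f)) (s : Finset ℕ) (x : L2) :
    mulOp (fun η => ∑ n ∈ s, spectralSymbol (f n) η) x =
      ∑ n ∈ s, mulOp (spectralSymbol (f n)) x := by
  have hb : ∀ s : Finset ℕ, IsBddMeas (fun η => ∑ n ∈ s, spectralSymbol (f n) η) := fun s =>
    ⟨Finset.measurable_fun_sum s fun n _ => (isBddMeas_spectralSymbol (hf n)).1, 1,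
      norm_sum_spectralSymbol_le hd s⟩
  induction s using Finset.induction_on with
  | empty =>
    refine Lp.ext ?_
    filter_upwards [coeFn_mulOp (hb ∅) x, Lp.coeFn_zero ℂ 2 μ₀] with η h1 h2
    rw [h1, Finset.sum_empty, Finset.sum_empty, h2]
    simp
  | insert n s hn ih =>
    rw [Finset.sum_insert hn, ← ih]
    refine Lp.ext ?_
    filter_upwards [coeFn_mulOp (hb (insert n s)) x, coeFn_mulOp (hb s) x,
      coeFn_mulOp (isBddMeas_spectralSymbol (hf n)) x,
      Lp.coeFn_add (mulOp (spectralSymbol (f n)) x)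
        (mulOp (fun η => ∑ n ∈ s, spectralSymbol (f n) η) x)] with η h1 h2 h3 h4
    rw [h1, h4, Pi.add_apply, h2, h3, Finset.sum_insert hn, add_mul]

variable [CompleteSpace H]

/-- The spectral measure of an operator that `V` transforms into multiplication by `-η²`. -/
def spectralPVM (V : H ≃ₗᵢ[ℂ] L2) : ProjectionValuedMeasure H where
  toFun S := conjOp V (spectralSymbol S)
  isStarProjection S hS := by
    have hb := isBddMeas_spectralSymbol hS
    refine ⟨?_, ?_⟩
    · rw [IsIdempotentElem, ← conjOp_mul V hb hb, ← spectralSymbol_inter, inter_self]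
    · rw [ContinuousLinearMap.isSelfAdjoint_iff_isSymmetric]
      intro x y
      change inner ℂ (conjOp V (spectralSymbol S) x) y = inner ℂ x (conjOp V (spectralSymbol S) y)
      rw [inner_conjOp, ← V.inner_map_map, map_conjOp, inner_mulOp_left hb, inner_mulOp_right hb]
      simp only [conj_spectralSymbol]
  map_univ := by
    have : spectralSymbol univ = fun _ => 1 := by
      funext η
      simp [spectralSymbol]
    rw [this, conjOp_one]
  map_inter S S' hS hS' := by
    rw [spectralSymbol_inter,
      conjOp_mul V (isBddMeas_spectralSymbol hS) (isBddMeas_spectralSymbol hS')]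
  hasSum f hf hd x := by
    have h := tendsto_conjOp V (x := x) (tendsto_mulOp (l := SummationFilter.filter (.unconditional ℕ))
      (φ := fun s η => ∑ n ∈ s, spectralSymbol (f n) η) (φ₀ := spectralSymbol (⋃ n, f n)) (C := 1)
      (Eventually.of_forall fun s =>
        Finset.measurable_fun_sum s fun n _ => (isBddMeas_spectralSymbol (hf n)).1)
      (Eventually.of_forall fun s => norm_sum_spectralSymbol_le hd s)
      (isBddMeas_spectralSymbol (MeasurableSet.iUnion hf))
      (fun η _ => hasSum_spectralSymbol hd η) (V x))
    refine h.congr fun s => ?_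
    rw [conjOp_apply, mulOp_sum_spectralSymbol hf hd, map_sum]
    rfl

theorem scalar_spectralPVM (V : H ≃ₗᵢ[ℂ] L2) (x : H) :
    (spectralPVM V).scalar x = axisMeasure fun η => ‖V x η‖ₑ ^ 2 := by
  ext S hS
  have hm := continuous_axisPoint.measurable hS
  have hint : Integrable (fun η => ‖V x η‖ ^ 2) μ₀ := (Lp.memLp (V x)).norm.integrable_sq
  rw [ProjectionValuedMeasure.scalar_apply _ _ hS, axisMeasure_apply _ hS]
  have h1 : inner ℂ x ((spectralPVM V).toFun S x) =
      ((∫ η in axisPoint ⁻¹' S, ‖V x η‖ ^ 2 ∂μ₀ : ℝ) : ℂ) := by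
    rw [← integral_complex_ofReal, ← integral_indicator hm]
    change inner ℂ x (conjOp V (spectralSymbol S) x) = _
    rw [inner_conjOp, inner_mulOp_right (isBddMeas_spectralSymbol hS)]
    refine integral_congr_ae (Eventually.of_forall fun η => ?_)
    by_cases h : axisPoint η ∈ S
    · simp [spectralSymbol, h, Complex.conj_mul']
    · simp [spectralSymbol, h]
  rw [h1, Complex.ofReal_re, ofReal_integral_eq_lintegral_ofReal hint.integrableOn
    (Eventually.of_forall fun η => by positivity)]
  refine lintegral_congr fun η => ?_
  rw [ENNReal.ofReal_pow (norm_nonneg _), ofReal_norm]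

theorem aemeasurable_enorm_sq (f : L2) : AEMeasurable (fun η => ‖f η‖ₑ ^ 2) μ₀ :=
  (Lp.aestronglyMeasurable f).enorm.pow_const 2

theorem IsModel.isSpectralMeasure {A : H →ₗ.[ℂ] H} {V : H ≃ₗᵢ[ℂ] L2} (hA : IsModel A V) :
    IsSpectralMeasure A (spectralPVM V) := by
  constructor
  · intro x
    have key : ∫⁻ z, ‖z‖ₑ ^ 2 ∂((spectralPVM V).scalar x) =
        ∫⁻ η in Ioi (0 : ℝ), ‖axisPoint η * V x η‖ₑ ^ 2 := by
      rw [scalar_spectralPVM, axisMeasure,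
        lintegral_map (by fun_prop) continuous_axisPoint.measurable,
        lintegral_withDensity_eq_lintegral_mul₀ (aemeasurable_enorm_sq _)
          (by have := continuous_axisPoint; fun_prop)]
      refine lintegral_congr fun η => ?_
      rw [Pi.mul_apply, enorm_mul, mul_pow, mul_comm]
    rw [key]
    constructor
    · intro hx
      have h := lintegral_lt_top_of_memLp_two (Lp.memLp (V (A ⟨x, hx⟩)))
      rwa [lintegral_congr_ae (g := fun η => ‖axisPoint η * V x η‖ₑ ^ 2)] at h
      filter_upwards [hA.map_apply ⟨x, hx⟩] with η hη
      rw [hη]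
    · intro h
      have hm : MemLp (fun η => axisPoint η * V x η) 2 μ₀ :=
        memLp_two_of_lintegral_lt_top
          (continuous_axisPoint.aestronglyMeasurable.mul (Lp.aestronglyMeasurable _)) h
      have hg : (x, V.symm (hm.toLp _)) ∈ A.graph := by
        rw [hA, V.apply_symm_apply]
        exact hm.coeFn_toLp
      exact LinearPMap.mem_domain_of_mem_graph hg
  · intro x
    rw [scalar_spectralPVM, axisMeasure, integral_map continuous_axisPoint.measurable.aemeasurable
      (by fun_prop), integral_withDensity_eq_integral_toReal_smul₀ (aemeasurable_enorm_sq _)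
      (Eventually.of_forall fun η => ENNReal.pow_lt_top enorm_lt_top), ← V.inner_map_map, inner_L2]
    refine integral_congr_ae ?_
    filter_upwards [hA.map_apply x] with η hη
    rw [hη, mul_left_comm, Complex.conj_mul', ENNReal.toReal_pow, toReal_enorm, Complex.real_smul,
      mul_comm]
    push_cast
    rfl

end Model

/-! ### The semigroup -/

/-- The multiplier `e^{-tη²}` of the semigroup, for `t ≥ 0`. -/
def heatSymbol (t η : ℝ) : ℂ := (Real.exp (-(max t 0 * η ^ 2)) : ℂ)

theorem norm_heatSymbol_le (t η : ℝ) : ‖heatSymbol t η‖ ≤ 1 := by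
  rw [heatSymbol, Complex.norm_real, Real.norm_of_nonneg (Real.exp_pos _).le, Real.exp_le_one_iff,
    neg_nonpos]
  positivity

theorem continuous_heatSymbol (t : ℝ) : Continuous (heatSymbol t) := by
  unfold heatSymbol
  fun_prop

theorem isBddMeas_heatSymbol (t : ℝ) : IsBddMeas (heatSymbol t) :=
  ⟨(continuous_heatSymbol t).measurable, 1, norm_heatSymbol_le t⟩

theorem heatSymbol_add {s t : ℝ} (hs : 0 ≤ s) (ht : 0 ≤ t) :
    heatSymbol (s + t) = fun η => heatSymbol s η * heatSymbol t η := by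
  funext η
  rw [heatSymbol, heatSymbol, heatSymbol, max_eq_left hs, max_eq_left ht,
    max_eq_left (add_nonneg hs ht), ← Complex.ofReal_mul, ← Real.exp_add]
  congr 2
  ring

theorem tendsto_mulOp_heatSymbol (f : L2) (t₀ : ℝ) :
    Tendsto (fun t => mulOp (heatSymbol t) f) (𝓝 t₀) (𝓝 (mulOp (heatSymbol t₀) f)) := by
  refine tendsto_mulOp (C := 1) (Eventually.of_forall fun t => (isBddMeas_heatSymbol t).1)
    (Eventually.of_forall norm_heatSymbol_le) (isBddMeas_heatSymbol t₀) (fun η _ => ?_) f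
  have : Continuous fun t => heatSymbol t η := by
    unfold heatSymbol
    fun_prop
  exact this.tendsto t₀

theorem heatSymbol_zero : heatSymbol 0 = fun _ => 1 := by
  funext η
  simp [heatSymbol]

/-- The difference quotient of the multiplier of the semigroup. -/
def heatQuotient (t η : ℝ) : ℂ := ((t⁻¹ : ℝ) : ℂ) * (heatSymbol t η - 1)

theorem heatQuotient_eq {t : ℝ} (ht : 0 < t) (η : ℝ) :
    heatQuotient t η = ((t⁻¹ * (Real.exp (-(t * η ^ 2)) - 1) : ℝ) : ℂ) := by
  rw [heatQuotient, heatSymbol, max_eq_left ht.le]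
  push_cast
  rfl

theorem norm_heatQuotient_le {t : ℝ} (ht : 0 < t) (η : ℝ) :
    ‖heatQuotient t η‖ ≤ ‖axisPoint η‖ := by
  rw [heatQuotient_eq ht, Complex.norm_real, norm_axisPoint, norm_mul,
    Real.norm_of_nonneg (by positivity), Real.norm_eq_abs, abs_of_nonpos, inv_mul_le_iff₀ ht]
  · linarith [Real.add_one_le_exp (-(t * η ^ 2))]
  · have : Real.exp (-(t * η ^ 2)) ≤ 1 := by
      rw [Real.exp_le_one_iff, neg_nonpos]
      positivity
    linarith

theorem tendsto_heatQuotient (η : ℝ) :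
    Tendsto (fun t => heatQuotient t η) (𝓝[>] 0) (𝓝 (axisPoint η)) := by
  have hd : HasDerivAt (fun t : ℝ => Real.exp (-(t * η ^ 2))) (-η ^ 2) 0 := by
    have h := (((hasDerivAt_id (0 : ℝ)).mul_const (η ^ 2)).fun_neg).exp
    simpa using h
  have h1 : Tendsto (fun t : ℝ => t⁻¹ * (Real.exp (-(t * η ^ 2)) - 1)) (𝓝[>] 0) (𝓝 (-η ^ 2)) := by
    have h2 := (hasDerivAt_iff_tendsto_slope.1 hd).mono_left
      (nhdsWithin_mono 0 fun t (ht : 0 < t) => ht.ne')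
    refine h2.congr fun t => ?_
    simp [slope_def_field, div_eq_inv_mul]
  have h3 := (Complex.continuous_ofReal.tendsto _).comp h1
  rw [axisPoint, show -(η : ℂ) ^ 2 = ((-η ^ 2 : ℝ) : ℂ) by push_cast; rfl]
  refine h3.congr' ?_
  filter_upwards [self_mem_nhdsWithin] with t ht
  exact (heatQuotient_eq ht η).symm

section Model

variable {H : Type} [NormedAddCommGroup H] [InnerProductSpace ℂ H]

/-- The semigroup of an operator that `V` transforms into multiplication by `-η²`. -/
def heatSemigroup (V : H ≃ₗᵢ[ℂ] L2) : C0Semigroup H where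
  toFun t := conjOp V (heatSymbol t)
  map_zero := by rw [heatSymbol_zero, conjOp_one]
  map_add s t hs ht := by
    rw [heatSymbol_add hs ht, conjOp_mul V (isBddMeas_heatSymbol s) (isBddMeas_heatSymbol t)]
  tendsto_zero x := by
    have h := tendsto_conjOp V ((tendsto_mulOp_heatSymbol (V x) 0).mono_left
      (nhdsWithin_le_nhds (s := Ioi 0)))
    rw [heatSymbol_zero, conjOp_one] at h
    exact h

namespace IsModel

variable {A : H →ₗ.[ℂ] H} {V : H ≃ₗᵢ[ℂ] L2}

theorem tendsto_quotient (hA : IsModel A V) {x y : H} (h : (x, y) ∈ A.graph) :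
    Tendsto (fun t : ℝ => ((t⁻¹ : ℝ) : ℂ) • ((heatSemigroup V).toFun t x - x)) (𝓝[>] 0)
      (𝓝 y) := by
  have hV : Tendsto (fun t : ℝ => V (((t⁻¹ : ℝ) : ℂ) • ((heatSemigroup V).toFun t x - x)))
      (𝓝[>] 0) (𝓝 (V y)) := by
    have hg := (hA x y).1 h
    refine tendsto_L2_of_dominated (g := V y) (ψ := fun t η => heatQuotient t η * V x η) ?_ ?_ ?_
    · refine Eventually.of_forall fun t => ?_
      rw [map_smul, map_sub]
      change (((t⁻¹ : ℝ) : ℂ) • (V (conjOp V (heatSymbol t) x) - V x) : L2) =ᵐ[μ₀] _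
      rw [map_conjOp]
      filter_upwards [Lp.coeFn_smul ((t⁻¹ : ℝ) : ℂ) (mulOp (heatSymbol t) (V x) - V x),
        Lp.coeFn_sub (mulOp (heatSymbol t) (V x)) (V x),
        coeFn_mulOp (isBddMeas_heatSymbol t) (V x)] with η h1 h2 h3
      rw [h1, Pi.smul_apply, h2, Pi.sub_apply, h3, heatQuotient, smul_eq_mul]
      ring
    · filter_upwards [self_mem_nhdsWithin] with t ht
      filter_upwards [hg] with η hη
      rw [hη, norm_mul, norm_mul]
      gcongr
      exact norm_heatQuotient_le ht η
    · filter_upwards [hg] with η hη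
      rw [hη]
      exact (tendsto_heatQuotient η).mul_const _
  have := (V.symm.continuous.tendsto _).comp hV
  rw [V.symm_apply_apply] at this
  refine this.congr fun t => ?_
  exact V.symm_apply_apply _

theorem isGenerator (hA : IsModel A V) : IsGenerator A (heatSemigroup V) := by
  intro x y
  refine ⟨hA.tendsto_quotient, fun h => ?_⟩
  have h1 : (1 : ℂ) ∈ Complex.slitPlane := Complex.one_mem_slitPlane
  have hB := isBddMeas_resolventSymbol h1
  have hB' := isBddMeas_axis_mul_resolventSymbol h1
  have hg : (conjOp V (resolventSymbol 1) x,
      conjOp V (fun η => axisPoint η * resolventSymbol 1 η) x) ∈ A.graph := by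
    rw [hA, map_conjOp, map_conjOp]
    filter_upwards [coeFn_mulOp hB (V x), coeFn_mulOp hB' (V x)] with η h1 h2
    rw [h1, h2, mul_assoc]
  have h2 := ((conjOp V (resolventSymbol 1)).continuous.tendsto _).comp h
  have h3 := hA.tendsto_quotient hg
  have h4 : conjOp V (resolventSymbol 1) y =
      conjOp V (fun η => axisPoint η * resolventSymbol 1 η) x := by
    refine tendsto_nhds_unique (h2.congr fun t => ?_) h3
    rw [Function.comp_apply, map_smul, map_sub]
    change _ • (_ - _) = _ • ((conjOp V (heatSymbol t) * conjOp V (resolventSymbol 1)) x - _)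
    rw [← conjOp_mul V (isBddMeas_heatSymbol t) hB]
    simp only [mul_comm (heatSymbol t _)]
    rw [conjOp_mul V hB (isBddMeas_heatSymbol t)]
    rfl
  have h5 := congrArg V h4
  rw [map_conjOp, map_conjOp] at h5
  rwa [hA, eq_axisPoint_mul_iff h1]

end IsModel

end Model

/-! ### The extrapolation space of an operator in multiplication form -/

/-- The truncated multiplier of `s - A`. -/
def truncSymbol (s : ℂ) (n : ℕ) (η : ℝ) : ℂ :=
  (s + (η : ℂ) ^ 2) * (Ioo (-n : ℝ) n).indicator (fun _ => 1) η

theorem isBddMeas_truncSymbol (s : ℂ) (n : ℕ) : IsBddMeas (truncSymbol s n) := by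
  refine ⟨(by fun_prop : Measurable fun η : ℝ => s + (η : ℂ) ^ 2).mul
    (measurable_const.indicator measurableSet_Ioo), (1 + ‖s‖) * (1 + n ^ 2), fun η => ?_⟩
  rw [truncSymbol, norm_mul]
  by_cases h : η ∈ Ioo (-n : ℝ) n
  · rw [indicator_of_mem h, norm_one, mul_one]
    refine (norm_add_sq_upper s η).trans ?_
    exact mul_le_mul_of_nonneg_left (by linarith [sq_le_sq' h.1.le h.2.le]) (by positivity)
  · rw [indicator_of_notMem h, norm_zero, mul_zero]
    positivity

theorem resolventSymbol_mul_truncSymbol {s : ℂ} (hs : s ∈ Complex.slitPlane) (n : ℕ) :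
    (fun η => resolventSymbol s η * truncSymbol s n η) =
      (Ioo (-n : ℝ) n).indicator fun _ => 1 := by
  funext η
  rw [resolventSymbol, truncSymbol, ← mul_assoc, inv_mul_cancel₀ (add_sq_ne_zero hs η), one_mul]

section Model

variable {H : Type} [NormedAddCommGroup H] [InnerProductSpace ℂ H]
  {A : H →ₗ.[ℂ] H} {s : ℂ} {V : H ≃ₗᵢ[ℂ] L2}

theorem norm_toExtrapolation (x : H) : ‖toExtrapolation A s x‖ = ‖resolvent A s x‖ :=
  UniformSpace.Completion.norm_coe _

theorem denseRange_toExtrapolation : DenseRange (toExtrapolation A s) := fun b =>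
  UniformSpace.Completion.denseRange_coe (α := PreExtrapolation A s) b

/-- The operator `V R(s, A)`. -/
def mapResolvent (A : H →ₗ.[ℂ] H) (s : ℂ) (V : H ≃ₗᵢ[ℂ] L2) : H →ₗ[ℂ] L2 :=
  V.toLinearEquiv.toLinearMap ∘ₗ (resolvent A s).toLinearMap

theorem IsModel.mapResolvent_apply (hA : IsModel A V) (hs : s ∈ Complex.slitPlane) (x : H) :
    mapResolvent A s V x = mulOp (resolventSymbol s) (V x) := by
  rw [← map_conjOp, ← hA.resolvent_eq hs]
  rfl

/-- The extension of `V R(s, A)` to the extrapolation space. -/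
def extrapolationMap (A : H →ₗ.[ℂ] H) (s : ℂ) (V : H ≃ₗᵢ[ℂ] L2) : Extrapolation A s →L[ℂ] L2 :=
  (mapResolvent A s V).extendOfNorm (toExtrapolation A s)

theorem norm_mapResolvent (x : H) : ‖mapResolvent A s V x‖ = ‖toExtrapolation A s x‖ := by
  rw [norm_toExtrapolation]
  exact V.norm_map _

theorem extrapolationMap_toExtrapolation (x : H) :
    extrapolationMap A s V (toExtrapolation A s x) = mapResolvent A s V x := by
  have hb : ∃ C, ∀ x, ‖mapResolvent A s V x‖ ≤ C * ‖toExtrapolation A s x‖ :=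
    ⟨1, fun x => by rw [one_mul, norm_mapResolvent]⟩
  exact LinearMap.extendOfNorm_eq (f := mapResolvent A s V) (e := toExtrapolation A s)
    (denseRange_toExtrapolation (A := A) (s := s)) hb x

theorem norm_extrapolationMap (b : Extrapolation A s) : ‖extrapolationMap A s V b‖ = ‖b‖ := by
  refine isClosed_property (p := fun b => ‖extrapolationMap A s V b‖ = ‖b‖)
    (denseRange_toExtrapolation (A := A) (s := s))
    (isClosed_eq (by fun_prop) (by fun_prop)) (fun x => ?_) b
  rw [extrapolationMap_toExtrapolation, norm_mapResolvent]

/-- The extension of `V R(s, A)` to the extrapolation space, as an isometry. -/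
def extrapolationIsometry (A : H →ₗ.[ℂ] H) (s : ℂ) (V : H ≃ₗᵢ[ℂ] L2) :
    Extrapolation A s →ₗᵢ[ℂ] L2 where
  toLinearMap := (extrapolationMap A s V).toLinearMap
  norm_map' := norm_extrapolationMap

namespace IsModel

theorem surjective_extrapolationIsometry (hA : IsModel A V) (hs : s ∈ Complex.slitPlane) :
    Function.Surjective (extrapolationIsometry A s V) := by
  have hc : IsClosed (range (extrapolationIsometry A s V)) :=
    (extrapolationIsometry A s V).isometry.isClosedEmbedding.isClosed_range
  intro f
  change f ∈ range (extrapolationIsometry A s V)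
  refine hc.mem_of_tendsto (tendsto_truncOp f) (Eventually.of_forall fun n => ?_)
  refine ⟨toExtrapolation A s (V.symm (mulOp (truncSymbol s n) f)), ?_⟩
  change extrapolationMap A s V _ = _
  rw [extrapolationMap_toExtrapolation, hA.mapResolvent_apply hs, V.apply_symm_apply,
    mulOp_mulOp (isBddMeas_resolventSymbol hs) (isBddMeas_truncSymbol s n),
    resolventSymbol_mul_truncSymbol hs]
  rfl

/-- The unitary operator from the extrapolation space to `L²(0, ∞)` that extends `V R(s, A)`. -/
def extrapolationUnitary (hA : IsModel A V) (hs : s ∈ Complex.slitPlane) :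
    Extrapolation A s ≃ₗᵢ[ℂ] L2 :=
  LinearIsometryEquiv.ofSurjective (extrapolationIsometry A s V)
    (hA.surjective_extrapolationIsometry hs)

theorem extrapolationUnitary_toExtrapolation (hA : IsModel A V) (hs : s ∈ Complex.slitPlane)
    (x : H) : hA.extrapolationUnitary hs (toExtrapolation A s x) =
      mulOp (resolventSymbol s) (V x) :=
  (extrapolationMap_toExtrapolation x).trans (hA.mapResolvent_apply hs x)

/-- The graph of multiplication by `-η²`, transported to the extrapolation space. -/
theorem mem_closure_graph_iff (hA : IsModel A V) (hs : s ∈ Complex.slitPlane)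
    (p : Extrapolation A s × Extrapolation A s) :
    p ∈ (A.graph.map ((toExtrapolation A s).prodMap (toExtrapolation A s))).topologicalClosure ↔
      hA.extrapolationUnitary hs p.2 =ᵐ[μ₀]
        fun η => axisPoint η * hA.extrapolationUnitary hs p.1 η := by
  set W := hA.extrapolationUnitary hs with hW
  have hr := isBddMeas_resolventSymbol hs
  have hr' := isBddMeas_axis_mul_resolventSymbol hs
  constructor
  · have hcl : IsClosed {p : Extrapolation A s × Extrapolation A s |
        mulOp (resolventSymbol s) (W p.2) =
          mulOp (fun η => axisPoint η * resolventSymbol s η) (W p.1)} :=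
      isClosed_eq (by fun_prop) (by fun_prop)
    intro hp
    rw [eq_axisPoint_mul_iff hs]
    refine closure_minimal (t := {p : Extrapolation A s × Extrapolation A s |
        mulOp (resolventSymbol s) (W p.2) =
          mulOp (fun η => axisPoint η * resolventSymbol s η) (W p.1)}) ?_ hcl hp
    rintro _ ⟨⟨x, y⟩, hxy, rfl⟩
    change mulOp _ (W (toExtrapolation A s y)) = mulOp _ (W (toExtrapolation A s x))
    rw [hW, hA.extrapolationUnitary_toExtrapolation, hA.extrapolationUnitary_toExtrapolation,
      (eq_axisPoint_mul_iff hs _ _).1 ((hA x y).1 hxy), mulOp_mulOp hr' hr, mulOp_mulOp hr hr']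
    simp only [mul_comm]
  · intro hp
    have htr : ∀ q : Extrapolation A s, Tendsto (fun n => W.symm (truncOp n (W q))) atTop (𝓝 q) := by
      intro q
      have := (W.symm.continuous.tendsto _).comp (tendsto_truncOp (W q))
      rwa [W.symm_apply_apply] at this
    refine mem_closure_of_tendsto ((htr p.1).prodMk_nhds (htr p.2))
      (Eventually.of_forall fun n => ?_)
    have ht : ∀ q : Extrapolation A s, toExtrapolation A s (V.symm (mulOp (truncSymbol s n) (W q))) =
        W.symm (truncOp n (W q)) := by
      intro q
      rw [W.eq_symm_apply, hW, hA.extrapolationUnitary_toExtrapolation, V.apply_symm_apply,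
        mulOp_mulOp hr (isBddMeas_truncSymbol s n), resolventSymbol_mul_truncSymbol hs]
      rfl
    refine ⟨(V.symm (mulOp (truncSymbol s n) (W p.1)), V.symm (mulOp (truncSymbol s n) (W p.2))),
      ?_, Prod.ext (ht p.1) (ht p.2)⟩
    change (_, _) ∈ A.graph
    rw [hA, V.apply_symm_apply, V.apply_symm_apply]
    filter_upwards [hp, coeFn_mulOp (isBddMeas_truncSymbol s n) (W p.1),
      coeFn_mulOp (isBddMeas_truncSymbol s n) (W p.2)] with η h1 h2 h3
    rw [h2, h3, h1]
    ring

theorem extrapolated (hA : IsModel A V) (hs : s ∈ Complex.slitPlane) :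
    IsModel (extrapolatedOperator A s) (hA.extrapolationUnitary hs) := by
  intro f g
  have hgr : (extrapolatedOperator A s).graph =
      (A.graph.map ((toExtrapolation A s).prodMap (toExtrapolation A s))).topologicalClosure := by
    refine Submodule.toLinearPMap_graph_eq _ fun p hp h0 => ?_
    rw [hA.mem_closure_graph_iff hs, h0, map_zero] at hp
    refine (hA.extrapolationUnitary hs).injective ?_
    rw [map_zero]
    refine Lp.ext ?_
    filter_upwards [hp, Lp.coeFn_zero ℂ 2 μ₀] with η h1 h2
    rw [h1, h2, Pi.zero_apply, mul_zero]
  rw [hgr, hA.mem_closure_graph_iff hs]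

theorem extend_conjOp (hA : IsModel A V) (hs : s ∈ Complex.slitPlane) {φ : ℝ → ℂ}
    (hφ : IsBddMeas φ) (b : Extrapolation A s) :
    extend A s (conjOp V φ) b =
      (hA.extrapolationUnitary hs).symm (mulOp φ (hA.extrapolationUnitary hs b)) := by
  set W := hA.extrapolationUnitary hs with hW
  have hr := isBddMeas_resolventSymbol hs
  let S : PreExtrapolation A s →ₗ[ℂ] PreExtrapolation A s := (conjOp V φ).toLinearMap
  have hS : ∀ x : PreExtrapolation A s, ‖S x‖ ≤ ‖conjOp V φ‖ * ‖x‖ := by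
    intro x
    change ‖resolvent A s (conjOp V φ x)‖ ≤ ‖conjOp V φ‖ * ‖resolvent A s (show H from x)‖
    have : resolvent A s (conjOp V φ x) = conjOp V φ (resolvent A s (show H from x)) := by
      rw [hA.resolvent_eq hs]
      change (conjOp V (resolventSymbol s) * conjOp V φ) (show H from x) =
        (conjOp V φ * conjOp V (resolventSymbol s)) (show H from x)
      rw [← conjOp_mul V hr hφ, ← conjOp_mul V hφ hr]
      simp only [mul_comm]
    rw [this]
    exact (conjOp V φ).le_opNorm _
  have hu : UniformContinuous S := (S.mkContinuous _ hS).uniformContinuous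
  refine UniformSpace.Completion.induction_on b (isClosed_eq UniformSpace.Completion.continuous_map
    (by fun_prop)) fun x => ?_
  have h1 : extend A s (conjOp V φ) (x : Extrapolation A s) =
      toExtrapolation A s (conjOp V φ (show H from x)) := UniformSpace.Completion.map_coe hu x
  rw [h1, W.eq_symm_apply]
  have h2 : W (x : Extrapolation A s) = mulOp (resolventSymbol s) (V (show H from x)) :=
    hA.extrapolationUnitary_toExtrapolation hs (show H from x)
  rw [h2, hW, hA.extrapolationUnitary_toExtrapolation, map_conjOp, mulOp_mulOp hr hφ,
    mulOp_mulOp hφ hr]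
  simp only [mul_comm]

theorem coeFn_conj_sub (hA : IsModel A V) (s : ℂ) (φ : A.domain) :
    (conj s • V φ - V (A φ) : L2) =ᵐ[μ₀] fun η => (conj s + (η : ℂ) ^ 2) * V φ η := by
  filter_upwards [Lp.coeFn_sub (conj s • V (φ : H)) (V (A φ)), Lp.coeFn_smul (conj s) (V (φ : H)),
    hA.map_apply φ] with η h1 h2 h3
  rw [h1, Pi.sub_apply, h2, Pi.smul_apply, h3, smul_eq_mul, ← sub_mul, sub_axisPoint]

theorem conj_mem_slitPlane {s : ℂ} (hs : s ∈ Complex.slitPlane) : conj s ∈ Complex.slitPlane := by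
  rw [Complex.mem_slitPlane_iff] at hs ⊢
  simpa using hs

theorem pairing_eq_inner (hA : IsModel A V) (hs : s ∈ Complex.slitPlane) (φ : A.domain)
    (b : Extrapolation A s) :
    pairing A s φ b =
      inner ℂ (conj s • V φ - V (A φ)) (hA.extrapolationUnitary hs b) := by
  set W := hA.extrapolationUnitary hs with hW
  set ψ : L2 := conj s • V φ - V (A φ) with hψ
  have hfun : (fun x : PreExtrapolation A s => inner ℂ (φ : H) (show H from x)) =
      (fun b : Extrapolation A s => inner ℂ ψ (W b)) ∘
        ((↑) : PreExtrapolation A s → Extrapolation A s) := by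
    funext x
    have h2 : W (x : Extrapolation A s) = mulOp (resolventSymbol s) (V (show H from x)) :=
      hA.extrapolationUnitary_toExtrapolation hs (show H from x)
    rw [Function.comp_apply, h2, ← V.inner_map_map, inner_mulOp_right (isBddMeas_resolventSymbol hs),
      inner_L2]
    refine integral_congr_ae ?_
    filter_upwards [hA.coeFn_conj_sub s φ] with η hη
    have hne := add_sq_ne_zero hs η
    rw [hη, resolventSymbol]
    simp only [map_mul, map_add, Complex.conj_conj, map_pow, Complex.conj_ofReal]
    field_simp
  have hc : Continuous (fun b : Extrapolation A s => inner ℂ ψ (W b)) := by fun_prop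
  rw [pairing, hfun, UniformSpace.Completion.extension_comp_coe]
  exact ((innerSL ℂ ψ).uniformContinuous).comp W.isometry.uniformContinuous

theorem pairing_eq_integral (hA : IsModel A V) (hs : s ∈ Complex.slitPlane) (φ : A.domain)
    {b : Extrapolation A s} {w : ℝ → ℂ}
    (hb : hA.extrapolationUnitary hs b =ᵐ[μ₀] fun η => resolventSymbol s η * w η) :
    pairing A s φ b = ∫ η in Ioi (0 : ℝ), conj (V φ η) * w η := by
  rw [hA.pairing_eq_inner hs, inner_L2]
  refine integral_congr_ae ?_
  filter_upwards [hA.coeFn_conj_sub s φ, hb] with η h1 h2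
  have hne := add_sq_ne_zero hs η
  rw [h1, h2, resolventSymbol]
  simp only [map_mul, map_add, Complex.conj_conj, map_pow, Complex.conj_ofReal]
  field_simp

theorem eq_of_pairing_eq (hA : IsModel A V) (hs : s ∈ Complex.slitPlane)
    {b b' : Extrapolation A s} (h : ∀ φ : A.domain, pairing A s φ b = pairing A s φ b') :
    b = b' := by
  refine (hA.extrapolationUnitary hs).injective (ext_inner_left ℂ fun f => ?_)
  have hs' := conj_mem_slitPlane hs
  obtain ⟨hd, he⟩ := (hA.isResolventAt hs').1 (V.symm f)
  have := h ⟨_, hd⟩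
  rwa [hA.pairing_eq_inner hs, hA.pairing_eq_inner hs, ← map_smul, ← map_sub, he,
    V.apply_symm_apply] at this

end IsModel

end Model

/-! ### Admissibility -/

/-- The multiplier `∫₀ᵗ e^{-(t-r)η²} u(r) dr`. -/
def duhamelSymbol (t : ℝ) (u : ℝ → ℂ) (η : ℝ) : ℂ := ∫ r in Icc 0 t, heatSymbol (t - r) η * u r

theorem continuous_heatSymbol_uncurry : Continuous fun x : ℝ × ℝ => heatSymbol x.1 x.2 := by
  unfold heatSymbol
  fun_prop

theorem integrable_heatSymbol_mul {t : ℝ} {u : ℝ → ℂ} (hu : IntegrableOn u (Icc 0 t)) (η : ℝ) :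
    IntegrableOn (fun r => heatSymbol (t - r) η * u r) (Icc 0 t) := by
  refine Integrable.bdd_mul (c := 1) hu ?_ (Eventually.of_forall fun r => norm_heatSymbol_le _ _)
  have := continuous_heatSymbol_uncurry.comp
    (by fun_prop : Continuous fun r : ℝ => (t - r, η))
  exact this.aestronglyMeasurable

theorem isBddMeas_duhamelSymbol {t : ℝ} {u : ℝ → ℂ} (hu : IntegrableOn u (Icc 0 t)) :
    IsBddMeas (duhamelSymbol t u) := by
  have hb : ∀ r η, ‖heatSymbol (t - r) η * u r‖ ≤ ‖u r‖ := fun r η => by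
    rw [norm_mul]
    exact mul_le_of_le_one_left (norm_nonneg _) (norm_heatSymbol_le _ _)
  refine ⟨Continuous.measurable ?_, ∫ r in Icc 0 t, ‖u r‖, fun η => ?_⟩
  · refine continuous_of_dominated (bound := fun r => ‖u r‖)
      (fun η => (integrable_heatSymbol_mul hu η).1) (fun η => Eventually.of_forall fun r => hb r η)
      hu.norm (Eventually.of_forall fun r => ?_)
    exact (continuous_heatSymbol _).mul_const _
  · exact (norm_integral_le_integral_norm _).trans
      (integral_mono_of_nonneg (Eventually.of_forall fun _ => norm_nonneg _) hu.norm
        (Eventually.of_forall fun r => hb r η))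

theorem continuous_mulOp_heatSymbol (t : ℝ) (f : L2) :
    Continuous fun r : ℝ => mulOp (heatSymbol (t - r)) f := by
  have h : Continuous fun t : ℝ => mulOp (heatSymbol t) f :=
    continuous_iff_continuousAt.2 fun t₀ => tendsto_mulOp_heatSymbol f t₀
  exact h.comp (by fun_prop)

theorem norm_mulOp_heatSymbol_le (t : ℝ) (f : L2) : ‖mulOp (heatSymbol t) f‖ ≤ ‖f‖ := by
  refine norm_le_of_ae_norm_le ?_
  filter_upwards [coeFn_mulOp (isBddMeas_heatSymbol t) f] with η hη
  rw [hη, norm_mul]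
  exact mul_le_of_le_one_left (norm_nonneg _) (norm_heatSymbol_le _ _)

theorem integrable_smul_heat {t : ℝ} {u : ℝ → ℂ} (hu : IntegrableOn u (Icc 0 t)) (f : L2) :
    IntegrableOn (fun r => u r • mulOp (heatSymbol (t - r)) f) (Icc 0 t) := by
  refine Integrable.mono' (hu.norm.mul_const ‖f‖)
    (hu.1.smul (continuous_mulOp_heatSymbol t f).aestronglyMeasurable)
    (Eventually.of_forall fun r => ?_)
  rw [norm_smul]
  gcongr
  exact norm_mulOp_heatSymbol_le _ _

theorem integral_smul_heat {t : ℝ} {u : ℝ → ℂ} (hu : IntegrableOn u (Icc 0 t)) (f : L2) :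
    ∫ r in Icc 0 t, u r • mulOp (heatSymbol (t - r)) f = mulOp (duhamelSymbol t u) f := by
  refine ext_inner_left ℂ fun h => ?_
  have hg : Integrable (fun η => conj (h η) * f η) μ₀ :=
    (Lp.memLp h).star.integrable_mul (Lp.memLp f)
  rw [← integral_inner (integrable_smul_heat hu f), inner_mulOp_right (isBddMeas_duhamelSymbol hu)]
  have e1 : ∀ r, inner ℂ h (u r • mulOp (heatSymbol (t - r)) f) =
      ∫ η in Ioi (0 : ℝ), u r * (conj (h η) * f η) * heatSymbol (t - r) η := by
    intro r
    rw [inner_smul_right, inner_mulOp_right (isBddMeas_heatSymbol _), ← integral_const_mul]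
    refine integral_congr_ae (Eventually.of_forall fun η => ?_)
    ring
  have e2 : ∀ η, duhamelSymbol t u η * (conj (h η) * f η) =
      ∫ r in Icc 0 t, u r * (conj (h η) * f η) * heatSymbol (t - r) η := by
    intro η
    rw [duhamelSymbol, ← integral_mul_const]
    refine integral_congr_ae (Eventually.of_forall fun r => ?_)
    ring
  simp only [e1, e2]
  rw [integral_integral_swap]
  have hp : Integrable (fun p : ℝ × ℝ => u p.1 * (conj (h p.2) * f p.2))
      (Measure.prod (volume.restrict (Icc 0 t)) μ₀) := Integrable.mul_prod hu hg
  refine hp.mul_bdd (c := 1) (g := fun p : ℝ × ℝ => heatSymbol (t - p.1) p.2) ?_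
    (Eventually.of_forall fun p => norm_heatSymbol_le _ _)
  have := continuous_heatSymbol_uncurry.comp
    (by fun_prop : Continuous fun p : ℝ × ℝ => (t - p.1, p.2))
  exact this.aestronglyMeasurable

theorem integral_exp_le {t : ℝ} (ht : 0 ≤ t) (η : ℝ) :
    ∫ r in Icc 0 t, Real.exp (-((t - r) * η ^ 2)) ≤ (1 + t) / (1 + η ^ 2) := by
  rw [integral_Icc_eq_integral_Ioc, ← intervalIntegral.integral_of_le ht,
    le_div_iff₀ (by positivity)]
  have hc : Continuous fun r => Real.exp (-((t - r) * η ^ 2)) := by fun_prop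
  have h1 : ∫ r in (0 : ℝ)..t, Real.exp (-((t - r) * η ^ 2)) ≤ t := by
    calc _ ≤ ∫ r in (0 : ℝ)..t, (1 : ℝ) := by
          refine intervalIntegral.integral_mono_on ht (hc.intervalIntegrable _ _)
            (by simp) fun r hr => ?_
          rw [Real.exp_le_one_iff, neg_nonpos]
          exact mul_nonneg (by linarith [hr.2]) (sq_nonneg η)
      _ = t := by simp
  have h2 : (∫ r in (0 : ℝ)..t, Real.exp (-((t - r) * η ^ 2))) * η ^ 2 ≤ 1 := by
    rw [← intervalIntegral.integral_mul_const,
      intervalIntegral.integral_eq_sub_of_hasDerivAt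
        (f := fun r => Real.exp (-((t - r) * η ^ 2)))]
    · have := Real.exp_pos (-((t - 0) * η ^ 2))
      simp only [sub_self, zero_mul, neg_zero, Real.exp_zero]
      linarith
    · intro r _
      have := ((((hasDerivAt_id r).const_sub t).mul_const (η ^ 2)).fun_neg).exp
      simpa using this
    · exact (hc.mul_const _).intervalIntegrable _ _
  linarith

theorem enorm_duhamelSymbol_le {t : ℝ} (ht : 0 ≤ t) {p q : ℝ} (hpq : p.HolderConjugate q)
    {u : ℝ → ℂ} (hu : AEStronglyMeasurable u (volume.restrict (Icc 0 t))) (η : ℝ) :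
    ‖duhamelSymbol t u η‖ₑ ≤ ENNReal.ofReal ((1 + t) / (1 + η ^ 2)) ^ (1 / q) *
      eLpNorm u (ENNReal.ofReal p) (volume.restrict (Icc 0 t)) := by
  have hcont : Continuous fun r => heatSymbol (t - r) η :=
    continuous_heatSymbol_uncurry.comp (by fun_prop : Continuous fun r : ℝ => (t - r, η))
  have hH : ∫⁻ r in Icc 0 t, ‖heatSymbol (t - r) η‖ₑ ^ q ≤
      ENNReal.ofReal ((1 + t) / (1 + η ^ 2)) := by
    have hc : Continuous fun r => Real.exp (-((t - r) * η ^ 2)) := by fun_prop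
    calc _ ≤ ∫⁻ r in Icc 0 t, ENNReal.ofReal (Real.exp (-((t - r) * η ^ 2))) := by
          refine setLIntegral_mono' measurableSet_Icc fun r hr => ?_
          have h1 : ‖heatSymbol (t - r) η‖ₑ ≤ 1 := by
            rw [← ofReal_norm]
            exact ENNReal.ofReal_le_one.2 (norm_heatSymbol_le _ _)
          refine (ENNReal.rpow_le_self_of_le_one h1 hpq.symm.lt.le).trans (le_of_eq ?_)
          rw [heatSymbol, ← ofReal_norm, Complex.norm_real,
            Real.norm_of_nonneg (Real.exp_pos _).le, max_eq_left (by linarith [hr.2])]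
      _ = ENNReal.ofReal (∫ r in Icc 0 t, Real.exp (-((t - r) * η ^ 2))) := by
          rw [ofReal_integral_eq_lintegral_ofReal hc.integrableOn_Icc
            (Eventually.of_forall fun r => (Real.exp_pos _).le)]
      _ ≤ _ := ENNReal.ofReal_le_ofReal (integral_exp_le ht η)
  have hp0 : 0 < p := hpq.pos
  rw [eLpNorm_eq_lintegral_rpow_enorm_toReal (by simpa using hp0) ENNReal.ofReal_ne_top,
    ENNReal.toReal_ofReal hp0.le]
  calc _ ≤ ∫⁻ r in Icc 0 t, ‖heatSymbol (t - r) η * u r‖ₑ := enorm_integral_le_lintegral_enorm _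
    _ = ∫⁻ r in Icc 0 t, ((fun r => ‖heatSymbol (t - r) η‖ₑ) * fun r => ‖u r‖ₑ) r := by
        simp only [enorm_mul, Pi.mul_apply]
    _ ≤ (∫⁻ r in Icc 0 t, ‖heatSymbol (t - r) η‖ₑ ^ q) ^ (1 / q) *
        (∫⁻ r in Icc 0 t, ‖u r‖ₑ ^ p) ^ (1 / p) :=
        ENNReal.lintegral_mul_le_Lp_mul_Lq _ hpq.symm
          hcont.aestronglyMeasurable.enorm hu.enorm
    _ ≤ _ := by
        gcongr
        exact one_div_nonneg.2 hpq.symm.pos.le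

section Model

variable {H : Type} [NormedAddCommGroup H] [InnerProductSpace ℂ H]
  {A : H →ₗ.[ℂ] H} {s : ℂ} {V : H ≃ₗᵢ[ℂ] L2}

theorem FiniteTimeAdmissible.mono_exponent {T : C0Semigroup H} {B : ℂ →L[ℂ] Extrapolation A s}
    {p p' : ℝ≥0∞} (h : FiniteTimeAdmissible A s T B p) (hp : p ≠ 0) (hpp : p ≤ p') :
    FiniteTimeAdmissible A s T B p' := by
  intro t ht
  obtain ⟨C, hC, hB⟩ := h t ht
  set ν := volume.restrict (Icc 0 t) with hν
  have hfin : ν univ ≠ ⊤ := by simp [hν]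
  set D : ℝ≥0∞ := ν univ ^ (1 / p.toReal - 1 / p'.toReal) with hD
  have hDtop : D ≠ ⊤ := by
    refine (ENNReal.rpow_lt_top_of_nonneg ?_ hfin).ne
    rcases eq_or_ne p' ⊤ with rfl | hp'
    · simp
    · have h1 : p ≠ ⊤ := ne_top_of_le_ne_top hp' hpp
      have h2 : p.toReal ≤ p'.toReal := ENNReal.toReal_mono hp' hpp
      have h3 : 0 < p.toReal := ENNReal.toReal_pos hp h1
      exact sub_nonneg.2 (one_div_le_one_div_of_le h3 h2)
  refine ⟨C * (D.toReal + 1), by positivity, fun u hu => ?_⟩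
  obtain ⟨h1, x, h2, h3⟩ := hB u (hu.mono_exponent hpp)
  refine ⟨h1, x, h2, h3.trans ?_⟩
  rw [mul_assoc]
  gcongr
  have h4 := eLpNorm_le_eLpNorm_mul_rpow_measure_univ hpp hu.1
  calc _ ≤ (eLpNorm u p' ν * D).toReal :=
        ENNReal.toReal_mono (ENNReal.mul_ne_top hu.2.ne hDtop) h4
    _ = D.toReal * (eLpNorm u p' ν).toReal := by rw [ENNReal.toReal_mul, mul_comm]
    _ ≤ _ := by
        gcongr
        linarith

theorem IsModel.finiteTimeAdmissible (hA : IsModel A V) (hs : s ∈ Complex.slitPlane)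
    {b : Extrapolation A s} {w : ℝ → ℂ} (hw : Continuous w)
    (hb : hA.extrapolationUnitary hs b =ᵐ[μ₀] fun η => resolventSymbol s η * w η)
    {p q : ℝ} (hpq : p.HolderConjugate q)
    (hI : ∫⁻ η in Ioi (0 : ℝ), ‖w η‖ₑ ^ 2 * ENNReal.ofReal ((1 + η ^ 2) ^ (-(2 / q))) < ⊤) :
    FiniteTimeAdmissible A s (heatSemigroup V) (ContinuousLinearMap.toSpanSingleton ℂ b)
      (ENNReal.ofReal p) := by
  set W := hA.extrapolationUnitary hs with hW
  intro t ht
  set D : ℝ≥0∞ := ENNReal.ofReal ((1 + t) ^ (2 / q)) *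
    ∫⁻ η in Ioi (0 : ℝ), ‖w η‖ₑ ^ 2 * ENNReal.ofReal ((1 + η ^ 2) ^ (-(2 / q))) with hD
  have hDtop : D < ⊤ := ENNReal.mul_lt_top (by simp) hI
  refine ⟨√D.toReal + 1, by positivity, fun u hu => ?_⟩
  have hui : IntegrableOn u (Icc 0 t) :=
    hu.integrable (ENNReal.one_le_ofReal.2 hpq.lt.le)
  have hint : ∀ r, extend A s ((heatSemigroup V).toFun (t - r))
      (ContinuousLinearMap.toSpanSingleton ℂ b (u r)) =
        W.symm (u r • mulOp (heatSymbol (t - r)) (W b)) := by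
    intro r
    rw [ContinuousLinearMap.toSpanSingleton_apply]
    change extend A s (conjOp V (heatSymbol (t - r))) _ = _
    rw [hA.extend_conjOp hs (isBddMeas_heatSymbol _), map_smul, map_smul]
  simp only [hint]
  have hI1 := integrable_smul_heat hui (W b)
  refine ⟨W.symm.toContinuousLinearEquiv.toContinuousLinearMap.integrable_comp hI1, ?_⟩
  have hK := isBddMeas_duhamelSymbol hui
  set N := eLpNorm u (ENNReal.ofReal p) (volume.restrict (Icc 0 t)) with hN
  have hbound : ∫⁻ η in Ioi (0 : ℝ), ‖duhamelSymbol t u η * w η‖ₑ ^ 2 ≤ D * N ^ 2 := by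
    rw [hD, ← lintegral_const_mul' _ _ (by simp), ← lintegral_mul_const' _ _ (by
      exact ENNReal.pow_ne_top hu.2.ne)]
    refine lintegral_mono fun η => ?_
    have hq : (0 : ℝ) < q := hpq.symm.pos
    have h1 := enorm_duhamelSymbol_le ht hpq hu.1 η
    have h2 : (ENNReal.ofReal ((1 + t) / (1 + η ^ 2)) ^ (1 / q)) ^ 2 =
        ENNReal.ofReal ((1 + t) ^ (2 / q)) * ENNReal.ofReal ((1 + η ^ 2) ^ (-(2 / q))) := by
      have h0 : 0 < 1 + η ^ 2 := by positivity
      rw [← ENNReal.rpow_natCast, ← ENNReal.rpow_mul,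
        ENNReal.ofReal_rpow_of_nonneg (by positivity) (by positivity),
        ← ENNReal.ofReal_mul (by positivity)]
      congr 1
      rw [Real.rpow_neg h0.le, ← div_eq_mul_inv, ← Real.div_rpow (by positivity) h0.le]
      congr 1
      push_cast
      ring
    calc ‖duhamelSymbol t u η * w η‖ₑ ^ 2 = ‖w η‖ₑ ^ 2 * ‖duhamelSymbol t u η‖ₑ ^ 2 := by
          rw [enorm_mul, mul_pow, mul_comm]
      _ ≤ ‖w η‖ₑ ^ 2 * (ENNReal.ofReal ((1 + t) / (1 + η ^ 2)) ^ (1 / q) * N) ^ 2 := by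
          gcongr
      _ = _ := by
          rw [mul_pow, h2]
          ring
  have hm : MemLp (fun η => duhamelSymbol t u η * w η) 2 μ₀ :=
    memLp_two_of_lintegral_lt_top (hK.1.aestronglyMeasurable.mul hw.aestronglyMeasurable)
      (hbound.trans_lt (ENNReal.mul_lt_top hDtop (ENNReal.pow_lt_top hu.2)))
  refine ⟨V.symm (hm.toLp _), ?_, ?_⟩
  · have e1 : ∫ r in Icc 0 t, W.symm (u r • mulOp (heatSymbol (t - r)) (W b)) =
        W.symm (∫ r in Icc 0 t, u r • mulOp (heatSymbol (t - r)) (W b)) :=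
      W.symm.toContinuousLinearEquiv.toContinuousLinearMap.integral_comp_comm hI1
    rw [e1, integral_smul_heat hui, W.eq_symm_apply, hW, hA.extrapolationUnitary_toExtrapolation,
      V.apply_symm_apply]
    refine Lp.ext ?_
    filter_upwards [coeFn_mulOp (isBddMeas_resolventSymbol hs) (hm.toLp _), hm.coeFn_toLp,
      coeFn_mulOp hK (W b), hb] with η h1 h2 h3 h4
    rw [h1, h2, h3, h4]
    ring
  · have h1 : ‖hm.toLp _‖ₑ ^ 2 ≤ D * N ^ 2 := by
      rw [enorm_sq_L2]
      refine (le_of_eq (lintegral_congr_ae ?_)).trans hbound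
      filter_upwards [hm.coeFn_toLp] with η hη
      rw [hη]
    have h2 : ‖hm.toLp _‖ ^ 2 ≤ D.toReal * N.toReal ^ 2 := by
      have := ENNReal.toReal_mono
        (ENNReal.mul_ne_top hDtop.ne (ENNReal.pow_ne_top hu.2.ne)) h1
      rwa [ENNReal.toReal_pow, toReal_enorm, ENNReal.toReal_mul, ENNReal.toReal_pow] at this
    rw [V.symm.norm_map]
    have h3 : ‖hm.toLp _‖ ≤ √D.toReal * N.toReal := by
      refine le_of_sq_le_sq ?_ (by positivity)
      rwa [mul_pow, Real.sq_sqrt ENNReal.toReal_nonneg]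
    refine h3.trans ?_
    gcongr
    linarith

end Model

/-! ### Equivalence of measures -/

theorem equivalentMeasures_withDensity {ν : Measure ℂ} [SigmaFinite ν] {k : ℂ → ℝ≥0∞}
    (hk : Measurable k) {c C : ℝ} (hc : 0 < c)
    (hb : ∀ᵐ z ∂ν, ENNReal.ofReal c ≤ k z ∧ k z ≤ ENNReal.ofReal C) :
    EquivalentMeasures (ν.withDensity k) ν := by
  have h0 : ∀ᵐ z ∂ν, k z ≠ 0 := hb.mono fun z hz =>
    ((ENNReal.ofReal_pos.2 hc).trans_le hz.1).ne'
  have htop : ∀ᵐ z ∂ν, k z ≠ ⊤ := hb.mono fun z hz => (hz.2.trans_lt ENNReal.ofReal_lt_top).ne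
  have hac : ν.withDensity k ≪ ν := withDensity_absolutelyContinuous ν k
  have hinv : (ν.withDensity k).withDensity k⁻¹ = ν := withDensity_inv_same hk h0 htop
  have hσ : SigmaFinite (ν.withDensity k) := SigmaFinite.withDensity_of_ne_top htop
  set D := max C 1 with hD
  have hD0 : 0 < D := by positivity
  refine ⟨hac, withDensity_absolutelyContinuous' hk.aemeasurable h0,
    min c D⁻¹, max D c⁻¹, lt_min hc (by positivity), ?_, ?_⟩
  · filter_upwards [hb, Measure.rnDeriv_withDensity ν hk] with z hz hr
    rw [hr]
    exact ⟨(ENNReal.ofReal_le_ofReal (min_le_left _ _)).trans hz.1,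
      hz.2.trans (ENNReal.ofReal_le_ofReal ((le_max_left C 1).trans (le_max_left _ _)))⟩
  · have hr := Measure.rnDeriv_withDensity (ν.withDensity k) hk.inv
    rw [hinv] at hr
    filter_upwards [hac.ae_le hb, hr] with z hz hr
    rw [hr, Pi.inv_apply]
    constructor
    · calc ENNReal.ofReal (min c D⁻¹) ≤ ENNReal.ofReal D⁻¹ :=
            ENNReal.ofReal_le_ofReal (min_le_right _ _)
        _ = (ENNReal.ofReal D)⁻¹ := ENNReal.ofReal_inv_of_pos hD0
        _ ≤ _ := ENNReal.inv_le_inv.2 (hz.2.trans (ENNReal.ofReal_le_ofReal (le_max_left _ _)))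
    · calc (k z)⁻¹ ≤ (ENNReal.ofReal c)⁻¹ := ENNReal.inv_le_inv.2 hz.1
        _ = ENNReal.ofReal c⁻¹ := (ENNReal.ofReal_inv_of_pos hc).symm
        _ ≤ _ := ENNReal.ofReal_le_ofReal (le_max_right _ _)

theorem axisMeasure_withDensity {ρ : ℝ → ℝ≥0∞} (hρ : AEMeasurable ρ μ₀) {g : ℂ → ℝ≥0∞}
    (hg : Measurable g) :
    (axisMeasure ρ).withDensity g = axisMeasure fun η => ρ η * g (axisPoint η) := by
  have hm := continuous_axisPoint.measurable
  ext S hS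
  rw [withDensity_apply _ hS, axisMeasure_apply _ hS, axisMeasure,
    setLIntegral_map hS hg hm, restrict_withDensity (hm hS),
    lintegral_withDensity_eq_lintegral_mul₀ (hρ.mono_measure Measure.restrict_le_self)
      (g := fun η => g (axisPoint η)) (hg.comp hm).aemeasurable]
  rfl

theorem sigmaFinite_axisMeasure {ρ : ℝ → ℝ} (hρ : Continuous ρ) :
    SigmaFinite (axisMeasure fun η => ENNReal.ofReal (ρ η)) := by
  refine ⟨⟨⟨fun n : ℕ => Metric.closedBall (0 : ℂ) n, fun _ => trivial, fun n => ?_,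
    Metric.iUnion_closedBall_nat 0⟩⟩⟩
  rw [axisMeasure_apply _ Metric.isClosed_closedBall.measurableSet]
  have hsub : axisPoint ⁻¹' Metric.closedBall (0 : ℂ) n ⊆ Icc (-√n) √n := by
    intro η hη
    rw [mem_preimage, mem_closedBall_zero_iff, norm_axisPoint] at hη
    exact abs_le.1 (Real.abs_le_sqrt hη)
  calc _ ≤ ∫⁻ η in Icc (-√n) √n, ENNReal.ofReal (ρ η) :=
        (lintegral_mono_set hsub).trans
          (lintegral_mono' (Measure.restrict_mono_measure Measure.restrict_le_self _) le_rfl)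
    _ < ⊤ := (hρ.integrableOn_Icc).lintegral_lt_top

/-- The Radon–Nikodym density of the control measure. -/
theorem IsModel.equivalentMeasures {H : Type} [NormedAddCommGroup H] [InnerProductSpace ℂ H]
    {A : H →ₗ.[ℂ] H} {s : ℂ} {V : H ≃ₗᵢ[ℂ] L2} (hA : IsModel A V) (hs : s ∈ Complex.slitPlane)
    {b : Extrapolation A s} {w : ℝ → ℂ} (hw : Continuous w)
    (hb : hA.extrapolationUnitary hs b =ᵐ[μ₀] fun η => resolventSymbol s η * w η) :
    EquivalentMeasures (controlMeasure (spectralPVM (hA.extrapolationUnitary hs)) b)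
      (axisMeasure fun η => ENNReal.ofReal (Real.pi * ‖w η‖ ^ 2)) := by
  set k : ℂ → ℝ≥0∞ := fun z => ENNReal.ofReal ((1 + ‖z‖ ^ 2) / (Real.pi * ‖s - z‖ ^ 2)) with hk
  have hkm : Measurable k := by fun_prop
  have hρ : Continuous fun η => Real.pi * ‖w η‖ ^ 2 := by fun_prop
  have hσ := sigmaFinite_axisMeasure hρ
  have hm : controlMeasure (spectralPVM (hA.extrapolationUnitary hs)) b =
      (axisMeasure fun η => ENNReal.ofReal (Real.pi * ‖w η‖ ^ 2)).withDensity k := by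
    rw [controlMeasure, scalar_spectralPVM, axisMeasure_withDensity (aemeasurable_enorm_sq _)
      (by fun_prop), axisMeasure_withDensity (by fun_prop) hkm]
    refine axisMeasure_congr ?_
    filter_upwards [hb] with η hη
    have hne := norm_pos_iff.2 (add_sq_ne_zero hs η)
    rw [hη, hk, ← ofReal_norm, ← ENNReal.ofReal_pow (norm_nonneg _),
      ← ENNReal.ofReal_mul (by positivity), ← ENNReal.ofReal_mul (by positivity), norm_mul,
      resolventSymbol, norm_inv, sub_axisPoint]
    congr 1
    field_simp
  rw [hm]
  obtain ⟨c, hc, hlow⟩ := norm_add_sq_lower hs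
  refine equivalentMeasures_withDensity hkm (c := (2 * Real.pi * (1 + ‖s‖) ^ 2)⁻¹)
    (C := (Real.pi * c ^ 2)⁻¹) (by positivity) ?_
  have hset : MeasurableSet {z | ENNReal.ofReal (2 * Real.pi * (1 + ‖s‖) ^ 2)⁻¹ ≤ k z ∧
      k z ≤ ENNReal.ofReal (Real.pi * c ^ 2)⁻¹} :=
    (measurableSet_le measurable_const hkm).inter (measurableSet_le hkm measurable_const)
  rw [axisMeasure, ae_map_iff continuous_axisPoint.measurable.aemeasurable hset]
  refine Eventually.of_forall fun η => ?_
  have hne := norm_pos_iff.2 (add_sq_ne_zero hs η)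
  have h1 := hlow η
  have h2 := norm_add_sq_upper s η
  simp only [hk]
  rw [norm_axisPoint, sub_axisPoint]
  constructor
  · refine ENNReal.ofReal_le_ofReal ?_
    rw [inv_eq_one_div, div_le_div_iff₀ (by positivity) (by positivity)]
    have h3 : ‖s + (η : ℂ) ^ 2‖ ^ 2 ≤ ((1 + ‖s‖) * (1 + η ^ 2)) ^ 2 := by gcongr
    have h4 : (1 + η ^ 2) ^ 2 ≤ 2 * (1 + (η ^ 2) ^ 2) := by nlinarith [sq_nonneg (1 - η ^ 2)]
    calc 1 * (Real.pi * ‖s + (η : ℂ) ^ 2‖ ^ 2) ≤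
          1 * (Real.pi * ((1 + ‖s‖) * (1 + η ^ 2)) ^ 2) := by gcongr
      _ = Real.pi * (1 + ‖s‖) ^ 2 * (1 + η ^ 2) ^ 2 := by ring
      _ ≤ Real.pi * (1 + ‖s‖) ^ 2 * (2 * (1 + (η ^ 2) ^ 2)) := by gcongr
      _ = _ := by ring
  · refine ENNReal.ofReal_le_ofReal ?_
    rw [inv_eq_one_div, div_le_div_iff₀ (by positivity) (by positivity)]
    have h3 : (c * (1 + η ^ 2)) ^ 2 ≤ ‖s + (η : ℂ) ^ 2‖ ^ 2 := by gcongr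
    have h4 : 1 + (η ^ 2) ^ 2 ≤ (1 + η ^ 2) ^ 2 := by nlinarith [sq_nonneg η]
    calc (1 + (η ^ 2) ^ 2) * (Real.pi * c ^ 2) ≤ (1 + η ^ 2) ^ 2 * (Real.pi * c ^ 2) := by gcongr
      _ = Real.pi * (c * (1 + η ^ 2)) ^ 2 := by ring
      _ ≤ 1 * (Real.pi * ‖s + (η : ℂ) ^ 2‖ ^ 2) := by
        rw [one_mul]
        gcongr

/-! ### Weak derivatives and first-order equations -/

theorem IsTest.integral_eq {φ : ℝ → ℂ} (hφ : IsTest φ) (u : ℝ → ℂ) :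
    ∫ x in Ioi (0 : ℝ), u x * φ x = ∫ x, u x * φ x :=
  setIntegral_eq_integral_of_forall_compl_eq_zero fun x hx => by
    rw [image_eq_zero_of_notMem_tsupport fun hx' => hx (hφ.2.2 hx'), mul_zero]

theorem IsTest.deriv {φ : ℝ → ℂ} (hφ : IsTest φ) : IsTest (deriv φ) :=
  ⟨(contDiff_infty_iff_deriv.1 hφ.1).2, hφ.2.1.deriv, (tsupport_deriv_subset).trans hφ.2.2⟩

theorem IsTest.integrable {φ : ℝ → ℂ} (hφ : IsTest φ) : Integrable φ :=
  hφ.1.continuous.integrable_of_hasCompactSupport hφ.2.1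

theorem IsTest.mul_contDiff {φ e : ℝ → ℂ} (hφ : IsTest φ) (he : ContDiff ℝ ∞ e) :
    IsTest (fun x => e x * φ x) := by
  have hs : Function.support (fun x => e x * φ x) ⊆ Function.support φ := fun x hx =>
    right_ne_zero_of_mul hx
  exact ⟨he.mul hφ.1, hφ.2.1.mono hs, (closure_mono hs).trans hφ.2.2⟩

theorem IsTest.conj {φ : ℝ → ℂ} (hφ : IsTest φ) : IsTest (fun x => conj (φ x)) := by
  have hs : Function.support (fun x => (starRingEnd ℂ) (φ x)) ⊆ Function.support φ := fun x hx h =>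
    hx (by simp [h])
  exact ⟨Complex.conjCLE.contDiff.comp hφ.1, hφ.2.1.mono hs, (closure_mono hs).trans hφ.2.2⟩

theorem IsTest.exists_primitive {θ : ℝ → ℂ} (hθ : IsTest θ) (h0 : ∫ x, θ x = 0) :
    ∃ φ, IsTest φ ∧ _root_.deriv φ = θ := by
  have hcpt : IsCompact (tsupport θ ∪ {1}) := hθ.2.1.isCompact.union isCompact_singleton
  have hne : (tsupport θ ∪ {1} : Set ℝ).Nonempty := ⟨1, by simp⟩
  obtain ⟨a, ha, ha'⟩ := hcpt.exists_isLeast hne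
  obtain ⟨b, hb, hb'⟩ := hcpt.exists_isGreatest hne
  have ha0 : 0 < a := by
    rcases ha with h | h
    · exact hθ.2.2 h
    · rw [mem_singleton_iff] at h
      rw [h]
      exact one_pos
  have hc := hθ.1.continuous
  have hz : ∀ x, x ∉ Icc a b → θ x = 0 := fun x hx =>
    image_eq_zero_of_notMem_tsupport fun h => hx ⟨ha' (Or.inl h), hb' (Or.inl h)⟩
  set φ : ℝ → ℂ := fun x => ∫ t in a..x, θ t with hφ
  have hd : ∀ x, HasDerivAt φ (θ x) x := fun x => hc.integral_hasStrictDerivAt a x |>.hasDerivAt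
  have hd' : _root_.deriv φ = θ := funext fun x => (hd x).deriv
  have hsupp : Function.support φ ⊆ Icc a b := by
    intro x hx
    by_contra hn
    refine hx ?_
    rcases lt_or_ge x a with h | h
    · refine intervalIntegral.integral_zero_ae ?_ |>.trans rfl
      refine Eventually.mono (compl_mem_ae_iff.2 (measure_singleton a)) fun t ht ht' => ?_
      rw [uIoc_of_ge h.le] at ht'
      exact hz t fun h' => ht (le_antisymm ht'.2 h'.1)
    · have hbx : b < x := by
        by_contra hbx
        exact hn ⟨h, not_lt.1 hbx⟩
      rw [← h0]
      change ∫ t in a..x, θ t = _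
      rw [intervalIntegral.integral_of_le h, ← integral_Icc_eq_integral_Ioc]
      exact setIntegral_eq_integral_of_forall_compl_eq_zero fun t ht =>
        hz t fun h' => ht ⟨h'.1, h'.2.trans hbx.le⟩
  refine ⟨φ, ⟨contDiff_infty_iff_deriv.2 ⟨fun x => (hd x).differentiableAt, hd' ▸ hθ.1⟩,
    HasCompactSupport.of_support_subset_isCompact isCompact_Icc hsupp, ?_⟩, hd'⟩
  exact (closure_minimal hsupp isClosed_Icc).trans fun x hx => ha0.trans_le hx.1

theorem exists_isTest_integral_eq_one : ∃ ρ, IsTest ρ ∧ ∫ x, ρ x = 1 := by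
  let f : ContDiffBump (2 : ℝ) := ⟨1 / 2, 1, by norm_num, by norm_num⟩
  have hs : Function.support (fun x => (f.normed volume x : ℂ)) ⊆ Function.support (f.normed volume) := by
    intro x hx
    simpa using hx
  refine ⟨fun x => (f.normed volume x : ℂ), ⟨Complex.ofRealCLM.contDiff.comp f.contDiff_normed,
    f.hasCompactSupport_normed.mono hs, (closure_mono hs).trans ?_⟩, ?_⟩
  · change tsupport (f.normed volume) ⊆ _
    rw [f.tsupport_normed_eq]
    intro x hx
    rw [Metric.mem_closedBall, Real.dist_eq] at hx
    have h1 := (abs_le.1 hx).1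
    have h2 : f.rOut = 1 := rfl
    rw [mem_Ioi]
    linarith
  · rw [integral_complex_ofReal, f.integral_normed]
    simp

theorem ae_eq_const_of_integral_mul_deriv_eq_zero {u : ℝ → ℂ}
    (hu : LocallyIntegrableOn u (Ioi 0) volume)
    (h : ∀ φ, IsTest φ → ∫ x, u x * deriv φ x = 0) : ∃ C : ℂ, ∀ᵐ x ∂μ₀, u x = C := by
  obtain ⟨ρ, hρ, hρ1⟩ := exists_isTest_integral_eq_one
  have hint : ∀ {ψ : ℝ → ℂ}, IsTest ψ → Integrable fun x => u x * ψ x := by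
    intro ψ hψ
    have h1 : IntegrableOn u (tsupport ψ) :=
      hu.integrableOn_compact_subset hψ.2.2 hψ.2.1.isCompact
    have h2 : IntegrableOn (fun x => u x * ψ x) (tsupport ψ) :=
      h1.mul_continuousOn hψ.1.continuous.continuousOn hψ.2.1.isCompact
    refine (integrableOn_iff_integrable_of_support_subset fun x hx => ?_).1 h2
    exact subset_tsupport _ (right_ne_zero_of_mul hx)
  set C : ℂ := ∫ x, u x * ρ x with hC
  refine ⟨C, ?_⟩
  have hz := isOpen_Ioi.ae_eq_zero_of_integral_contDiff_smul_eq_zero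
    (f := fun x => u x - C) (μ := volume) (hu.sub ((locallyIntegrable_const C).locallyIntegrableOn _))
    (by
      intro g hg hgc hgs
      have ht : IsTest (fun x => (g x : ℂ)) := by
        have hsupp : Function.support (fun x => (g x : ℂ)) ⊆ Function.support g := by
          intro x hx
          simpa using hx
        exact ⟨Complex.ofRealCLM.contDiff.comp hg, hgc.mono hsupp, (closure_mono hsupp).trans hgs⟩
      set c : ℂ := ∫ x, (g x : ℂ) with hc
      have hθ := ht.add (hρ.smul (-c))
      obtain ⟨φ, hφ, hφ'⟩ := hθ.exists_primitive (by
        have := integral_add ht.integrable (hρ.integrable.smul (-c))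
        simp only [Pi.add_apply]
        refine this.trans ?_
        simp only [Pi.smul_apply, smul_eq_mul]
        rw [integral_const_mul, hρ1, hc]
        ring)
      have h1 := h φ hφ
      rw [hφ'] at h1
      have e1 : ∀ x, u x * ((fun x => (g x : ℂ)) + -c • ρ) x =
          u x * (g x : ℂ) - c * (u x * ρ x) := by
        intro x
        simp only [Pi.add_apply, Pi.smul_apply, smul_eq_mul]
        ring
      simp only [e1] at h1
      rw [integral_sub (hint ht) ((hint hρ).const_mul c), integral_const_mul, ← hC] at h1
      have e2 : ∀ x, g x • (u x - C) = u x * (g x : ℂ) - C * (g x : ℂ) := by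
        intro x
        rw [Complex.real_smul]
        ring
      simp only [e2]
      rw [integral_sub (hint ht) (ht.integrable.const_mul C), integral_const_mul, ← hc, mul_comm C]
      exact h1)
  rw [ae_restrict_iff' measurableSet_Ioi]
  filter_upwards [hz] with x hx hx0
  exact sub_eq_zero.1 (hx hx0)

theorem IsWeakDeriv.eq_exp {w : L2} {c : ℝ} (h : IsWeakDeriv w ((c : ℂ) • w)) :
    ∃ C : ℂ, ∀ᵐ x ∂μ₀, w x = C * (Real.exp (c * x) : ℂ) := by
  have hloc : LocallyIntegrableOn (w : ℝ → ℂ) (Ioi 0) volume :=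
    locallyIntegrableOn_of_locallyIntegrable_restrict
      ((Lp.memLp w).locallyIntegrable (by norm_num))
  set e : ℝ → ℂ := fun x => (Real.exp (-(c * x)) : ℂ) with he
  have hes : ContDiff ℝ ∞ e := Complex.ofRealCLM.contDiff.comp
    (Real.contDiff_exp.comp (by fun_prop : ContDiff ℝ ∞ fun x : ℝ => -(c * x)))
  obtain ⟨C, hC⟩ := ae_eq_const_of_integral_mul_deriv_eq_zero (u := fun x => w x * e x)
    (hloc.mul_continuousOn hes.continuous.continuousOn isOpen_Ioi.isLocallyClosed) (by
      intro ψ hψ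
      have hφ := hψ.mul_contDiff hes
      have hde : ∀ x, HasDerivAt e (-(c : ℂ) * e x) x := by
        intro x
        have h1 : HasDerivAt (fun x : ℝ => Real.exp (-(c * x))) (-c * Real.exp (-(c * x))) x := by
          have := (((hasDerivAt_id x).const_mul c).fun_neg).exp
          simpa [mul_comm] using this
        have := h1.ofReal_comp
        push_cast at this
        simpa [he] using this
      have hd : ∀ x, deriv (fun x => e x * ψ x) x = e x * deriv ψ x - c * (e x * ψ x) := by
        intro x
        have h1 := (hde x).fun_mul ((hψ.1.differentiable (by simp) x).hasDerivAt)
        rw [h1.deriv]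
        ring
      have h1 := h _ hφ
      have i1 := integrable_mul_L2 w (hψ.deriv.mul_contDiff hes).memLp
      have i2 := integrable_mul_L2 w hφ.memLp
      have e1 : ∀ x, w x * (e x * deriv ψ x - c * (e x * ψ x)) =
          w x * (e x * deriv ψ x) - c * (w x * (e x * ψ x)) := fun x => by ring
      have e2 : ∫ x in Ioi (0 : ℝ), ((c : ℂ) • w : L2) x * (e x * ψ x) =
          c * ∫ x in Ioi (0 : ℝ), w x * (e x * ψ x) := by
        rw [← integral_const_mul]
        refine integral_congr_ae ?_
        filter_upwards [Lp.coeFn_smul (c : ℂ) w] with x hx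
        rw [hx, Pi.smul_apply, smul_eq_mul, mul_assoc]
      simp only [hd, e1] at h1
      rw [integral_sub i1 (i2.const_mul _), integral_const_mul, e2] at h1
      simp only [mul_assoc]
      rw [← (hψ.deriv.mul_contDiff hes).integral_eq]
      linear_combination h1)
  refine ⟨C, ?_⟩
  filter_upwards [hC] with x hx
  rw [← hx, mul_assoc, he, ← Complex.ofReal_mul, ← Real.exp_add]
  simp

/-! ### The sine and the cosine transform of weak derivatives -/

/-- The normalized sine transform. -/
def sinOp : L2 →L[ℂ] L2 := isPlancherelKernel_sin.op

/-- The normalized cosine transform. -/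
def cosOp : L2 →L[ℂ] L2 := isPlancherelKernel_cos.op

theorem sinOp_sinOp (f : L2) : sinOp (sinOp f) = f := isPlancherelKernel_sin.op_op f

theorem cosOp_cosOp (f : L2) : cosOp (cosOp f) = f := isPlancherelKernel_cos.op_op f

theorem inner_sinOp (f g : L2) : inner ℂ (sinOp f) (sinOp g) = inner ℂ f g :=
  isPlancherelKernel_sin.inner_op_op f g

theorem inner_cosOp (f g : L2) : inner ℂ (cosOp f) (cosOp g) = inner ℂ f g :=
  isPlancherelKernel_cos.inner_op_op f g

/-- A test function as an element of `L²(0, ∞)`. -/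
def IsTest.toL2 {φ : ℝ → ℂ} (hφ : IsTest φ) : L2 := hφ.memLp.toLp φ

theorem IsTest.coeFn_toL2 {φ : ℝ → ℂ} (hφ : IsTest φ) : hφ.toL2 =ᵐ[μ₀] φ := hφ.memLp.coeFn_toLp

theorem kernelTransform_deriv {k k' : ℝ → ℝ} (hk : ∀ x, HasDerivAt k (k' x) x)
    (hk' : Continuous k') {φ : ℝ → ℂ} (hφ : IsTest φ) (x : ℝ) :
    kernelTransform k (deriv φ) x = -(x * kernelTransform k' φ x) := by
  have hkc : Continuous k := continuous_iff_continuousAt.2 fun x => (hk x).continuousAt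
  have hcm : ∀ {ψ : ℝ → ℂ} {m : ℝ → ℝ}, IsTest ψ → Continuous m →
      Integrable fun ξ => ψ ξ * (m (x * ξ) : ℂ) := by
    intro ψ m hψ hm
    refine Continuous.integrable_of_hasCompactSupport (hψ.1.continuous.mul (by fun_prop)) ?_
    exact hψ.2.1.mul_right
  have hd : ∀ ξ, HasDerivAt (fun ξ => φ ξ * (k (x * ξ) : ℂ))
      (deriv φ ξ * (k (x * ξ) : ℂ) + x * (φ ξ * (k' (x * ξ) : ℂ))) ξ := by
    intro ξ
    have h1 : HasDerivAt (fun ξ : ℝ => k (x * ξ)) (k' (x * ξ) * x) ξ := by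
      have h0 : HasDerivAt (fun ξ : ℝ => x * ξ) x ξ := by
        simpa using (hasDerivAt_id ξ).const_mul x
      exact (hk (x * ξ)).comp ξ h0
    have h2 := ((hφ.1.differentiable (by simp) ξ).hasDerivAt).fun_mul h1.ofReal_comp
    refine h2.congr_deriv ?_
    push_cast
    ring
  have hI := integral_eq_zero_of_hasDerivAt_of_integrable hd
    ((hcm hφ.deriv hkc).add ((hcm hφ hk').const_mul _)) (hcm hφ hkc)
  rw [integral_add (hcm hφ.deriv hkc) ((hcm hφ hk').const_mul _), integral_const_mul] at hI
  have hset : ∀ {ψ : ℝ → ℂ} {m : ℝ → ℝ}, IsTest ψ →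
      kernelTransform m ψ x = ∫ ξ, ψ ξ * (m (x * ξ) : ℂ) := by
    intro ψ m hψ
    have := hψ.integral_eq (fun ξ => (m (x * ξ) : ℂ))
    simpa only [kernelTransform, mul_comm] using this
  rw [hset hφ.deriv, hset hφ]
  exact eq_neg_of_add_eq_zero_left hI

theorem IsPlancherelKernel.coeFn_op_toL2 {k : ℝ → ℝ} (hk : IsPlancherelKernel k) {φ : ℝ → ℂ}
    (hφ : IsTest φ) : hk.op hφ.toL2 =ᵐ[μ₀] fun x => κ * kernelTransform k φ x := by
  have hi : Integrable hφ.toL2 μ₀ := hφ.integrable.restrict.congr hφ.coeFn_toL2.symm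
  filter_upwards [hk.coeFn_op hi] with x hx
  rw [hx, kernelTransform_congr hφ.coeFn_toL2]

theorem sinOp_deriv {φ : ℝ → ℂ} (hφ : IsTest φ) :
    sinOp hφ.deriv.toL2 =ᵐ[μ₀] fun η => -(η : ℂ) * cosOp hφ.toL2 η := by
  filter_upwards [isPlancherelKernel_sin.coeFn_op_toL2 hφ.deriv,
    isPlancherelKernel_cos.coeFn_op_toL2 hφ] with η h1 h2
  rw [sinOp, cosOp, h1, h2, kernelTransform_deriv Real.hasDerivAt_sin Real.continuous_cos hφ]
  ring

theorem cosOp_deriv {φ : ℝ → ℂ} (hφ : IsTest φ) :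
    cosOp hφ.deriv.toL2 =ᵐ[μ₀] fun η => (η : ℂ) * sinOp hφ.toL2 η := by
  filter_upwards [isPlancherelKernel_cos.coeFn_op_toL2 hφ.deriv,
    isPlancherelKernel_sin.coeFn_op_toL2 hφ] with η h1 h2
  rw [sinOp, cosOp, h1, h2, kernelTransform_deriv Real.hasDerivAt_cos
    (k' := fun x => -Real.sin x) (by fun_prop) hφ]
  simp only [kernelTransform, Complex.ofReal_neg, mul_neg, integral_neg, neg_neg]
  ring

theorem isWeakDeriv_iff_inner (f g : L2) : IsWeakDeriv f g ↔
    ∀ φ (hφ : IsTest φ), inner ℂ hφ.deriv.toL2 f = -inner ℂ hφ.toL2 g := by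
  have key : ∀ {ψ : ℝ → ℂ} (hψ : IsTest ψ) (f : L2),
      inner ℂ hψ.toL2 f = ∫ x in Ioi (0 : ℝ), f x * conj (ψ x) := by
    intro ψ hψ f
    rw [inner_L2]
    refine integral_congr_ae ?_
    filter_upwards [hψ.coeFn_toL2] with x hx
    rw [hx, mul_comm]
  have hconj : ∀ {ψ : ℝ → ℂ}, IsTest ψ → ∀ x, deriv (fun x => conj (ψ x)) x = conj (deriv ψ x) := by
    intro ψ hψ x
    exact ((hψ.1.differentiable (by simp) x).hasDerivAt.star).deriv
  constructor
  · intro h φ hφ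
    have := h _ hφ.conj
    simp only [hconj hφ] at this
    rw [key, key, this]
  · intro h φ hφ
    have := h _ hφ.conj
    rw [key, key] at this
    simp only [hconj hφ, Complex.conj_conj] at this
    exact this

theorem inner_eq_neg_inner {a a' f g : L2} {c : ℝ}
    (h : a' =ᵐ[μ₀] fun η => -((c : ℂ) * η) * a η) (h' : g =ᵐ[μ₀] fun η => ((c : ℂ) * η) * f η) :
    inner ℂ a' f = -inner ℂ a g := by
  rw [inner_L2, inner_L2, ← integral_neg]
  refine integral_congr_ae ?_
  filter_upwards [h, h'] with η h1 h2
  rw [h1, h2]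
  simp only [map_mul, map_neg, Complex.conj_ofReal]
  ring

theorem isWeakDeriv_of_cosOp_eq {f g : L2}
    (h : cosOp g =ᵐ[μ₀] fun η => (η : ℂ) * sinOp f η) : IsWeakDeriv f g := by
  rw [isWeakDeriv_iff_inner]
  intro φ hφ
  rw [← inner_sinOp, ← inner_cosOp hφ.toL2]
  refine inner_eq_neg_inner (c := 1) ?_ ?_
  · simpa using sinOp_deriv hφ
  · simpa using h

theorem isWeakDeriv_of_sinOp_eq {f g : L2}
    (h : sinOp g =ᵐ[μ₀] fun η => -(η : ℂ) * cosOp f η) : IsWeakDeriv f g := by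
  rw [isWeakDeriv_iff_inner]
  intro φ hφ
  rw [← inner_cosOp, ← inner_sinOp hφ.toL2]
  refine inner_eq_neg_inner (c := -1) ?_ ?_
  · simpa using cosOp_deriv hφ
  · simpa using h

theorem memLp_two_of_sq_le {f : ℝ → ℂ} (hf : Measurable f) {C : ℝ}
    (h : ∀ η : ℝ, ‖f η‖ ^ 2 ≤ C * (1 + η ^ 2)⁻¹) : MemLp f 2 μ₀ := by
  refine (memLp_two_iff_integrable_sq_norm hf.aestronglyMeasurable).2 ?_
  refine ((integrable_inv_one_add_sq.const_mul C).restrict).mono'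
    (hf.norm.pow_const 2).aestronglyMeasurable (Eventually.of_forall fun η => ?_)
  rw [Real.norm_of_nonneg (by positivity)]
  exact h η

theorem integrable_of_memLp_mul {h : ℝ → ℂ} (h1 : MemLp h 2 μ₀)
    (h2 : MemLp (fun η : ℝ => (η : ℂ) * h η) 2 μ₀) : Integrable h μ₀ := by
  have hne : ∀ η : ℝ, 1 + (η : ℂ) * Complex.I ≠ 0 := fun η h0 => by
    have := congrArg Complex.re h0
    simp at this
  have hB : MemLp (fun η : ℝ => (1 + (η : ℂ) * Complex.I)⁻¹) 2 μ₀ := by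
    refine memLp_two_of_sq_le (C := 1) (by fun_prop) fun η => le_of_eq ?_
    rw [norm_inv, inv_pow, one_mul, ← Complex.normSq_eq_norm_sq]
    simp [Complex.normSq_apply, sq]
  have := (h1.add (h2.const_mul Complex.I)).integrable_mul hB
  refine this.congr (Eventually.of_forall fun η => ?_)
  have := hne η
  simp only [Pi.mul_apply, Pi.add_apply]
  rw [show h η + Complex.I * (η * h η) = h η * (1 + η * Complex.I) by ring, mul_assoc,
    mul_inv_cancel₀ this, mul_one]

theorem vanishesAtZero_of_cosOp_eq {f g : L2}
    (h : cosOp g =ᵐ[μ₀] fun η => (η : ℂ) * sinOp f η) : VanishesAtZero f := by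
  have hi : Integrable (sinOp f) μ₀ :=
    integrable_of_memLp_mul (Lp.memLp _) ((memLp_congr_ae h).1 (Lp.memLp _))
  refine ⟨fun x => κ * kernelTransform Real.sin (sinOp f) x,
    ((isPlancherelKernel_sin.continuous_kernelTransform hi).const_mul κ).continuousOn, ?_, ?_⟩
  · have := isPlancherelKernel_sin.coeFn_op hi
    rwa [← sinOp, sinOp_sinOp] at this
  · simp [kernelTransform]

/-- The multiplier `η / (1 + η²)` is bounded. -/
theorem isBddMeas_mul_resolventSymbol {z : ℂ} (hz : z ∈ Complex.slitPlane) (c : ℝ) :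
    IsBddMeas fun η : ℝ => ((c : ℂ) * η) * resolventSymbol z η := by
  obtain ⟨C, hC, h⟩ := norm_resolventSymbol_le hz
  refine ⟨(by fun_prop : Measurable fun η : ℝ => (c : ℂ) * η).mul (measurable_resolventSymbol z),
    |c| * C, fun η => ?_⟩
  rw [norm_mul, norm_mul, Complex.norm_real, Complex.norm_real, mul_assoc]
  refine mul_le_mul_of_nonneg_left ?_ (abs_nonneg c)
  calc ‖η‖ * ‖resolventSymbol z η‖ ≤ ‖η‖ * (C * (1 + η ^ 2)⁻¹) := by
        gcongr
        exact h η
    _ = C * (|η| / (1 + η ^ 2)) := by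
        rw [Real.norm_eq_abs]
        ring
    _ ≤ C := by
        refine mul_le_of_le_one_right hC.le ((div_le_one (by positivity)).2 ?_)
        nlinarith [sq_abs η, sq_nonneg (|η| - 1)]

theorem eq_mul_iff_mulOp (c : ℝ) (F G : L2) :
    (G =ᵐ[μ₀] fun η => ((c : ℂ) * η) * F η) ↔ mulOp (resolventSymbol 1) G =
      mulOp (fun η => ((c : ℂ) * η) * resolventSymbol 1 η) F :=
  ae_eq_mul_iff_mulOp (isBddMeas_resolventSymbol Complex.one_mem_slitPlane)
    (isBddMeas_mul_resolventSymbol Complex.one_mem_slitPlane c)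
    (fun η => inv_ne_zero (add_sq_ne_zero Complex.one_mem_slitPlane η)) F G

theorem IsWeakDeriv.sub {f f' g g' : L2} (h : IsWeakDeriv f g) (h' : IsWeakDeriv f' g') :
    IsWeakDeriv (f - f') (g - g') := by
  have := h.add (h'.smul (-1))
  simpa [sub_eq_add_neg] using this

theorem eq_zero_of_isWeakDeriv_self {w : L2} (h : IsWeakDeriv w w) : w = 0 := by
  obtain ⟨C, hC⟩ := IsWeakDeriv.eq_exp (w := w) (c := 1) (by simpa using h)
  have hC0 : C = 0 := by
    by_contra hne
    have h1 : ∫⁻ x in Ioi (0 : ℝ), ‖C‖ₑ ^ 2 ≤ ∫⁻ x in Ioi (0 : ℝ), ‖w x‖ₑ ^ 2 := by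
      refine lintegral_mono_ae ?_
      filter_upwards [hC, ae_restrict_mem measurableSet_Ioi] with x hx hx0
      gcongr
      rw [enorm_le_iff_norm_le, hx, norm_mul, Complex.norm_real,
        Real.norm_of_nonneg (Real.exp_pos _).le]
      refine le_mul_of_one_le_right (norm_nonneg _) (Real.one_le_exp ?_)
      have : (0 : ℝ) < x := hx0
      linarith
    have h2 := h1.trans_lt (lintegral_lt_top_of_memLp_two (Lp.memLp w))
    rw [setLIntegral_const, Real.volume_Ioi, ENNReal.mul_top (by simpa using hne)] at h2
    exact lt_irrefl _ h2
  refine Lp.ext ?_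
  filter_upwards [hC, Lp.coeFn_zero ℂ 2 μ₀] with x h1 h2
  rw [h1, h2, hC0, zero_mul, Pi.zero_apply]

theorem eqOn_Ici_of_ae_eq {F G : ℝ → ℂ} (hF : ContinuousOn F (Ici 0)) (hG : ContinuousOn G (Ici 0))
    (h : F =ᵐ[μ₀] G) : EqOn F G (Ici 0) := by
  have h1 : EqOn F G (Ioi 0) :=
    Measure.eqOn_open_of_ae_eq h isOpen_Ioi (hF.mono Ioi_subset_Ici_self)
      (hG.mono Ioi_subset_Ici_self)
  exact h1.of_subset_closure hF hG Ioi_subset_Ici_self (by rw [closure_Ioi])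

/-- A weak solution of `f'' = f` on the half line that vanishes at the boundary is zero. -/
theorem eq_zero_of_isWeakDeriv {f g : L2} (h1 : IsWeakDeriv f g) (h2 : IsWeakDeriv g f)
    (h0 : VanishesAtZero f) : f = 0 := by
  have hw := eq_zero_of_isWeakDeriv_self (w := f + g) (by
    have := h1.add h2
    rwa [add_comm g f] at this)
  obtain rfl : g = -f := (neg_eq_of_add_eq_zero_right hw).symm
  obtain ⟨C, hC⟩ := IsWeakDeriv.eq_exp (w := f) (c := -1) (by simpa using h1)
  obtain ⟨G, hG, hfG, hG0⟩ := h0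
  have hEq := eqOn_Ici_of_ae_eq (F := fun x => C * (Real.exp (-1 * x) : ℂ)) (G := G)
    (Continuous.continuousOn (by fun_prop)) hG (EventuallyEq.trans (EventuallyEq.symm hC) hfG)
  have h3 := hEq (mem_Ici.2 le_rfl)
  simp only [mul_zero, Real.exp_zero, Complex.ofReal_one, mul_one, hG0] at h3
  refine Lp.ext ?_
  filter_upwards [hC, Lp.coeFn_zero ℂ 2 μ₀] with x h1 h2
  rw [h1, h2, h3, zero_mul, Pi.zero_apply]

/-! ### The closure of the test functions in `H¹` -/

/-- The pairs `(φ, φ')` with a test function `φ`. -/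
def testGraph : Submodule ℂ (WithLp 2 (L2 × L2)) where
  carrier := {p | ∃ φ, ∃ hφ : IsTest φ, p.fst = hφ.toL2 ∧ p.snd = hφ.deriv.toL2}
  zero_mem' := by
    have h0 : IsTest (0 : ℝ → ℂ) :=
      ⟨contDiff_const, HasCompactSupport.zero, by simp [tsupport]⟩
    refine ⟨0, h0, ?_, ?_⟩
    · refine Lp.ext ?_
      filter_upwards [h0.coeFn_toL2, Lp.coeFn_zero ℂ 2 μ₀] with x h1 h2
      rw [h1]
      exact h2
    · refine Lp.ext ?_
      filter_upwards [h0.deriv.coeFn_toL2, Lp.coeFn_zero ℂ 2 μ₀] with x h1 h2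
      rw [h1]
      refine Eq.trans h2 ?_
      simp
  add_mem' := by
    rintro p q ⟨φ, hφ, h1, h2⟩ ⟨ψ, hψ, h3, h4⟩
    refine ⟨φ + ψ, hφ.add hψ, ?_, ?_⟩
    · rw [WithLp.add_fst, h1, h3]
      refine Lp.ext ?_
      filter_upwards [(hφ.add hψ).coeFn_toL2, hφ.coeFn_toL2, hψ.coeFn_toL2,
        Lp.coeFn_add hφ.toL2 hψ.toL2] with x e1 e2 e3 e4
      rw [e1, e4, Pi.add_apply, Pi.add_apply, e2, e3]
    · rw [WithLp.add_snd, h2, h4]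
      refine Lp.ext ?_
      filter_upwards [(hφ.add hψ).deriv.coeFn_toL2, hφ.deriv.coeFn_toL2, hψ.deriv.coeFn_toL2,
        Lp.coeFn_add hφ.deriv.toL2 hψ.deriv.toL2] with x e1 e2 e3 e4
      rw [e1, e4, Pi.add_apply, e2, e3, hφ.deriv_add hψ]
  smul_mem' := by
    rintro c p ⟨φ, hφ, h1, h2⟩
    refine ⟨c • φ, hφ.smul c, ?_, ?_⟩
    · rw [WithLp.smul_fst, h1]
      refine Lp.ext ?_
      filter_upwards [(hφ.smul c).coeFn_toL2, hφ.coeFn_toL2, Lp.coeFn_smul c hφ.toL2]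
        with x e1 e2 e3
      rw [e1, e3, Pi.smul_apply, Pi.smul_apply, e2]
    · rw [WithLp.smul_snd, h2]
      refine Lp.ext ?_
      filter_upwards [(hφ.smul c).deriv.coeFn_toL2, hφ.deriv.coeFn_toL2,
        Lp.coeFn_smul c hφ.deriv.toL2] with x e1 e2 e3
      rw [e1, e3, Pi.smul_apply, e2, IsTest.deriv_smul, smul_eq_mul]

theorem IsTest.eLpNorm_sub {φ : ℝ → ℂ} (hφ : IsTest φ) (f : L2) :
    eLpNorm (fun x => f x - φ x) 2 μ₀ = ‖f - hφ.toL2‖ₑ := by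
  rw [Lp.enorm_def]
  refine eLpNorm_congr_ae ?_
  filter_upwards [hφ.coeFn_toL2, Lp.coeFn_sub f hφ.toL2] with x h1 h2
  rw [h2, Pi.sub_apply, h1]

theorem mem_closure_testGraph_iff (p : WithLp 2 (L2 × L2)) :
    p ∈ testGraph.topologicalClosure ↔ ∀ ε : ℝ≥0∞, 0 < ε → ∃ φ : ℝ → ℂ, IsTest φ ∧
      eLpNorm (fun x => p.fst x - φ x) 2 μ₀ < ε ∧
      eLpNorm (fun x => p.snd x - deriv φ x) 2 μ₀ < ε := by
  constructor
  · intro hp ε hε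
    obtain ⟨u, hu, hlim⟩ := mem_closure_iff_seq_limit.1 hp
    have h1 : Tendsto (fun n => (u n).fst) atTop (𝓝 p.fst) :=
      ((WithLp.continuous_fst 2 L2 L2).tendsto p).comp hlim
    have h2 : Tendsto (fun n => (u n).snd) atTop (𝓝 p.snd) :=
      ((WithLp.continuous_snd 2 L2 L2).tendsto p).comp hlim
    rw [tendsto_iff_edist_tendsto_0] at h1 h2
    obtain ⟨n, hn1, hn2⟩ := ((h1.eventually_lt_const hε).and (h2.eventually_lt_const hε)).exists
    obtain ⟨φ, hφ, e1, e2⟩ := hu n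
    refine ⟨φ, hφ, ?_, ?_⟩
    · rwa [hφ.eLpNorm_sub, ← e1, ← edist_eq_enorm_sub, edist_comm]
    · rwa [hφ.deriv.eLpNorm_sub, ← e2, ← edist_eq_enorm_sub, edist_comm]
  · intro h
    choose φ hφ h1 h2 using fun n : ℕ => h ((n : ℝ≥0∞) + 1)⁻¹ (by simp)
    have hz : Tendsto (fun n : ℕ => ((n : ℝ≥0∞) + 1)⁻¹) atTop (𝓝 0) := by
      have := (tendsto_add_atTop_iff_nat 1).2 ENNReal.tendsto_inv_nat_nhds_zero
      simpa using this
    have t1 : Tendsto (fun n => (hφ n).toL2) atTop (𝓝 p.fst) := by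
      rw [tendsto_iff_edist_tendsto_0]
      refine tendsto_of_tendsto_of_tendsto_of_le_of_le tendsto_const_nhds hz
        (fun _ => zero_le) fun n => ?_
      change edist (hφ n).toL2 p.fst ≤ _
      rw [edist_comm, edist_eq_enorm_sub, ← (hφ n).eLpNorm_sub]
      exact (h1 n).le
    have t2 : Tendsto (fun n => (hφ n).deriv.toL2) atTop (𝓝 p.snd) := by
      rw [tendsto_iff_edist_tendsto_0]
      refine tendsto_of_tendsto_of_tendsto_of_le_of_le tendsto_const_nhds hz
        (fun _ => zero_le) fun n => ?_
      change edist (hφ n).deriv.toL2 p.snd ≤ _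
      rw [edist_comm, edist_eq_enorm_sub, ← (hφ n).deriv.eLpNorm_sub]
      exact (h2 n).le
    have t3 := ((WithLp.prod_continuous_toLp 2 L2 L2).tendsto (p.fst, p.snd)).comp (t1.prodMk_nhds t2)
    exact mem_closure_of_tendsto t3 (Eventually.of_forall fun n => ⟨φ n, hφ n, rfl, rfl⟩)

theorem cosOp_eq_of_mem_closure {p : WithLp 2 (L2 × L2)} (hp : p ∈ testGraph.topologicalClosure) :
    cosOp p.snd =ᵐ[μ₀] fun η => (η : ℂ) * sinOp p.fst η := by
  have key : ∀ f g : L2, (cosOp g =ᵐ[μ₀] fun η => (η : ℂ) * sinOp f η) ↔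
      mulOp (resolventSymbol 1) (cosOp g) =
        mulOp (fun η => (((1 : ℝ) : ℂ) * η) * resolventSymbol 1 η) (sinOp f) := by
    intro f g
    rw [← eq_mul_iff_mulOp]
    simp
  rw [key]
  have hc1 := WithLp.continuous_fst 2 L2 L2
  have hc2 := WithLp.continuous_snd 2 L2 L2
  refine closure_minimal (s := (testGraph : Set (WithLp 2 (L2 × L2))))
    (t := {p | mulOp (resolventSymbol 1) (cosOp p.snd) =
        mulOp (fun η => (((1 : ℝ) : ℂ) * η) * resolventSymbol 1 η) (sinOp p.fst)}) ?_
    (isClosed_eq (by fun_prop) (by fun_prop)) hp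
  rintro q ⟨φ, hφ, h1, h2⟩
  rw [mem_ofPred_eq, ← key, h1, h2]
  exact cosOp_deriv hφ

theorem mem_closure_of_isWeakDeriv {f g : L2} (h : IsWeakDeriv f g) (h0 : VanishesAtZero f) :
    WithLp.toLp 2 (f, g) ∈ testGraph.topologicalClosure := by
  set K := testGraph.topologicalClosure with hK
  have hcl : IsClosed (K : Set (WithLp 2 (L2 × L2))) := testGraph.isClosed_topologicalClosure
  have : CompleteSpace K := hcl.completeSpace_coe
  obtain ⟨q, hq, r, hr, hqr⟩ := K.exists_add_mem_mem_orthogonal (WithLp.toLp 2 (f, g))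
  have hqG := cosOp_eq_of_mem_closure hq
  have e1 : r.fst = f - q.fst := by
    have := congrArg WithLp.fst hqr
    rw [WithLp.add_fst] at this
    exact eq_sub_of_add_eq' this.symm
  have e2 : r.snd = g - q.snd := by
    have := congrArg WithLp.snd hqr
    rw [WithLp.add_snd] at this
    exact eq_sub_of_add_eq' this.symm
  have hN : IsWeakDeriv r.fst r.snd := by
    rw [e1, e2]
    exact h.sub (isWeakDeriv_of_cosOp_eq hqG)
  have hV : VanishesAtZero r.fst := by
    have := h0.add ((vanishesAtZero_of_cosOp_eq hqG).smul (-1))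
    rw [e1]
    simpa [sub_eq_add_neg] using this
  have hN' : IsWeakDeriv r.snd r.fst := by
    rw [isWeakDeriv_iff_inner]
    intro φ hφ
    have hm : WithLp.toLp 2 (hφ.toL2, hφ.deriv.toL2) ∈ K :=
      testGraph.le_topologicalClosure ⟨φ, hφ, rfl, rfl⟩
    have := (Submodule.mem_orthogonal K r).1 hr _ hm
    rw [WithLp.prod_inner_apply] at this
    exact eq_neg_of_add_eq_zero_right this
  have hz := eq_zero_of_isWeakDeriv hN hN' hV
  have hz' : r.snd = 0 := by
    rw [hz] at hN
    exact hN.eq_zero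
  have hr0 : r = 0 := WithLp.ofLp_injective 2 (Prod.ext hz hz')
  rw [hqr, hr0, add_zero]
  exact hq

theorem sinOp_eq_of_isWeakDeriv {f g : L2} (h : IsWeakDeriv f g) :
    sinOp g =ᵐ[μ₀] fun η => -(η : ℂ) * cosOp f η := by
  have h1 := Complex.one_mem_slitPlane
  have key := eq_mul_iff_mulOp (-1) (cosOp f) (sinOp g)
  simp only [Complex.ofReal_neg, Complex.ofReal_one, neg_mul, one_mul] at key
  simp only [neg_mul]
  rw [key]
  refine ext_inner_left ℂ fun u => ?_
  have hb := isBddMeas_resolventSymbol h1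
  have hb1 : IsBddMeas fun η : ℝ => -((η : ℂ) * resolventSymbol 1 η) := by
    simpa using isBddMeas_mul_resolventSymbol h1 (-1)
  have hb2 : IsBddMeas fun η : ℝ => (η : ℂ) * resolventSymbol 1 η := by
    simpa using isBddMeas_mul_resolventSymbol h1 1
  set a := sinOp (mulOp (resolventSymbol 1) u) with ha
  set a' := cosOp (mulOp (fun η => (η : ℂ) * resolventSymbol 1 η) u) with ha'
  have hrel : cosOp a' =ᵐ[μ₀] fun η => (η : ℂ) * sinOp a η := by
    rw [ha, ha', sinOp_sinOp, cosOp_cosOp]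
    filter_upwards [coeFn_mulOp hb u, coeFn_mulOp hb2 u] with η e1 e2
    rw [e1, e2, mul_assoc]
  have hmem := mem_closure_of_isWeakDeriv (isWeakDeriv_of_cosOp_eq hrel)
    (vanishesAtZero_of_cosOp_eq hrel)
  have hc1 := WithLp.continuous_fst 2 L2 L2
  have hc2 := WithLp.continuous_snd 2 L2 L2
  have hin : inner ℂ a' f = -inner ℂ a g := by
    refine closure_minimal (s := (testGraph : Set (WithLp 2 (L2 × L2))))
      (t := {p | inner ℂ p.snd f = -inner ℂ p.fst g}) ?_
      (isClosed_eq (by fun_prop) (by fun_prop)) hmem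
    rintro q ⟨φ, hφ, e1, e2⟩
    rw [mem_ofPred_eq, e1, e2]
    exact (isWeakDeriv_iff_inner f g).1 h φ hφ
  rw [← inner_cosOp, ← inner_sinOp a, ha, ha', sinOp_sinOp, cosOp_cosOp, inner_mulOp_left hb,
    inner_mulOp_left hb2] at hin
  have hreal : ∀ η : ℝ, conj (resolventSymbol 1 η) = resolventSymbol 1 η := fun η => by
    simp [resolventSymbol]
  simp only [map_mul, hreal, Complex.conj_ofReal] at hin
  rw [inner_mulOp_right hb, inner_mulOp_right hb1]
  simp only [neg_mul]
  rw [integral_neg, hin, neg_neg]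

theorem memH10_iff (f : L2) : MemH10 f ↔
    ∃ g, WithLp.toLp 2 (f, g) ∈ testGraph.topologicalClosure := by
  constructor
  · rintro ⟨g, -, h⟩
    exact ⟨g, (mem_closure_testGraph_iff (WithLp.toLp 2 (f, g))).2 h⟩
  · rintro ⟨g, h⟩
    exact ⟨g, isWeakDeriv_of_cosOp_eq (cosOp_eq_of_mem_closure h),
      (mem_closure_testGraph_iff (WithLp.toLp 2 (f, g))).1 h⟩

/-! ### The Laplacians in multiplication form -/

/-- If `F` and `η² F` are square-integrable, so is `η F`. -/
theorem memLp_mul_of_axisPoint {F G : L2} (h : G =ᵐ[μ₀] fun η => axisPoint η * F η) :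
    MemLp (fun η : ℝ => (η : ℂ) * F η) 2 μ₀ := by
  refine MemLp.mono ((Lp.memLp F).norm.add (Lp.memLp G).norm)
    ((by fun_prop : Measurable fun η : ℝ => (η : ℂ)).aestronglyMeasurable.mul
      (Lp.aestronglyMeasurable F)) ?_
  filter_upwards [h] with η hη
  rw [Pi.add_apply, Real.norm_of_nonneg (add_nonneg (norm_nonneg _) (norm_nonneg _)), hη, norm_mul,
    norm_mul, norm_axisPoint, Complex.norm_real, Real.norm_eq_abs]
  nlinarith [norm_nonneg (F η), sq_abs η, sq_nonneg (|η| - 1),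
    mul_nonneg (norm_nonneg (F η)) (sq_nonneg (|η| - 1))]

theorem isModel_dirichlet : IsModel dirichletLaplacian isPlancherelKernel_sin.unitary := by
  intro f k
  rw [dirichletLaplacian_graph]
  change (MemH10 f ∧ ∃ g : L2, IsWeakDeriv f g ∧ IsWeakDeriv g k) ↔
    sinOp k =ᵐ[μ₀] fun η => axisPoint η * sinOp f η
  constructor
  · rintro ⟨hf, g, h1, h2⟩
    obtain ⟨g', hg'⟩ := (memH10_iff f).1 hf
    have hr : cosOp g' =ᵐ[μ₀] fun η => (η : ℂ) * sinOp f η := cosOp_eq_of_mem_closure hg'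
    obtain rfl : g = g' := by
      have := h1.sub (isWeakDeriv_of_cosOp_eq hr)
      rw [sub_self] at this
      exact sub_eq_zero.1 this.eq_zero
    filter_upwards [hr, sinOp_eq_of_isWeakDeriv h2] with η e1 e2
    rw [e2, e1, axisPoint]
    ring
  · intro h
    have hm := memLp_mul_of_axisPoint h
    set g : L2 := cosOp (hm.toLp _) with hg
    have hr : cosOp g =ᵐ[μ₀] fun η => (η : ℂ) * sinOp f η := by
      rw [hg, cosOp_cosOp]
      exact hm.coeFn_toLp
    refine ⟨(memH10_iff f).2 ⟨g, mem_closure_of_isWeakDeriv (isWeakDeriv_of_cosOp_eq hr)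
      (vanishesAtZero_of_cosOp_eq hr)⟩, g, isWeakDeriv_of_cosOp_eq hr, isWeakDeriv_of_sinOp_eq ?_⟩
    filter_upwards [h, hr] with η e1 e2
    rw [e1, e2, axisPoint]
    ring

theorem isModel_neumann : IsModel neumannLaplacian isPlancherelKernel_cos.unitary := by
  intro f k
  rw [neumannLaplacian_graph]
  change (∃ g : L2, IsWeakDeriv f g ∧ IsWeakDeriv g k ∧ VanishesAtZero g) ↔
    cosOp k =ᵐ[μ₀] fun η => axisPoint η * cosOp f η
  constructor
  · rintro ⟨g, h1, h2, h3⟩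
    have hr : cosOp k =ᵐ[μ₀] fun η => (η : ℂ) * sinOp g η :=
      cosOp_eq_of_mem_closure (mem_closure_of_isWeakDeriv h2 h3)
    filter_upwards [sinOp_eq_of_isWeakDeriv h1, hr] with η e1 e2
    rw [e2, e1, axisPoint]
    ring
  · intro h
    have hm := (memLp_mul_of_axisPoint h).neg
    set g : L2 := sinOp (hm.toLp _) with hg
    have hr : sinOp g =ᵐ[μ₀] fun η => -(η : ℂ) * cosOp f η := by
      rw [hg, sinOp_sinOp]
      filter_upwards [hm.coeFn_toLp] with η hη
      rw [hη, Pi.neg_apply, neg_mul]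
    have hr' : cosOp k =ᵐ[μ₀] fun η => (η : ℂ) * sinOp g η := by
      filter_upwards [h, hr] with η e1 e2
      rw [e1, e2, axisPoint]
      ring
    exact ⟨g, isWeakDeriv_of_sinOp_eq hr, isWeakDeriv_of_cosOp_eq hr',
      vanishesAtZero_of_cosOp_eq hr'⟩

/-! ### Explicit formulas for the resolvent and the spectral measure -/

theorem normalization_mul_self : κ * κ = 2 / (Real.pi : ℂ) := by
  rw [← Complex.ofReal_mul, Real.mul_self_sqrt (by positivity)]
  push_cast
  rfl

theorem memLp_resolventSymbol_mul {s : ℂ} (hs : s ∈ Complex.slitPlane) {w : ℝ → ℂ}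
    (hw : Continuous w) {C : ℝ} (hC : ∀ η, ‖w η‖ ^ 2 ≤ C * (1 + η ^ 2)) :
    MemLp (fun η => resolventSymbol s η * w η) 2 μ₀ := by
  obtain ⟨D, hD, h⟩ := norm_resolventSymbol_le hs
  refine memLp_two_of_sq_le (C := D ^ 2 * C) ((measurable_resolventSymbol s).mul hw.measurable)
    fun η => ?_
  rw [norm_mul, mul_pow]
  calc ‖resolventSymbol s η‖ ^ 2 * ‖w η‖ ^ 2
      ≤ (D * (1 + η ^ 2)⁻¹) ^ 2 * (C * (1 + η ^ 2)) := by
        gcongr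
        · exact h η
        · exact hC η
    _ = D ^ 2 * C * (1 + η ^ 2)⁻¹ := by
        field_simp

theorem IsModel.resolvent_eq_integral {A : L2 →ₗ.[ℂ] L2} {k : ℝ → ℝ} {hk : IsPlancherelKernel k}
    (hA : IsModel A hk.unitary) {z : ℂ} (hz : z ∈ Complex.slitPlane) {g : L2}
    (hg : Integrable g μ₀) :
    resolvent A z g =ᵐ[μ₀] fun x => 2 / (Real.pi : ℂ) * ∫ η in Ioi (0 : ℝ),
      (k (x * η) : ℂ) / (z + (η : ℂ) ^ 2) * kernelTransform k g η := by
  have h1 : resolvent A z g = hk.op (mulOp (resolventSymbol z) (hk.op g)) := by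
    rw [hA.resolvent_eq hz]
    rfl
  have h2 := coeFn_mulOp (isBddMeas_resolventSymbol hz) (hk.op g)
  have h3 : MemLp (resolventSymbol z) 2 μ₀ := by
    simpa using memLp_resolventSymbol_mul hz (w := fun _ => 1) continuous_const (C := 1)
      fun η => by simp [sq_nonneg]
  have hi : Integrable (mulOp (resolventSymbol z) (hk.op g)) μ₀ :=
    (h3.integrable_mul (Lp.memLp (hk.op g))).congr h2.symm
  rw [h1]
  filter_upwards [hk.coeFn_op hi] with x hx
  rw [hx, ← normalization_mul_self, mul_assoc, kernelTransform]
  congr 1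
  rw [← integral_const_mul κ]
  refine integral_congr_ae ?_
  filter_upwards [h2, hk.coeFn_op hg] with η e1 e2
  rw [e1, e2, resolventSymbol]
  ring

theorem halfAxisMeasure_eq_axisMeasure {w v : ℝ → ℝ}
    (h : ∀ᵐ η ∂μ₀, 0 < η → 2 * η * w (-η ^ 2) = v η) :
    halfAxisMeasure w = axisMeasure fun η => ENNReal.ofReal (v η) := by
  rw [halfAxisMeasure_eq]
  refine axisMeasure_congr ?_
  filter_upwards [h, ae_restrict_mem measurableSet_Ioi] with η hη h0
  have h0 : 0 < η := h0
  rw [← ENNReal.ofReal_mul (by positivity), hη h0]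

theorem abs_neg_sq (η : ℝ) : |-η ^ 2| = η ^ 2 := by rw [abs_neg, abs_of_nonneg (sq_nonneg η)]

theorem sqrt_abs_neg_sq {η : ℝ} (h : 0 < η) : √|-η ^ 2| = η := by
  rw [abs_neg_sq, Real.sqrt_sq h.le]

theorem scalar_spectralPVM_unitary {k : ℝ → ℝ} (hk : IsPlancherelKernel k) (g : L2) {G : ℝ → ℂ}
    (hG : hk.op g =ᵐ[μ₀] fun η => κ * G η) :
    (spectralPVM hk.unitary).scalar g =
      halfAxisMeasure fun z => ‖G (√|z|)‖ ^ 2 / (Real.pi * √|z|) := by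
  rw [scalar_spectralPVM, halfAxisMeasure_eq_axisMeasure (v := fun η => ‖κ * G η‖ ^ 2)]
  · refine axisMeasure_congr ?_
    filter_upwards [hG] with η hη
    change ‖hk.op g η‖ₑ ^ 2 = _
    rw [hη, ← ofReal_norm, ENNReal.ofReal_pow (norm_nonneg _)]
  · refine Eventually.of_forall fun η h0 => ?_
    have := Real.pi_pos
    rw [sqrt_abs_neg_sq h0, norm_mul, mul_pow, Complex.norm_real,
      Real.norm_of_nonneg (by positivity), Real.sq_sqrt (by positivity)]
    field_simp

theorem IsModel.exists_spectralMeasure {A : L2 →ₗ.[ℂ] L2} {k : ℝ → ℝ} {hk : IsPlancherelKernel k}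
    (hA : IsModel A hk.unitary) :
    ∃ E : ProjectionValuedMeasure L2, IsSpectralMeasure A E ∧
      (∀ g : L2, Integrable g μ₀ → E.scalar g = halfAxisMeasure fun z =>
        ‖kernelTransform k g (√|z|)‖ ^ 2 / (Real.pi * √|z|)) ∧
      ∃ S : L2 →L[ℂ] L2, (∀ g : L2, Integrable g μ₀ → S g =ᵐ[μ₀] kernelTransform k g) ∧
        ∀ g : L2, E.scalar g = halfAxisMeasure fun z => ‖S g (√|z|)‖ ^ 2 / (Real.pi * √|z|) := by
  have hκ : κ ≠ 0 := by
    have : 0 < √(2 / Real.pi) := by positivity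
    exact_mod_cast this.ne'
  refine ⟨spectralPVM hk.unitary, hA.isSpectralMeasure,
    fun g hg => scalar_spectralPVM_unitary hk g (hk.coeFn_op hg), κ⁻¹ • hk.op, fun g hg => ?_,
    fun g => scalar_spectralPVM_unitary hk g ?_⟩
  · filter_upwards [hk.coeFn_op hg, Lp.coeFn_smul κ⁻¹ (hk.op g)] with η h1 h2
    rw [smul_apply, h2, Pi.smul_apply, h1, smul_eq_mul, inv_mul_cancel_left₀ hκ]
  · filter_upwards [Lp.coeFn_smul κ⁻¹ (hk.op g)] with η h2
    rw [smul_apply, h2, Pi.smul_apply, smul_eq_mul, mul_inv_cancel_left₀ hκ]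

/-! ### Boundary values of functions in the domain -/

theorem hasDerivAt_kernelTransform {k k' : ℝ → ℝ} {c : ℝ} (hk : Continuous k)
    (hkb : ∀ x, |k x| ≤ 1) (hd : ∀ x, HasDerivAt k (c * k' x) x) (hk' : Continuous k')
    (hkb' : ∀ x, |k' x| ≤ 1) {h : ℝ → ℂ} (h0 : Integrable h μ₀)
    (h1 : Integrable (fun η : ℝ => (η : ℂ) * h η) μ₀) (x : ℝ) :
    HasDerivAt (kernelTransform k h) (c * kernelTransform k' (fun η : ℝ => (η : ℂ) * h η) x) x := by
  have hm := h0.1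
  have hbm : ∀ m : ℝ → ℝ, Continuous m → ∀ y : ℝ,
      AEStronglyMeasurable (fun η => (m (y * η) : ℂ)) μ₀ := fun m hm y => by fun_prop
  have := (hasDerivAt_integral_of_dominated_loc_of_deriv_le (μ := μ₀) (𝕜 := ℝ) (x₀ := x)
    (F := fun y η => h η * (k (y * η) : ℂ))
    (F' := fun y η => h η * ((c * k' (y * η) * η : ℝ) : ℂ))
    (bound := fun η => |c| * ‖(η : ℂ) * h η‖) (s := univ) univ_mem
    (Eventually.of_forall fun y => hm.mul (hbm k hk y))
    (h0.mul_bdd (c := 1) (hbm k hk x) (Eventually.of_forall fun η => by simpa using hkb _))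
    (hm.mul (by fun_prop)) (Eventually.of_forall fun η y _ => ?_) (h1.norm.const_mul _)
    (Eventually.of_forall fun η y _ => ?_)).2
  · refine this.congr_deriv ?_
    rw [kernelTransform, ← integral_const_mul]
    refine integral_congr_ae (Eventually.of_forall fun η => ?_)
    push_cast
    ring
  · rw [norm_mul, norm_mul, Complex.norm_real, Complex.norm_real, Real.norm_eq_abs,
      Real.norm_eq_abs, abs_mul, abs_mul]
    calc ‖h η‖ * (|c| * |k' (y * η)| * |η|) ≤ ‖h η‖ * (|c| * 1 * |η|) := by
          gcongr
          exact hkb' _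
      _ = _ := by ring
  · have hl : HasDerivAt (fun y : ℝ => y * η) η y := by
      simpa using (hasDerivAt_id y).mul_const η
    exact (((hd (y * η)).comp y hl).ofReal_comp).const_mul _

/-- Elements of the domain have a representative that is `C¹` up to the boundary. -/
theorem IsModel.exists_representative {A : L2 →ₗ.[ℂ] L2} {k k' : ℝ → ℝ}
    {hk : IsPlancherelKernel k} (hA : IsModel A hk.unitary) (hk' : IsPlancherelKernel k') {c : ℝ}
    (hd : ∀ x, HasDerivAt k (c * k' x) x) (φ : A.domain) :
    ∃ F : ℝ → ℂ, (φ : L2) =ᵐ[μ₀] F ∧ ContDiff ℝ 1 F ∧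
      (∀ x, F x = ∫ η in Ioi (0 : ℝ), hk.unitary φ η * (κ * k (x * η))) ∧
      ∀ x, HasDerivAt F (∫ η in Ioi (0 : ℝ), hk.unitary φ η * (κ * c * η * k' (x * η))) x := by
  have hφ := hA.map_apply φ
  set h : L2 := hk.unitary φ with hh
  have hm := memLp_mul_of_axisPoint hφ
  have h0 : Integrable h μ₀ := integrable_of_memLp_mul (Lp.memLp h) hm
  have h1 : Integrable (fun η : ℝ => (η : ℂ) * h η) μ₀ := by
    refine integrable_of_memLp_mul hm ((memLp_congr_ae ?_).1 (Lp.memLp (hk.unitary (A φ))).neg)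
    filter_upwards [hφ] with η hη
    rw [Pi.neg_apply, hη, axisPoint]
    ring
  have hder : ∀ x, HasDerivAt (fun x => κ * kernelTransform k h x)
      (κ * (c * kernelTransform k' (fun η : ℝ => (η : ℂ) * h η) x)) x := fun x =>
    (hasDerivAt_kernelTransform hk.continuous hk.abs_le hd hk'.continuous hk'.abs_le h0 h1
      x).const_mul κ
  refine ⟨fun x => κ * kernelTransform k h x, ?_, ?_, fun x => ?_, fun x => ?_⟩
  · have := hk.coeFn_op h0
    rwa [show hk.op h = φ from hk.op_op _] at this
  · refine contDiff_one_iff_deriv.2 ⟨fun x => (hder x).differentiableAt, ?_⟩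
    rw [funext fun x => (hder x).deriv]
    exact ((hk'.continuous_kernelTransform h1).const_mul _).const_mul _
  · beta_reduce
    rw [kernelTransform, ← integral_const_mul]
    exact integral_congr_ae (Eventually.of_forall fun η => by ring)
  · refine (hder x).congr_deriv ?_
    rw [kernelTransform, ← integral_const_mul, ← integral_const_mul]
    exact integral_congr_ae (Eventually.of_forall fun η => by ring)

theorem delta_congr {F G : ℝ → ℂ} (h : EqOn F G (Ici 0)) : delta F = delta G := h self_mem_Ici

theorem deltaPrime_congr {F G : ℝ → ℂ} (h : EqOn F G (Ici 0)) : deltaPrime F = deltaPrime G := by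
  rw [deltaPrime, deltaPrime, derivWithin_congr h (h self_mem_Ici)]

theorem deltaPrime_eq {F : ℝ → ℂ} {F' : ℂ} (h : HasDerivAt F F' 0) : deltaPrime F = -F' := by
  rw [deltaPrime, h.hasDerivWithinAt.derivWithin (uniqueDiffOn_Ici 0 0 self_mem_Ici)]

/-! ### Control through the boundary -/

theorem lintegral_weight_lt_top {w : ℝ → ℂ} {D a r : ℝ} (hD : ∀ η, ‖w η‖ ^ 2 ≤ D * (1 + η ^ 2) ^ a)
    (hr : 1 / 2 < r - a) :
    ∫⁻ η in Ioi (0 : ℝ), ‖w η‖ₑ ^ 2 * ENNReal.ofReal ((1 + η ^ 2) ^ (-r)) < ⊤ := by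
  have hi : Integrable (fun η : ℝ => D * (1 + η ^ 2) ^ (a - r)) μ₀ := by
    have := integrable_rpow_neg_one_add_norm_sq (E := ℝ) (μ := volume) (r := 2 * (r - a))
      (by simp; linarith)
    refine (this.const_mul D).restrict.congr (Eventually.of_forall fun η => ?_)
    simp only [Real.norm_eq_abs, sq_abs]
    congr 2
    ring
  refine lt_of_le_of_lt (lintegral_mono fun η => ?_) hi.lintegral_lt_top
  rw [← ofReal_norm, ← ENNReal.ofReal_pow (norm_nonneg _), ← ENNReal.ofReal_mul (by positivity)]
  refine ENNReal.ofReal_le_ofReal ?_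
  rw [sub_eq_add_neg, Real.rpow_add (by positivity), ← mul_assoc]
  gcongr
  exact hD η

theorem IsModel.exists_control {A : L2 →ₗ.[ℂ] L2} {V : L2 ≃ₗᵢ[ℂ] L2} (hA : IsModel A V) {s : ℂ}
    (hs : s ∈ Complex.slitPlane) {ℓ : (ℝ → ℂ) → ℂ}
    (hℓ : ∀ F G : ℝ → ℂ, EqOn F G (Ici 0) → ℓ F = ℓ G) {w : ℝ → ℂ} (hw : Continuous w)
    (hrep : ∀ φ : A.domain, ∃ F : ℝ → ℂ, (φ : L2) =ᵐ[μ₀] F ∧ ContDiff ℝ 1 F ∧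
      conj (ℓ F) = ∫ η in Ioi (0 : ℝ), conj (V φ η) * w η)
    {v : ℝ → ℝ} (hv : ∀ η : ℝ, 0 < η → 2 * η * v (-η ^ 2) = Real.pi * ‖w η‖ ^ 2)
    {D a : ℝ} (ha : a ≤ 1) (hD : ∀ η, ‖w η‖ ^ 2 ≤ D * (1 + η ^ 2) ^ a)
    {p₀ : ℝ} (hp₀ : 1 ≤ p₀)
    (hp : ∀ p q : ℝ, p₀ < p → p.HolderConjugate q → 1 / 2 < 2 / q - a) :
    ∃ b : Extrapolation A s, Represents A s b ℓ ∧ (∀ b', Represents A s b' ℓ → b' = b) ∧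
      (∃ F : ProjectionValuedMeasure (Extrapolation A s),
        IsSpectralMeasure (extrapolatedOperator A s) F ∧
        EquivalentMeasures (controlMeasure F b) (halfAxisMeasure v)) ∧
      ∀ p : ℝ≥0∞, ENNReal.ofReal p₀ < p → FiniteTimeAdmissible A s (heatSemigroup V)
        (ContinuousLinearMap.toSpanSingleton ℂ b) p := by
  have hD0 : 0 ≤ D := by
    have := (sq_nonneg _).trans (hD 0)
    simpa using this
  have hm : MemLp (fun η => resolventSymbol s η * w η) 2 μ₀ :=
    memLp_resolventSymbol_mul hs hw fun η => (hD η).trans (by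
      gcongr
      exact (Real.rpow_le_rpow_of_exponent_le (by nlinarith [sq_nonneg η]) ha).trans_eq
        (Real.rpow_one _))
  set b : Extrapolation A s := (hA.extrapolationUnitary hs).symm (hm.toLp _) with hb_def
  have hb : hA.extrapolationUnitary hs b =ᵐ[μ₀] fun η => resolventSymbol s η * w η := by
    rw [hb_def, LinearIsometryEquiv.apply_symm_apply]
    exact hm.coeFn_toLp
  have hR : Represents A s b ℓ := by
    intro φ hφ F hF hFc
    obtain ⟨F₀, h1, h2, h3⟩ := hrep ⟨φ, hφ⟩
    rw [hA.pairing_eq_integral hs ⟨φ, hφ⟩ hb, ← h3,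
      hℓ F₀ F (eqOn_Ici_of_ae_eq h2.continuous.continuousOn hFc.continuousOn (h1.symm.trans hF))]
  refine ⟨b, hR, fun b' hb' => hA.eq_of_pairing_eq hs fun φ => ?_,
    ⟨spectralPVM (hA.extrapolationUnitary hs), (hA.extrapolated hs).isSpectralMeasure, ?_⟩,
    fun p hpp => ?_⟩
  · obtain ⟨F₀, h1, h2, -⟩ := hrep φ
    rw [hR φ φ.2 F₀ h1 h2.contDiffOn, hb' φ φ.2 F₀ h1 h2.contDiffOn]
  · rw [halfAxisMeasure_eq_axisMeasure (Eventually.of_forall hv)]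
    exact hA.equivalentMeasures hs hw hb
  · obtain ⟨r, hr1, hr2⟩ := ENNReal.lt_iff_exists_real_btwn.1 hpp |>.imp fun r h => h.2
    have hr : p₀ < r := (ENNReal.ofReal_lt_ofReal_iff_of_nonneg (by linarith)).1 hr1
    have hq := Real.HolderConjugate.conjExponent (lt_of_le_of_lt hp₀ hr)
    refine (hA.finiteTimeAdmissible hs hw hb hq
      (lintegral_weight_lt_top hD (hp _ _ hr hq))).mono_exponent ?_ hr2.le
    simpa using by linarith

/-! ### The Dirichlet and the Neumann Laplacian -/

theorem two_div_conjExponent_sub {p q : ℝ} (h : p.HolderConjugate q) : 2 / q = 2 - 2 / p := by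
  have := h.inv_add_inv_eq_one
  rw [div_eq_mul_inv, div_eq_mul_inv]
  linarith

theorem norm_sq_normalization : ‖κ‖ ^ 2 = 2 / Real.pi := by
  rw [Complex.norm_real, Real.norm_of_nonneg (by positivity), Real.sq_sqrt (by positivity)]

theorem deltaPrime_sin (t : ℝ) : deltaPrime (fun ξ => (Real.sin (t * ξ) : ℂ)) = -(t : ℂ) := by
  refine deltaPrime_eq ?_
  have h : HasDerivAt (fun ξ : ℝ => Real.sin (t * ξ)) (Real.cos (t * 0) * (t * 1)) 0 :=
    ((hasDerivAt_id (0 : ℝ)).const_mul t).sin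
  simpa using h.ofReal_comp

theorem delta_cos (t : ℝ) : delta (fun ξ => (Real.cos (t * ξ) : ℂ)) = 1 := by
  simp [delta]

theorem sq_div_sqrt (x : ℝ) : √|x| ^ 2 / √|x| = |x| ^ (1 / 2 : ℝ) := by
  rw [← Real.sqrt_eq_rpow, sq, mul_self_div_self]

theorem one_div_sqrt (x : ℝ) : 1 / √|x| = |x| ^ (-(1 / 2) : ℝ) := by
  rw [Real.rpow_neg (abs_nonneg x), ← Real.sqrt_eq_rpow, one_div]

theorem exists_control_dirichlet {s : ℂ} (hs : s ∈ Complex.slitPlane) :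
    ∃ b : Extrapolation dirichletLaplacian s, Represents dirichletLaplacian s b deltaPrime ∧
      (∀ b', Represents dirichletLaplacian s b' deltaPrime → b' = b) ∧
      (∃ F : ProjectionValuedMeasure (Extrapolation dirichletLaplacian s),
        IsSpectralMeasure (extrapolatedOperator dirichletLaplacian s) F ∧
        EquivalentMeasures (controlMeasure F b) (halfAxisMeasure fun z => |z| ^ (1 / 2 : ℝ))) ∧
      ∀ p : ℝ≥0∞, 4 < p → FiniteTimeAdmissible dirichletLaplacian s
        (heatSemigroup isPlancherelKernel_sin.unitary)
        (ContinuousLinearMap.toSpanSingleton ℂ b) p := by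
  have h := isModel_dirichlet.exists_control hs (fun F G => deltaPrime_congr)
    (w := fun η => -(κ * η)) (by fun_prop) (fun φ => ?_)
    (v := fun z => |z| ^ (1 / 2 : ℝ)) (fun η h0 => ?_) (D := 2 / Real.pi) (a := 1) le_rfl
    (fun η => ?_) (p₀ := 4) (by norm_num) (fun p q hp hpq => ?_)
  · simpa using h
  · obtain ⟨F, h1, h2, -, h3⟩ := isModel_dirichlet.exists_representative isPlancherelKernel_cos
      (c := 1) (fun x => by simpa using Real.hasDerivAt_sin x) φ
    refine ⟨F, h1, h2, ?_⟩
    rw [deltaPrime_eq (h3 0), map_neg, ← integral_conj, ← integral_neg]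
    refine integral_congr_ae (Eventually.of_forall fun η => ?_)
    simp [Complex.conj_ofReal]
  · have := Real.pi_pos
    rw [← sq_div_sqrt, sqrt_abs_neg_sq h0, norm_neg, norm_mul, mul_pow, norm_sq_normalization,
      Complex.norm_real, Real.norm_of_nonneg h0.le]
    field_simp
  · rw [norm_neg, norm_mul, mul_pow, norm_sq_normalization, Complex.norm_real, Real.norm_eq_abs,
      sq_abs, Real.rpow_one]
    have := Real.pi_pos
    gcongr
    linarith
  · have : 2 / p < 1 / 2 := by
      rw [div_lt_div_iff₀ (by linarith) two_pos]
      linarith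
    rw [two_div_conjExponent_sub hpq]
    linarith

theorem exists_control_neumann {s : ℂ} (hs : s ∈ Complex.slitPlane) :
    ∃ b : Extrapolation neumannLaplacian s, Represents neumannLaplacian s b delta ∧
      (∀ b', Represents neumannLaplacian s b' delta → b' = b) ∧
      (∃ F : ProjectionValuedMeasure (Extrapolation neumannLaplacian s),
        IsSpectralMeasure (extrapolatedOperator neumannLaplacian s) F ∧
        EquivalentMeasures (controlMeasure F b) (halfAxisMeasure fun z => |z| ^ (-(1 / 2) : ℝ))) ∧
      ∀ p : ℝ≥0∞, 4 / 3 < p → FiniteTimeAdmissible neumannLaplacian s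
        (heatSemigroup isPlancherelKernel_cos.unitary)
        (ContinuousLinearMap.toSpanSingleton ℂ b) p := by
  have h := isModel_neumann.exists_control hs (fun F G => delta_congr)
    (w := fun _ => κ) continuous_const (fun φ => ?_)
    (v := fun z => |z| ^ (-(1 / 2) : ℝ)) (fun η h0 => ?_) (D := 2 / Real.pi) (a := 0) zero_le_one
    (fun η => ?_) (p₀ := 4 / 3) (by norm_num) (fun p q hp hpq => ?_)
  · rwa [ENNReal.ofReal_div_of_pos (by norm_num), ENNReal.ofReal_ofNat, ENNReal.ofReal_ofNat] at h
  · obtain ⟨F, h1, h2, h3, -⟩ := isModel_neumann.exists_representative isPlancherelKernel_sin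
      (c := -1) (fun x => by simpa using Real.hasDerivAt_cos x) φ
    refine ⟨F, h1, h2, ?_⟩
    rw [delta, h3 0, ← integral_conj]
    refine integral_congr_ae (Eventually.of_forall fun η => ?_)
    simp [Complex.conj_ofReal]
  · have := Real.pi_pos
    rw [← one_div_sqrt, sqrt_abs_neg_sq h0, norm_sq_normalization]
    field_simp
  · rw [norm_sq_normalization, Real.rpow_zero, mul_one]
  · have : 2 / p < 3 / 2 := by
      rw [div_lt_div_iff₀ (by linarith) two_pos]
      linarith
    rw [two_div_conjExponent_sub hpq]
    linarith

end HalfLine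

end

theorem mainTheorem10 :
    -- Dirichlet Laplacian with control `δ₀'`
    ((∀ z ∈ Complex.slitPlane, z ∈ HalfLine.resolventSet HalfLine.dirichletLaplacian ∧
        ∀ g : HalfLine.L2, Integrable g (volume.restrict (Ioi 0)) →
          HalfLine.resolvent HalfLine.dirichletLaplacian z g =ᵐ[volume.restrict (Ioi 0)] fun x =>
            2 / (Real.pi : ℂ) * ∫ η in Ioi (0 : ℝ),
              (Real.sin (x * η) : ℂ) / (z + (η : ℂ) ^ 2) * HalfLine.sineTransform g η) ∧
      (∃ E : HalfLine.ProjectionValuedMeasure HalfLine.L2,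
        HalfLine.IsSpectralMeasure HalfLine.dirichletLaplacian E ∧
        (∀ g : HalfLine.L2, Integrable g (volume.restrict (Ioi 0)) →
          E.scalar g = HalfLine.halfAxisMeasure fun z =>
            ‖HalfLine.sineTransform g (√|z|)‖ ^ 2 / (Real.pi * √|z|)) ∧
        ∃ S : HalfLine.L2 →L[ℂ] HalfLine.L2,
          (∀ g : HalfLine.L2, Integrable g (volume.restrict (Ioi 0)) →
            S g =ᵐ[volume.restrict (Ioi 0)] HalfLine.sineTransform g) ∧
          ∀ g : HalfLine.L2, E.scalar g = HalfLine.halfAxisMeasure fun z =>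
            ‖S g (√|z|)‖ ^ 2 / (Real.pi * √|z|)) ∧
      (∀ t : ℝ, HalfLine.deltaPrime (fun ξ => (Real.sin (t * ξ) : ℂ)) = -(t : ℂ)) ∧
      HalfLine.halfAxisMeasure
          (fun z => ‖HalfLine.deltaPrime (fun ξ => (Real.sin (√|z| * ξ) : ℂ))‖ ^ 2 / √|z|) =
        HalfLine.halfAxisMeasure (fun z => |z| ^ (1 / 2 : ℝ)) ∧
      ∃ T : HalfLine.C0Semigroup HalfLine.L2,
        HalfLine.IsGenerator HalfLine.dirichletLaplacian T ∧
        ∀ s ∈ HalfLine.resolventSet HalfLine.dirichletLaplacian,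
          ∃ b : HalfLine.Extrapolation HalfLine.dirichletLaplacian s,
            HalfLine.Represents HalfLine.dirichletLaplacian s b HalfLine.deltaPrime ∧
            (∀ b', HalfLine.Represents HalfLine.dirichletLaplacian s b' HalfLine.deltaPrime →
              b' = b) ∧
            (∃ F : HalfLine.ProjectionValuedMeasure
                (HalfLine.Extrapolation HalfLine.dirichletLaplacian s),
              HalfLine.IsSpectralMeasure
                (HalfLine.extrapolatedOperator HalfLine.dirichletLaplacian s) F ∧
              HalfLine.EquivalentMeasures (HalfLine.controlMeasure F b)
                (HalfLine.halfAxisMeasure fun z => |z| ^ (1 / 2 : ℝ))) ∧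
            ∀ p : ℝ≥0∞, 4 < p →
              HalfLine.FiniteTimeAdmissible HalfLine.dirichletLaplacian s T
                (ContinuousLinearMap.toSpanSingleton ℂ b) p) ∧
    -- Neumann Laplacian with control `δ₀`
    ((∀ z ∈ Complex.slitPlane, z ∈ HalfLine.resolventSet HalfLine.neumannLaplacian ∧
        ∀ g : HalfLine.L2, Integrable g (volume.restrict (Ioi 0)) →
          HalfLine.resolvent HalfLine.neumannLaplacian z g =ᵐ[volume.restrict (Ioi 0)] fun x =>
            2 / (Real.pi : ℂ) * ∫ η in Ioi (0 : ℝ),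
              (Real.cos (x * η) : ℂ) / (z + (η : ℂ) ^ 2) * HalfLine.cosineTransform g η) ∧
      (∃ E : HalfLine.ProjectionValuedMeasure HalfLine.L2,
        HalfLine.IsSpectralMeasure HalfLine.neumannLaplacian E ∧
        (∀ g : HalfLine.L2, Integrable g (volume.restrict (Ioi 0)) →
          E.scalar g = HalfLine.halfAxisMeasure fun z =>
            ‖HalfLine.cosineTransform g (√|z|)‖ ^ 2 / (Real.pi * √|z|)) ∧
        ∃ S : HalfLine.L2 →L[ℂ] HalfLine.L2,
          (∀ g : HalfLine.L2, Integrable g (volume.restrict (Ioi 0)) →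
            S g =ᵐ[volume.restrict (Ioi 0)] HalfLine.cosineTransform g) ∧
          ∀ g : HalfLine.L2, E.scalar g = HalfLine.halfAxisMeasure fun z =>
            ‖S g (√|z|)‖ ^ 2 / (Real.pi * √|z|)) ∧
      (∀ t : ℝ, HalfLine.delta (fun ξ => (Real.cos (t * ξ) : ℂ)) = 1) ∧
      HalfLine.halfAxisMeasure
          (fun z => ‖HalfLine.delta (fun ξ => (Real.cos (√|z| * ξ) : ℂ))‖ ^ 2 / √|z|) =
        HalfLine.halfAxisMeasure (fun z => |z| ^ (-(1 / 2) : ℝ)) ∧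
      ∃ T : HalfLine.C0Semigroup HalfLine.L2,
        HalfLine.IsGenerator HalfLine.neumannLaplacian T ∧
        ∀ s ∈ HalfLine.resolventSet HalfLine.neumannLaplacian,
          ∃ b : HalfLine.Extrapolation HalfLine.neumannLaplacian s,
            HalfLine.Represents HalfLine.neumannLaplacian s b HalfLine.delta ∧
            (∀ b', HalfLine.Represents HalfLine.neumannLaplacian s b' HalfLine.delta →
              b' = b) ∧
            (∃ F : HalfLine.ProjectionValuedMeasure
                (HalfLine.Extrapolation HalfLine.neumannLaplacian s),
              HalfLine.IsSpectralMeasure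
                (HalfLine.extrapolatedOperator HalfLine.neumannLaplacian s) F ∧
              HalfLine.EquivalentMeasures (HalfLine.controlMeasure F b)
                (HalfLine.halfAxisMeasure fun z => |z| ^ (-(1 / 2) : ℝ))) ∧
            ∀ p : ℝ≥0∞, 4 / 3 < p →
              HalfLine.FiniteTimeAdmissible HalfLine.neumannLaplacian s T
                (ContinuousLinearMap.toSpanSingleton ℂ b) p) := by
  refine ⟨⟨fun z hz => ⟨HalfLine.isModel_dirichlet.mem_resolventSet hz,
      fun g hg => HalfLine.isModel_dirichlet.resolvent_eq_integral hz hg⟩,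
    HalfLine.isModel_dirichlet.exists_spectralMeasure, HalfLine.deltaPrime_sin, ?_, _,
    HalfLine.isModel_dirichlet.isGenerator,
    fun s hs => HalfLine.exists_control_dirichlet (HalfLine.isModel_dirichlet.mem_slitPlane hs)⟩,
    fun z hz => ⟨HalfLine.isModel_neumann.mem_resolventSet hz,
      fun g hg => HalfLine.isModel_neumann.resolvent_eq_integral hz hg⟩,
    HalfLine.isModel_neumann.exists_spectralMeasure, HalfLine.delta_cos, ?_, _,
    HalfLine.isModel_neumann.isGenerator,
    fun s hs => HalfLine.exists_control_neumann (HalfLine.isModel_neumann.mem_slitPlane hs)⟩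
  · congr 1
    funext z
    rw [HalfLine.deltaPrime_sin, norm_neg, Complex.norm_real,
      Real.norm_of_nonneg (Real.sqrt_nonneg _), HalfLine.sq_div_sqrt]
  · congr 1
    funext z
    rw [HalfLine.delta_cos, norm_one, one_pow, HalfLine.one_div_sqrt]
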